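/- All graphs are finite and simple. A C3CBP (Barnette graph) is a graph that is cubic (all degrees equal $3$), $3$-connected (it has more than $3$ vertices and deleting any set of at most $2$ vertices leaves a connected graph), bipartite and planar. Let $C_1$ be the graph of the cube. The two reductions are defined as follows (up to isomorphism). - $G(R_0)G'$: in a plane embedding of $G$ there is a face bounded by a $4$-cycle $v_0v_1v_2v_3$, where $v_i$ has a neighbour $u_i$ for each $i$ and the eight vertices $v_0,\dots,v_3,u_0,\dots,u_3$ are distinct; $G'$ is obtained from $G$ by deleting $v_0,v_1,v_2,v_3$ and adding the edges $u_0u_1$ and $u_2u_3$. (The choice of labels leaves two ways to reduce at a given $4$-face: adding $u_0u_1,u_2u_3$, or adding $u_1u_2,u_3u_0$.) - $G(R_4)G'$: $G$ contains ten distinct vertices $j,g,h,i,a,b,c,d,e,f$ and the edges $jg,jh,ji,ah,ai,bg,bh,cg,ci$ (a cube with one vertex removed) and $ad,be,cf$; $G'$ is obtained from $G$ by deleting $g,h,i,a,b,c$ and adding the edges $jd,je,jf$. Theorem. Let $G$ be a C3CBP with more than $8$ vertices. Then there is a C3CBP $G'$ with fewer vertices than $G$ such that $G(R_0)G'$ or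 $G(R_4)G'$. Moreover, $C_1$ is a C3CBP, and it is, up to isomorphism, the only C3CBP on $8$ or fewer vertices. For every C3CBP $G$, however one repeatedly applies reductions $R_0$ and $R_4$ that lead to C3CBPs, after finitely many steps one arrives at $C_1$ (and as long as $C_1$ is not reached, such a reduction is possible). Consequently every C3CBP can be generated from $C_1$ by successively applying the reverse operations of $R_0$ and $R_4$, with a C3CBP obtained after each step. -/

import Mathlib

universe u

/-- Every vertex has degree three. -/
def IsCubic {V : Type u} (G : SimpleGraph V) : Prop :=
  ∀ v : V, (G.neighborSet v).ncard = 3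

/-- A finite graph is `k`-connected if it has more than `k` vertices and the deletion of any set of
fewer than `k` vertices leaves a connected graph. -/
def IsKConnected {V : Type u} (k : ℕ) (G : SimpleGraph V) : Prop :=
  k < Nat.card V ∧ ∀ S : Finset V, S.card < k → (G.induce ((S : Set V)ᶜ)).Connected

/-- The dart following `d` on the boundary of the face incident with `d`, when `rot` lists, for
every vertex, the darts leaving it in their cyclic order around it: traverse `d` and leave its
end vertex along the dart that comes next, in the cyclic order there, after the reversal of `d`. -/
def facePerm {V : Type u} {G : SimpleGraph V} (rot : Equiv.Perm G.Dart) : Equiv.Perm G.Dart :=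
  (Function.Involutive.toPerm SimpleGraph.Dart.symm SimpleGraph.Dart.symm_involutive).trans rot

/-- An embedding of the finite graph `G` in the sphere (equivalently, in the plane), up to
homeomorphism, given by its rotation system: a cyclic order of the darts (oriented edges) leaving
each vertex, whose faces satisfy Euler's formula. The formula is written for a graph with any number
of components, each embedded in a sphere of its own; an isolated vertex contributes one face,
which carries no darts. For a connected graph with an edge it reads `|V| - |E| + |F| = 2`. -/
structure PlaneEmbedding {V : Type u} [Finite V] (G : SimpleGraph V) where
  /-- the next dart in the cyclic order around the initial vertex -/
  rot : Equiv.Perm G.Dart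
  rot_fst : ∀ d : G.Dart, (rot d).fst = d.fst
  rot_cyclic : ∀ d e : G.Dart, d.fst = e.fst → rot.SameCycle d e
  euler : Nat.card V
      + (Nat.card (Quotient (Equiv.Perm.SameCycle.setoid (facePerm rot)))
        + {v : V | G.neighborSet v = ∅}.ncard)
    = G.edgeSet.ncard + 2 * Nat.card G.ConnectedComponent

/-- A finite graph is planar if it has an embedding in the plane. -/
def IsPlanar {V : Type u} [Finite V] (G : SimpleGraph V) : Prop :=
  Nonempty (PlaneEmbedding G)

/-- The vertices met in succession along the boundary of some face are
`v₀, v₁, v₂, v₃`, after which the boundary closes up. -/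
def PlaneEmbedding.IsFourFace {V : Type u} [Finite V] {G : SimpleGraph V} (M : PlaneEmbedding G)
    (v₀ v₁ v₂ v₃ : V) : Prop :=
  ∃ d : G.Dart, d.fst = v₀ ∧ (facePerm M.rot d).fst = v₁ ∧
    (facePerm M.rot (facePerm M.rot d)).fst = v₂ ∧
    (facePerm M.rot (facePerm M.rot (facePerm M.rot d))).fst = v₃ ∧
    facePerm M.rot (facePerm M.rot (facePerm M.rot (facePerm M.rot d))) = d

/-- C3CBP, or Barnette graph: a finite, simple, cubic, 3-connected, bipartite, planar graph. -/
structure IsC3CBP {V : Type u} [Finite V] (G : SimpleGraph V) : Prop where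
  cubic : IsCubic G
  connected : IsKConnected 3 G
  bipartite : G.IsBipartite
  planar : IsPlanar G

/-- The graph `C₁` of the cube: an outer 4-cycle `0 1 2 3`, an inner 4-cycle `4 5 6 7`, and the
four edges joining corresponding vertices. -/
def cubeGraph : SimpleGraph (Fin 8) :=
  SimpleGraph.fromEdgeSet
    {s(0, 1), s(1, 2), s(2, 3), s(3, 0), s(4, 5), s(5, 6), s(6, 7), s(7, 4),
      s(0, 4), s(1, 5), s(2, 6), s(3, 7)}

/-- `G(R₀)G'`: the graph `G'` arises from `G` by deleting the four vertices `v₀ v₁ v₂ v₃` of a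
4-face, whose neighbours off the face are `u₀ u₁ u₂ u₃` respectively, and adding the two edges
`u₀u₁` and `u₂u₃`. The other choice of the two edges, `u₁u₂` and `u₃u₀`, is covered by listing the
face from `v₁` on. -/
def ReducesR0 {V V' : Type u} [Finite V] (G : SimpleGraph V) (G' : SimpleGraph V') : Prop :=
  ∃ (M : PlaneEmbedding G) (v₀ v₁ v₂ v₃ u₀ u₁ u₂ u₃ : V),
    [v₀, v₁, v₂, v₃, u₀, u₁, u₂, u₃].Nodup ∧
    M.IsFourFace v₀ v₁ v₂ v₃ ∧
    G.Adj v₀ u₀ ∧ G.Adj v₁ u₁ ∧ G.Adj v₂ u₂ ∧ G.Adj v₃ u₃ ∧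
    Nonempty (G' ≃g (G ⊔ SimpleGraph.edge u₀ u₁ ⊔ SimpleGraph.edge u₂ u₃).induce
      (({v₀, v₁, v₂, v₃} : Set V)ᶜ))

/-- `G(R₄)G'`: the graph `G` contains a cube with one vertex removed, consisting of `j`, its
neighbours `g h i`, and the vertices `a` (joined to `h i`), `b` (joined to `g h`), `c` (joined to
`g i`), which is attached to the rest of `G` by the edges `ad`, `be`, `cf`; and `G'` arises by
replacing it with the single vertex `j`, joined to `d e f`. -/
def ReducesR4 {V V' : Type u} (G : SimpleGraph V) (G' : SimpleGraph V') : Prop :=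
  ∃ j g h i a b c d e f : V,
    [j, g, h, i, a, b, c, d, e, f].Nodup ∧
    G.Adj j g ∧ G.Adj j h ∧ G.Adj j i ∧
    G.Adj a h ∧ G.Adj a i ∧ G.Adj b g ∧ G.Adj b h ∧ G.Adj c g ∧ G.Adj c i ∧
    G.Adj a d ∧ G.Adj b e ∧ G.Adj c f ∧
    Nonempty (G' ≃g (G ⊔ SimpleGraph.edge j d ⊔ SimpleGraph.edge j e ⊔ SimpleGraph.edge j f).induce
      (({g, h, i, a, b, c} : Set V)ᶜ))

/-- The graphs obtained from the cube by successive reversed reductions `R₀` and `R₄`, where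
the graph obtained after each step is a C3CBP. -/
inductive GeneratedFromCube : {V : Type u} → [Finite V] → SimpleGraph V → Prop
  | cube {V : Type u} [Finite V] {G : SimpleGraph V} :
      Nonempty (G ≃g cubeGraph) → GeneratedFromCube G
  | reverseR0 {V V' : Type u} [Finite V] [Finite V'] {G : SimpleGraph V} {G' : SimpleGraph V'} :
      GeneratedFromCube G' → IsC3CBP G → ReducesR0 G G' → GeneratedFromCube G
  | reverseR4 {V V' : Type u} [Finite V] [Finite V'] {G : SimpleGraph V} {G' : SimpleGraph V'} :
      GeneratedFromCube G' → IsC3CBP G → ReducesR4 G G' → GeneratedFromCube G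

/-- However one repeatedly reduces `G` by `R₀` and `R₄` to C3CBPs, after finitely many steps one
arrives at the cube: `G` is the cube, or it can be reduced to some C3CBP and each C3CBP it
reduces to has this property. -/
inductive AlwaysReducesToCube : {V : Type u} → [Finite V] → SimpleGraph V → Prop
  | cube {V : Type u} [Finite V] {G : SimpleGraph V} :
      Nonempty (G ≃g cubeGraph) → AlwaysReducesToCube G
  | step {V : Type u} [Finite V] {G : SimpleGraph V} :
      (∃ (V' : Type u) (_ : Finite V') (G' : SimpleGraph V'),
        IsC3CBP G' ∧ (ReducesR0 G G' ∨ ReducesR4 G G')) →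
      (∀ (V' : Type u) [Finite V'] (G' : SimpleGraph V'),
        IsC3CBP G' → ReducesR0 G G' ∨ ReducesR4 G G' → AlwaysReducesToCube G') →
      AlwaysReducesToCube G

/-!
Every Barnette graph other than the cube has one of the two reductions.

Work with edge cuts. In a cubic graph, 3-connectedness is the same as every proper nonempty vertex
set having at least three outgoing edges (`IsKConnected.isThreeEdgeConnected` and its converse), and
if the graph is bipartite and `X` has exactly three outgoing edges, then these leave `X` from
vertices of one colour (`colour_eq_of_cutSize_eq_three`).

A set `X` of at least two vertices with exactly three outgoing edges contains all vertices of some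
4-face (`exists_fourFace_within`): otherwise all faces inside `X` have length at least six, and
Euler's formula for the subgraph spanned by `X` gives a contradiction. Choose such an `X` with as
few vertices as possible, and a 4-face `v 0, v 1, v 2, v 3` in it. It has two reductions `R₀`, and
each of them leads to a Barnette graph unless a set with four outgoing edges separates `v 0`, `v 1`
and their neighbours from `v 2`, `v 3` and theirs, or the same for the indices shifted by one
(`IsSquare.isC3CBP_or`). If both are obstructed, then the two sets cross and, by counting edges, the
graph is a cube whose four vertices off the face are replaced by sets with three outgoing edges
(`exists_isCubeLike`). By minimality, each of these sets has at most one vertex in `X`, and then `X`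
is the cube minus a vertex (`IsCubeLike.exists_isCubeMinusVertex`). This is attached to the rest of
the graph by three edges; either they end in one vertex and the graph is the cube, or they end in
three different ones and `R₄` leads to a Barnette graph, because each of its cuts is a cut of the
original graph (`IsCubeMinusVertex.isC3CBP`).

Planarity is that of rotation systems. For an arbitrary rotation system and any set of edges, the
number of faces is at most that given by Euler's formula, and in the planar case equality is
inherited by subgraphs (`numCycles_facePermIn`). Both reductions replace some paths of length three
by edges and delete the rest, so that the reduced graph has at least as many faces as a subgraph
of `G` and hence enough of them to be planar (`isPlanar_of_topologicalMinor`).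
-/

/-! ### Counting cycles of permutations -/

/-- The number of cycles of a permutation, fixed points included. -/
noncomputable def numCycles {D : Type*} (π : Equiv.Perm D) : ℕ :=
  Nat.card (Quotient (Equiv.Perm.SameCycle.setoid π))

/-- Gluing two classes of an equivalence relation lowers the number of classes by at most one. -/
lemma card_quotient_le_succ_of_glue {D : Type*} [Finite D] (r r' : Setoid D) (x y : D)
    (h : ∀ a b, r' a b → r a b ∨ ((r a x ∨ r a y) ∧ (r b x ∨ r b y))) :
    Nat.card (Quotient r) ≤ Nat.card (Quotient r') + 1 := by
  classical
  have key : Function.Injective (fun q : Quotient r =>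
      if q = Quotient.mk r y then (none : Option (Quotient r'))
      else some (Quotient.mk r' q.out)) := by
    intro p q hpq
    by_cases hp : p = Quotient.mk r y <;> by_cases hq : q = Quotient.mk r y
    · rw [hp, hq]
    · simp [hp, hq] at hpq
    · simp [hp, hq] at hpq
    · simp only [hp, hq, if_false, Option.some.injEq] at hpq
      have h1 : r' p.out q.out := Quotient.exact hpq
      have np : ¬ r p.out y := fun h2 => hp (by rw [← Quotient.out_eq p]; exact Quotient.sound h2)
      have nq : ¬ r q.out y := fun h2 => hq (by rw [← Quotient.out_eq q]; exact Quotient.sound h2)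
      have h3 : r p.out q.out := by
        rcases h _ _ h1 with h2 | ⟨h2, h4⟩
        · exact h2
        · exact r.trans (h2.resolve_right np) (r.symm (h4.resolve_right nq))
      rw [← Quotient.out_eq p, ← Quotient.out_eq q]
      exact Quotient.sound h3
  have := Nat.card_le_card_of_injective _ key
  rwa [Finite.card_option] at this

/-- Passing to a strictly coarser equivalence relation lowers the number of classes. -/
lemma card_quotient_lt_of_coarser {D : Type*} [Finite D] (r r' : Setoid D) (x y : D)
    (h : ∀ a b, r a b → r' a b) (hxy : r' x y) (hn : ¬ r x y) :
    Nat.card (Quotient r') < Nat.card (Quotient r) := by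
  classical
  have := Fintype.ofFinite (Quotient r)
  have := Fintype.ofFinite (Quotient r')
  rw [Nat.card_eq_fintype_card, Nat.card_eq_fintype_card]
  refine Fintype.card_lt_of_surjective_not_injective (Quotient.map' (s₁ := r) (s₂ := r') id h)
    ?_ ?_
  · intro q
    induction q using Quotient.inductionOn with
    | h a => exact ⟨Quotient.mk r a, rfl⟩
  · intro hinj
    exact hn (Quotient.exact (@hinj (Quotient.mk r x) (Quotient.mk r y) (Quotient.sound hxy)))

open Equiv Equiv.Perm in
/-- If a relation contains every step `z ↦ π z`, it contains the cycles of `π`. -/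
lemma rel_of_sameCycle {D : Type*} (r : Setoid D) (π : Perm D) (h : ∀ z, r z (π z))
    {a b : D} (hab : π.SameCycle a b) : r a b := by
  obtain ⟨n, rfl⟩ := hab
  have hn : ∀ (k : ℕ) (z : D), r z ((π ^ k) z) := by
    intro k
    induction k with
    | zero => intro z; exact r.refl _
    | succ k ih =>
      intro z
      rw [pow_succ', Perm.mul_apply]
      exact r.trans (ih z) (h _)
  cases n with
  | ofNat k => simpa using hn k a
  | negSucc k =>
    have := hn (k + 1) ((π ^ (Int.negSucc k)) a)
    rw [zpow_negSucc, ← Perm.mul_apply, mul_inv_cancel] at this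
    rw [zpow_negSucc]
    exact r.symm this

open Equiv Equiv.Perm in
/-- Multiplying by a transposition splits at most one cycle in two. -/
lemma numCycles_le_succ_mul_swap {D : Type*} [Finite D] [DecidableEq D] (π : Perm D) (x y : D) :
    numCycles (π * swap x y) ≤ numCycles π + 1 := by
  refine card_quotient_le_succ_of_glue (SameCycle.setoid _) (SameCycle.setoid π) x y ?_
  set ρ := π * swap x y with hρ
  have hπ : ∀ z, π z = ρ (swap x y z) := fun z => by simp [hρ]
  let J : Setoid D :=
    { r := fun a b => ρ.SameCycle a b ∨
        ((ρ.SameCycle a x ∨ ρ.SameCycle a y) ∧ (ρ.SameCycle b x ∨ ρ.SameCycle b y))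
      iseqv := by
        refine ⟨fun a => Or.inl (SameCycle.refl _ _), ?_, ?_⟩
        · rintro a b (h | ⟨h, h'⟩)
          · exact Or.inl h.symm
          · exact Or.inr ⟨h', h⟩
        · rintro a b c (h | ⟨h, h'⟩) (k | ⟨k, k'⟩)
          · exact Or.inl (h.trans k)
          · exact Or.inr ⟨k.imp h.trans h.trans, k'⟩
          · exact Or.inr ⟨h, h'.imp k.symm.trans k.symm.trans⟩
          · exact Or.inr ⟨h, k'⟩ }
  intro a b hab
  refine rel_of_sameCycle J π (fun z => ?_) hab
  rw [hπ]
  by_cases hx : z = x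
  · subst hx
    refine Or.inr ⟨Or.inl (SameCycle.refl _ _), Or.inr ?_⟩
    rw [swap_apply_left]
    exact (SameCycle.refl ρ y).apply_left
  by_cases hy : z = y
  · subst hy
    refine Or.inr ⟨Or.inr (SameCycle.refl _ _), Or.inl ?_⟩
    rw [swap_apply_right]
    exact (SameCycle.refl ρ x).apply_left
  rw [swap_apply_of_ne_of_ne hx hy]
  exact Or.inl ((SameCycle.refl ρ z).apply_right)

open Equiv Equiv.Perm in
/-- Multiplying by a transposition of points of different cycles merges these cycles. -/
lemma numCycles_mul_swap_lt {D : Type*} [Finite D] [DecidableEq D] (π : Perm D) (x y : D)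
    (hxy : ¬ π.SameCycle x y) : numCycles (π * swap x y) < numCycles π := by
  set ρ := π * swap x y with hρ
  have hx : ρ x = π y := by simp [hρ]
  have hy : ρ y = π x := by simp [hρ]
  have ho : ∀ z, z ≠ x → z ≠ y → ρ z = π z := fun z h1 h2 => by
    simp [hρ, swap_apply_of_ne_of_ne h1 h2]
  have hm : ρ.SameCycle x y := by
    by_contra hn
    have hk : ∀ k : ℕ, ρ.SameCycle x ((π ^ (k + 1)) y) := by
      intro k
      induction k with
      | zero => rw [zero_add, pow_one, ← hx]; exact (SameCycle.refl ρ x).apply_right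
      | succ k ih =>
        rw [pow_succ', Perm.mul_apply]
        have h1 : (π ^ (k + 1)) y ≠ x := fun h =>
          hxy (h ▸ ((SameCycle.refl π y).pow_left (n := k + 1)))
        have h2 : (π ^ (k + 1)) y ≠ y := fun h => hn (by rwa [h] at ih)
        rw [← ho _ h1 h2]
        exact ih.apply_right
    have h1 := hk (orderOf π - 1)
    have h2 : orderOf π - 1 + 1 = orderOf π := Nat.sub_add_cancel (orderOf_pos π)
    rw [h2, pow_orderOf_eq_one] at h1
    exact hn h1
  refine card_quotient_lt_of_coarser (SameCycle.setoid π) (SameCycle.setoid ρ) x y ?_ hm hxy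
  intro a b hab
  refine rel_of_sameCycle (SameCycle.setoid ρ) π (fun z => ?_) hab
  change ρ.SameCycle z (π z)
  by_cases h1 : z = x
  · rw [h1, ← hy]; exact hm.apply_right
  by_cases h2 : z = y
  · rw [h2, ← hx]; exact hm.symm.apply_right
  rw [← ho z h1 h2]
  exact (SameCycle.refl ρ z).apply_right

/-- If an invariant function takes at least `n` values, there are at least `n` cycles. -/
lemma le_numCycles_of_surjective {D : Type*} [Finite D] (π : Equiv.Perm D) {C : Type*} (f : D → C)
    (hf : ∀ d, f (π d) = f d) (hs : Function.Surjective f) : Nat.card C ≤ numCycles π := by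
  have h : ∀ a b, (Equiv.Perm.SameCycle.setoid π) a b → f a = f b := fun a b hab =>
    rel_of_sameCycle (Setoid.ker f) π (fun z => (hf z).symm) hab
  refine Nat.card_le_card_of_surjective (Quotient.lift f h) fun c => ?_
  obtain ⟨d, rfl⟩ := hs c
  exact ⟨Quotient.mk _ d, rfl⟩

/-! ### Euler's formula for the spanning subgraphs of an embedded graph -/

namespace SimpleGraph

variable {V : Type*} {G : SimpleGraph V}

instance [Finite V] : Finite G.Dart :=
  Finite.of_injective _ (Dart.toProd_injective (G := G))

open Classical in
/-- The involution that reverses the darts of the edges in `S` and fixes all other darts. -/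
noncomputable def revIn (G : SimpleGraph V) (S : Set (Sym2 V)) : Equiv.Perm G.Dart :=
  Function.Involutive.toPerm (fun d => if d.edge ∈ S then d.symm else d) (by
    intro d
    by_cases h : d.edge ∈ S <;> simp [h])

lemma revIn_of_mem {S : Set (Sym2 V)} {d : G.Dart} (h : d.edge ∈ S) : G.revIn S d = d.symm :=
  if_pos h

lemma revIn_of_notMem {S : Set (Sym2 V)} {d : G.Dart} (h : d.edge ∉ S) : G.revIn S d = d :=
  if_neg h

/-- The face permutation of the spanning subgraph with edge set `S`. The darts of the other edges
are kept as loose ends: they have no effect on the number of faces, except that an isolated vertex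
gets a face made of its loose ends. -/
noncomputable def facePermIn (rot : Equiv.Perm G.Dart) (S : Set (Sym2 V)) : Equiv.Perm G.Dart :=
  (G.revIn S).trans rot

lemma facePermIn_of_mem (rot : Equiv.Perm G.Dart) {S : Set (Sym2 V)} {d : G.Dart}
    (h : d.edge ∈ S) : facePermIn rot S d = rot d.symm := by
  simp [facePermIn, revIn_of_mem h]

lemma facePermIn_of_notMem (rot : Equiv.Perm G.Dart) {S : Set (Sym2 V)} {d : G.Dart}
    (h : d.edge ∉ S) : facePermIn rot S d = rot d := by
  simp [facePermIn, revIn_of_notMem h]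

lemma facePermIn_edgeSet (rot : Equiv.Perm G.Dart) : facePermIn rot G.edgeSet = facePerm rot := by
  ext1 d
  rw [facePermIn_of_mem rot d.edge_mem]
  rfl

open Classical in
lemma facePermIn_insert (rot : Equiv.Perm G.Dart) {S : Set (Sym2 V)} (d : G.Dart)
    (h : d.edge ∉ S) :
    facePermIn rot (insert d.edge S) = facePermIn rot S * Equiv.swap d d.symm := by
  ext1 e
  rw [Equiv.Perm.mul_apply]
  by_cases h1 : e = d
  · subst h1
    rw [Equiv.swap_apply_left, facePermIn_of_mem rot (by simp), facePermIn_of_notMem rot (by simpa)]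
  by_cases h2 : e = d.symm
  · subst h2
    rw [Equiv.swap_apply_right, facePermIn_of_mem rot (by simp), facePermIn_of_notMem rot h,
      Dart.symm_symm]
  rw [Equiv.swap_apply_of_ne_of_ne h1 h2]
  have h3 : e.edge ≠ d.edge := fun h => by
    rcases (dart_edge_eq_iff e d).1 h with h | h <;> contradiction
  by_cases h4 : e.edge ∈ S
  · rw [facePermIn_of_mem rot h4, facePermIn_of_mem rot (Set.mem_insert_of_mem _ h4)]
  · rw [facePermIn_of_notMem rot h4, facePermIn_of_notMem rot (by simp [h3, h4])]

/-- The number of components of the spanning graph with edge set `S`. -/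
noncomputable def numComp (S : Set (Sym2 V)) : ℕ := Nat.card (fromEdgeSet S).ConnectedComponent

open Classical in
lemma facePermIn_fst {rot : Equiv.Perm G.Dart} (hrot : ∀ d, (rot d).fst = d.fst)
    {S : Set (Sym2 V)} (d : G.Dart) :
    (facePermIn rot S d).fst = if d.edge ∈ S then d.snd else d.fst := by
  split_ifs with h
  · rw [facePermIn_of_mem rot h, hrot]; rfl
  · rw [facePermIn_of_notMem rot h, hrot]

/-- Each face of a spanning subgraph belongs to one component. -/
lemma reachable_of_sameCycle {rot : Equiv.Perm G.Dart} (hrot : ∀ d, (rot d).fst = d.fst)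
    {S : Set (Sym2 V)} {d e : G.Dart} (h : (facePermIn rot S).SameCycle d e) :
    (fromEdgeSet S).Reachable d.fst e.fst := by
  refine rel_of_sameCycle ((fromEdgeSet S).reachableSetoid.comap (fun d : G.Dart => d.fst)) _ ?_ h
  intro z
  change (fromEdgeSet S).Reachable z.fst (facePermIn rot S z).fst
  rw [facePermIn_fst hrot]
  split_ifs with hz
  · exact (Adj.reachable (by rw [fromEdgeSet_adj]; exact ⟨hz, z.adj.ne⟩))
  · exact Reachable.refl _

lemma reachable_insert {S : Set (Sym2 V)} {x y a b : V}
    (h : (fromEdgeSet (insert s(x, y) S)).Reachable a b) :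
    (fromEdgeSet S).Reachable a b ∨
      (((fromEdgeSet S).Reachable a x ∨ (fromEdgeSet S).Reachable a y) ∧
        ((fromEdgeSet S).Reachable b x ∨ (fromEdgeSet S).Reachable b y)) := by
  obtain ⟨w⟩ := h
  induction w with
  | nil => exact Or.inl (Reachable.refl _)
  | @cons a c b hac w ih =>
    rw [fromEdgeSet_adj] at hac
    obtain ⟨hac, hne⟩ := hac
    rcases hac with hac | hac
    · rw [Sym2.eq_iff] at hac
      have ha : (fromEdgeSet S).Reachable a x ∨ (fromEdgeSet S).Reachable a y := by
        rcases hac with ⟨rfl, rfl⟩ | ⟨rfl, rfl⟩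
        · exact Or.inl (Reachable.refl _)
        · exact Or.inr (Reachable.refl _)
      have hc : c = x ∨ c = y := by rcases hac with ⟨rfl, rfl⟩ | ⟨rfl, rfl⟩ <;> simp
      refine Or.inr ⟨ha, ?_⟩
      rcases ih with ih | ⟨-, ih⟩
      · rcases hc with rfl | rfl
        · exact Or.inl ih.symm
        · exact Or.inr ih.symm
      · exact ih
    · have hR : (fromEdgeSet S).Reachable a c :=
        Adj.reachable (by rw [fromEdgeSet_adj]; exact ⟨hac, hne⟩)
      rcases ih with ih | ⟨ih, ih'⟩
      · exact Or.inl (hR.trans ih)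
      · exact Or.inr ⟨ih.imp hR.trans hR.trans, ih'⟩

lemma numComp_le_succ_insert [Finite V] (S : Set (Sym2 V)) (x y : V) :
    numComp S ≤ numComp (insert s(x, y) S) + 1 :=
  card_quotient_le_succ_of_glue (fromEdgeSet S).reachableSetoid
    (fromEdgeSet (insert s(x, y) S)).reachableSetoid x y fun _ _ h => reachable_insert h

lemma numComp_le_insert_of_reachable [Finite V] {S : Set (Sym2 V)} {x y : V}
    (hxy : (fromEdgeSet S).Reachable x y) : numComp S ≤ numComp (insert s(x, y) S) := by
  refine Nat.card_le_card_of_surjective (Quotient.map'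
    (s₁ := (fromEdgeSet (insert s(x, y) S)).reachableSetoid)
    (s₂ := (fromEdgeSet S).reachableSetoid) id ?_) ?_
  · intro a b h
    rcases reachable_insert h with h | ⟨h1, h2⟩
    · exact h
    · have h1' : (fromEdgeSet S).Reachable a x := h1.elim id fun h => h.trans hxy.symm
      have h2' : (fromEdgeSet S).Reachable b x := h2.elim id fun h => h.trans hxy.symm
      exact h1'.trans h2'.symm
  · intro q
    obtain ⟨a, rfl⟩ := Quot.exists_rep q
    exact ⟨Quot.mk _ a, rfl⟩

/-- Twice the genus of the spanning subgraph with edge set `S`, for an embedding in which the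
number of vertices is that of the cycles of `rot`. -/
noncomputable def genusIn (rot : Equiv.Perm G.Dart) (S : Finset (Sym2 V)) : ℤ :=
  2 * numComp (S : Set (Sym2 V)) + S.card - numCycles rot
    - numCycles (facePermIn rot (S : Set (Sym2 V)))

open Classical in
/-- Inserting an edge between two corners of one face adds at most one face and joins no components;
inserting one between different faces merges them and joins at most two components. -/
lemma genusIn_le_insert [Finite V] {rot : Equiv.Perm G.Dart} (hrot : ∀ d, (rot d).fst = d.fst)
    (S : Finset (Sym2 V)) {e : Sym2 V} (he : e ∈ G.edgeSet) :
    genusIn rot S ≤ genusIn rot (insert e S) := by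
  by_cases heS : e ∈ S
  · rw [Finset.insert_eq_of_mem heS]
  induction e using Sym2.ind with
  | h x y =>
  let d : G.Dart := ⟨(x, y), he⟩
  have hdS : d.edge ∉ (S : Set (Sym2 V)) := heS
  have hd : d.edge = s(x, y) := rfl
  have h1 := facePermIn_insert rot d hdS
  have h3 := numComp_le_succ_insert (S : Set (Sym2 V)) x y
  rw [hd] at h1
  unfold genusIn
  rw [Finset.card_insert_of_notMem heS, Finset.coe_insert, h1]
  by_cases hc : (facePermIn rot (S : Set (Sym2 V))).SameCycle d d.symm
  · have h2 := numCycles_le_succ_mul_swap (facePermIn rot (S : Set (Sym2 V))) d d.symm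
    have h4 := numComp_le_insert_of_reachable (reachable_of_sameCycle hrot hc)
    have h5 : s(d.fst, d.symm.fst) = s(x, y) := rfl
    rw [h5] at h4
    push_cast
    omega
  · have h2 := numCycles_mul_swap_lt (facePermIn rot (S : Set (Sym2 V))) d d.symm hc
    push_cast
    omega

open Classical in
lemma genusIn_mono [Finite V] {rot : Equiv.Perm G.Dart} (hrot : ∀ d, (rot d).fst = d.fst)
    {S T : Finset (Sym2 V)} (hST : S ⊆ T) (hT : (T : Set (Sym2 V)) ⊆ G.edgeSet) :
    genusIn rot S ≤ genusIn rot T := by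
  have : ∀ U : Finset (Sym2 V), (U : Set (Sym2 V)) ⊆ G.edgeSet →
      genusIn rot S ≤ genusIn rot (S ∪ U) := by
    intro U
    induction U using Finset.induction_on with
    | empty => intro; simp
    | insert e U _ ih =>
      intro hU
      rw [Finset.coe_insert, Set.insert_subset_iff] at hU
      rw [Finset.union_insert]
      exact (ih hU.2).trans (genusIn_le_insert hrot _ hU.1)
  have h := this T hT
  rwa [Finset.union_eq_right.2 hST] at h

/-- The cycles of a rotation system are the vertices, if none of these is isolated. -/
lemma numCycles_rot [Finite V] {rot : Equiv.Perm G.Dart} (hrot : ∀ d, (rot d).fst = d.fst)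
    (hcyc : ∀ d e : G.Dart, d.fst = e.fst → rot.SameCycle d e) (hne : ∀ v, ∃ w, G.Adj v w) :
    numCycles rot = Nat.card V := by
  have h : ∀ a b, (Equiv.Perm.SameCycle.setoid rot) a b → a.fst = b.fst := fun a b hab =>
    rel_of_sameCycle (Setoid.ker fun d : G.Dart => d.fst) rot (fun z => (hrot z).symm) hab
  refine Nat.card_congr (Equiv.ofBijective (Quotient.lift _ h) ⟨?_, ?_⟩)
  · intro p q
    induction p using Quotient.inductionOn with
    | h a =>
    induction q using Quotient.inductionOn with
    | h b => exact fun h => Quotient.sound (hcyc a b h)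
  · intro v
    obtain ⟨w, hw⟩ := hne v
    exact ⟨Quotient.mk _ ⟨(v, w), hw⟩, rfl⟩

lemma numComp_empty [Finite V] : numComp (∅ : Set (Sym2 V)) = Nat.card V := by
  unfold numComp
  rw [fromEdgeSet_empty]
  refine (Nat.card_congr (Equiv.ofBijective (connectedComponentMk _) ⟨?_, ?_⟩)).symm
  · intro a b h
    exact reachable_bot.1 (ConnectedComponent.exact h)
  · exact fun c => c.exists_rep

/-- Without edges, every vertex is a component with one face. -/
lemma genusIn_empty [Finite V] {rot : Equiv.Perm G.Dart} (hrot : ∀ d, (rot d).fst = d.fst)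
    (hcyc : ∀ d e : G.Dart, d.fst = e.fst → rot.SameCycle d e) (hne : ∀ v, ∃ w, G.Adj v w) :
    genusIn rot ∅ = 0 := by
  have h : facePermIn rot (∅ : Set (Sym2 V)) = rot := by
    ext1 d
    exact facePermIn_of_notMem rot (by simp)
  unfold genusIn
  rw [Finset.coe_empty, h, numComp_empty, numCycles_rot hrot hcyc hne]
  simp
  ring

/-- Euler's formula for the spanning subgraphs of a plane graph: deleting edges does not raise the
genus. -/
theorem numCycles_facePermIn [Finite V] (M : PlaneEmbedding G) (hne : ∀ v, ∃ w, G.Adj v w)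
    {S : Set (Sym2 V)} (hS : S ⊆ G.edgeSet) :
    numCycles (facePermIn M.rot S) + Nat.card V = S.ncard + 2 * numComp S := by
  classical
  have hSf : S.Finite := Set.toFinite S
  have hEf : G.edgeSet.Finite := Set.toFinite _
  have h0 := genusIn_mono M.rot_fst (Finset.empty_subset hSf.toFinset) (by simpa using hS)
  have h1 := genusIn_mono (S := hSf.toFinset) (T := hEf.toFinset) M.rot_fst
    (by simpa using hS) (by simp)
  rw [genusIn_empty M.rot_fst M.rot_cyclic hne] at h0
  have h2 := M.euler
  have h3 : {v : V | G.neighborSet v = ∅} = ∅ := by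
    ext v
    obtain ⟨w, hw⟩ := hne v
    simp only [Set.mem_ofPred_eq, Set.mem_empty_iff_false, iff_false]
    exact fun h => Set.eq_empty_iff_forall_notMem.1 h w hw
  rw [h3, Set.ncard_empty, add_zero] at h2
  unfold genusIn at h0 h1
  rw [numCycles_rot M.rot_fst M.rot_cyclic hne] at h0 h1
  rw [Set.Finite.coe_toFinset, ← Set.ncard_eq_toFinset_card S hSf] at h0 h1
  rw [Set.Finite.coe_toFinset, ← Set.ncard_eq_toFinset_card _ hEf, facePermIn_edgeSet] at h1
  have h4 : numComp G.edgeSet = Nat.card G.ConnectedComponent := by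
    unfold numComp
    rw [fromEdgeSet_edgeSet]
  rw [h4] at h1
  unfold numCycles at h0 h1 ⊢
  omega

/-- Euler's formula may be replaced by an inequality, as the genus is never negative. -/
theorem isPlanar_of_card_le [Finite V] (rot : Equiv.Perm G.Dart)
    (hrot : ∀ d, (rot d).fst = d.fst)
    (hcyc : ∀ d e : G.Dart, d.fst = e.fst → rot.SameCycle d e) (hne : ∀ v, ∃ w, G.Adj v w)
    (h : G.edgeSet.ncard + 2 * Nat.card G.ConnectedComponent
      ≤ Nat.card V + numCycles (facePerm rot)) : IsPlanar G := by
  classical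
  have hEf : G.edgeSet.Finite := Set.toFinite _
  have h0 := genusIn_mono hrot (Finset.empty_subset hEf.toFinset) (by simp)
  rw [genusIn_empty hrot hcyc hne] at h0
  unfold genusIn at h0
  have h4 : numComp G.edgeSet = Nat.card G.ConnectedComponent := by
    unfold numComp
    rw [fromEdgeSet_edgeSet]
  rw [numCycles_rot hrot hcyc hne, Set.Finite.coe_toFinset, ← Set.ncard_eq_toFinset_card _ hEf,
    facePermIn_edgeSet, h4] at h0
  have h3 : {v : V | G.neighborSet v = ∅} = ∅ := by
    ext v
    obtain ⟨w, hw⟩ := hne v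
    simp only [Set.mem_ofPred_eq, Set.mem_empty_iff_false, iff_false]
    exact fun h => Set.eq_empty_iff_forall_notMem.1 h w hw
  refine ⟨⟨rot, hrot, hcyc, ?_⟩⟩
  rw [h3, Set.ncard_empty, add_zero]
  unfold numCycles at h h0
  omega

end SimpleGraph

/-! ### Edge cuts of cubic graphs -/

namespace SimpleGraph

variable {V : Type*} {G : SimpleGraph V}

open Classical in
/-- The number of pairs in `A × B` of adjacent vertices: for disjoint `A` and `B` the number of
edges between them, and for `A = B` twice the number of edges inside `A`. -/
noncomputable def edgeCount (G : SimpleGraph V) (A B : Finset V) : ℕ :=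
  ∑ x ∈ A, ∑ y ∈ B, if G.Adj x y then 1 else 0

lemma edgeCount_comm (A B : Finset V) : G.edgeCount A B = G.edgeCount B A := by
  unfold edgeCount
  rw [Finset.sum_comm]
  exact Finset.sum_congr rfl fun x _ => Finset.sum_congr rfl fun y _ => by rw [G.adj_comm]

@[simp] lemma edgeCount_empty_left (B : Finset V) : G.edgeCount ∅ B = 0 := by simp [edgeCount]

@[simp] lemma edgeCount_empty_right (B : Finset V) : G.edgeCount B ∅ = 0 := by simp [edgeCount]

lemma edgeCount_union_left [DecidableEq V] {A B : Finset V} (h : Disjoint A B) (C : Finset V) :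
    G.edgeCount (A ∪ B) C = G.edgeCount A C + G.edgeCount B C := by
  unfold edgeCount
  rw [Finset.sum_union h]

lemma edgeCount_union_right [DecidableEq V] {A B : Finset V} (h : Disjoint A B) (C : Finset V) :
    G.edgeCount C (A ∪ B) = G.edgeCount C A + G.edgeCount C B := by
  rw [edgeCount_comm, edgeCount_union_left h, edgeCount_comm A, edgeCount_comm B]

lemma edgeCount_insert_left [DecidableEq V] {a : V} {A : Finset V} (h : a ∉ A) (C : Finset V) :
    G.edgeCount (insert a A) C = G.edgeCount {a} C + G.edgeCount A C := by
  unfold edgeCount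
  rw [Finset.sum_insert h, Finset.sum_singleton]

lemma edgeCount_insert_right [DecidableEq V] {a : V} {A : Finset V} (h : a ∉ A) (C : Finset V) :
    G.edgeCount C (insert a A) = G.edgeCount C {a} + G.edgeCount C A := by
  rw [edgeCount_comm, edgeCount_insert_left h, edgeCount_comm A, edgeCount_comm {a}]

open Classical in
lemma edgeCount_singleton (x y : V) : G.edgeCount {x} {y} = if G.Adj x y then 1 else 0 := by
  rw [edgeCount, Finset.sum_singleton, Finset.sum_singleton]

lemma edgeCount_singleton_of_adj {x y : V} (h : G.Adj x y) : G.edgeCount {x} {y} = 1 := by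
  rw [edgeCount_singleton, if_pos h]

lemma edgeCount_singleton_of_not_adj {x y : V} (h : ¬ G.Adj x y) : G.edgeCount {x} {y} = 0 := by
  rw [edgeCount_singleton, if_neg h]

lemma edgeCount_self (x : V) : G.edgeCount {x} {x} = 0 :=
  edgeCount_singleton_of_not_adj (G.loopless.irrefl x)

lemma edgeCount_le_one (x y : V) : G.edgeCount {x} {y} ≤ 1 := by
  rw [edgeCount_singleton]
  split_ifs <;> simp

lemma edgeCount_mono_left {A B : Finset V} (h : A ⊆ B) (C : Finset V) :
    G.edgeCount A C ≤ G.edgeCount B C :=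
  Finset.sum_le_sum_of_subset h

lemma edgeCount_mono_right {A B : Finset V} (h : A ⊆ B) (C : Finset V) :
    G.edgeCount C A ≤ G.edgeCount C B := by
  rw [edgeCount_comm C A, edgeCount_comm C B]
  exact edgeCount_mono_left h C

lemma edgeCount_eq_zero {A B : Finset V} :
    G.edgeCount A B = 0 ↔ ∀ x ∈ A, ∀ y ∈ B, ¬ G.Adj x y := by
  simp [edgeCount, Finset.sum_eq_zero_iff]

lemma edgeCount_pos {A B : Finset V} {x y : V} (hx : x ∈ A) (hy : y ∈ B) (h : G.Adj x y) :
    0 < G.edgeCount A B :=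
  Nat.pos_of_ne_zero fun h0 => edgeCount_eq_zero.1 h0 x hx y hy h

open Classical in
lemma edgeCount_eq_card (A B : Finset V) :
    G.edgeCount A B = ((A ×ˢ B).filter fun p => G.Adj p.1 p.2).card := by
  unfold edgeCount
  rw [Finset.card_filter, Finset.sum_product]

lemma even_edgeCount_self (A : Finset V) : Even (G.edgeCount A A) := by
  classical
  induction A using Finset.induction_on with
  | empty => simp
  | insert a A ha ih =>
    rw [edgeCount_insert_left ha, edgeCount_insert_right ha, edgeCount_insert_right ha,
      edgeCount_self, edgeCount_comm A {a}]
    obtain ⟨k, hk⟩ := ih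
    exact ⟨k + G.edgeCount {a} A, by omega⟩

lemma edgeCount_singleton_univ [Fintype V] (hG : IsCubic G) (x : V) :
    G.edgeCount {x} Finset.univ = 3 := by
  classical
  rw [← hG x, Set.ncard_eq_toFinset_card']
  simp only [edgeCount, Finset.sum_singleton]
  rw [← Finset.card_filter]
  congr 1
  ext y
  simp

lemma edgeCount_univ [Fintype V] (hG : IsCubic G) (A : Finset V) :
    G.edgeCount A Finset.univ = 3 * A.card := by
  classical
  induction A using Finset.induction_on with
  | empty => simp
  | insert a A ha ih =>
    rw [edgeCount_insert_left ha, ih, edgeCount_singleton_univ hG, Finset.card_insert_of_notMem ha]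
    ring

/-- The number of edges that leave `X`. -/
noncomputable def cutSize [Fintype V] [DecidableEq V] (G : SimpleGraph V) (X : Finset V) : ℕ :=
  G.edgeCount X Xᶜ

section Cut

variable [Fintype V] [DecidableEq V]

lemma cutSize_compl (X : Finset V) : G.cutSize Xᶜ = G.cutSize X := by
  unfold cutSize
  rw [compl_compl, edgeCount_comm]

lemma edgeCount_self_add_cutSize (hG : IsCubic G) (X : Finset V) :
    G.edgeCount X X + G.cutSize X = 3 * X.card := by
  unfold cutSize
  rw [← edgeCount_union_right disjoint_compl_right, Finset.union_compl, edgeCount_univ hG]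

lemma cutSize_mod_two (hG : IsCubic G) (X : Finset V) : G.cutSize X % 2 = X.card % 2 := by
  have h := edgeCount_self_add_cutSize hG X
  obtain ⟨k, hk⟩ := G.even_edgeCount_self X
  omega

lemma cutSize_singleton (hG : IsCubic G) (x : V) : G.cutSize {x} = 3 := by
  have h := edgeCount_self_add_cutSize hG {x}
  rw [edgeCount_self, Finset.card_singleton] at h
  omega

/-- Moving a vertex out of `X` replaces the cut edges at it by its edges into `X`. -/
lemma cutSize_erase (hG : IsCubic G) {X : Finset V} {x : V} (hx : x ∈ X) :
    G.cutSize (X.erase x) + 3 = G.cutSize X + 2 * G.edgeCount {x} X := by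
  have h1 := edgeCount_self_add_cutSize hG X
  have h2 := edgeCount_self_add_cutSize hG (X.erase x)
  have h3 : G.edgeCount X X = 2 * G.edgeCount {x} X + G.edgeCount (X.erase x) (X.erase x) := by
    conv_lhs => rw [← Finset.insert_erase hx]
    conv_rhs => rw [← Finset.insert_erase hx]
    simp only [edgeCount_insert_left (Finset.notMem_erase x X),
      edgeCount_insert_right (Finset.notMem_erase x X), Finset.erase_insert_eq_erase,
      Finset.erase_idem, edgeCount_self]
    rw [edgeCount_comm (X.erase x) {x}]
    ring
  have h4 := Finset.card_erase_add_one hx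
  omega

lemma cutSize_insert (hG : IsCubic G) {X : Finset V} {x : V} (hx : x ∉ X) :
    G.cutSize (insert x X) + 2 * G.edgeCount {x} X = G.cutSize X + 3 := by
  have h := cutSize_erase hG (Finset.mem_insert_self x X)
  rw [Finset.erase_insert hx, edgeCount_insert_right hx, edgeCount_self] at h
  omega

/-- The cut function is submodular. -/
lemma cutSize_inter_add_union_le (X Y : Finset V) :
    G.cutSize (X ∩ Y) + G.cutSize (X ∪ Y) ≤ G.cutSize X + G.cutSize Y := by
  have hX : X = (X ∩ Y) ∪ (X \ Y) := by ext; simp; tauto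
  have hY : Y = (X ∩ Y) ∪ (Y \ X) := by ext; simp; tauto
  have hI : (X ∩ Y)ᶜ = (X \ Y) ∪ ((Y \ X) ∪ (X ∪ Y)ᶜ) := by ext; simp; tauto
  have hU : X ∪ Y = (X ∩ Y) ∪ ((X \ Y) ∪ (Y \ X)) := by ext; simp; tauto
  have hXc : Xᶜ = (Y \ X) ∪ (X ∪ Y)ᶜ := by ext; simp; tauto
  have hYc : Yᶜ = (X \ Y) ∪ (X ∪ Y)ᶜ := by ext; simp; tauto
  have d1 : Disjoint (X ∩ Y) (X \ Y) := by rw [Finset.disjoint_left]; simp; tauto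
  have d2 : Disjoint (X ∩ Y) (Y \ X) := by rw [Finset.disjoint_left]; simp; tauto
  have d3 : Disjoint (X \ Y) (Y \ X) := by rw [Finset.disjoint_left]; simp; tauto
  have d4 : Disjoint (X \ Y) (X ∪ Y)ᶜ := by rw [Finset.disjoint_left]; simp; tauto
  have d5 : Disjoint (Y \ X) (X ∪ Y)ᶜ := by rw [Finset.disjoint_left]; simp; tauto
  have e1 : G.cutSize X = G.edgeCount (X ∩ Y) (Y \ X) + G.edgeCount (X ∩ Y) (X ∪ Y)ᶜ
      + (G.edgeCount (X \ Y) (Y \ X) + G.edgeCount (X \ Y) (X ∪ Y)ᶜ) := by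
    unfold cutSize
    have h := fun C => (congrArg (G.edgeCount · C) hX).trans (edgeCount_union_left d1 C)
    rw [hXc, edgeCount_union_right d5, h, h (X ∪ Y)ᶜ]
    ring
  have e2 : G.cutSize Y = G.edgeCount (X ∩ Y) (X \ Y) + G.edgeCount (X ∩ Y) (X ∪ Y)ᶜ
      + (G.edgeCount (Y \ X) (X \ Y) + G.edgeCount (Y \ X) (X ∪ Y)ᶜ) := by
    unfold cutSize
    have h := fun C => (congrArg (G.edgeCount · C) hY).trans (edgeCount_union_left d2 C)
    rw [hYc, edgeCount_union_right d4, h, h (X ∪ Y)ᶜ]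
    ring
  have e3 : G.cutSize (X ∩ Y) = G.edgeCount (X ∩ Y) (X \ Y) + (G.edgeCount (X ∩ Y) (Y \ X)
      + G.edgeCount (X ∩ Y) (X ∪ Y)ᶜ) := by
    unfold cutSize
    rw [hI, edgeCount_union_right (Finset.disjoint_union_right.2 ⟨d3, d4⟩), edgeCount_union_right d5]
  have e4 : G.cutSize (X ∪ Y) = G.edgeCount (X ∩ Y) (X ∪ Y)ᶜ + (G.edgeCount (X \ Y) (X ∪ Y)ᶜ
      + G.edgeCount (Y \ X) (X ∪ Y)ᶜ) := by
    unfold cutSize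
    nth_rw 1 [hU]
    rw [edgeCount_union_left (Finset.disjoint_union_right.2 ⟨d1, d2⟩), edgeCount_union_left d3]
  omega

end Cut

/-- Every cut with both sides non-empty has at least three edges. -/
def IsThreeEdgeConnected [Fintype V] [DecidableEq V] (G : SimpleGraph V) : Prop :=
  ∀ X : Finset V, X.Nonempty → X ≠ Finset.univ → 3 ≤ G.cutSize X

/-- Two disconnected parts are witnessed by a set without outgoing edges. -/
lemma preconnected_of_forall_closed (H : SimpleGraph V)
    (h : ∀ A : Set V, A.Nonempty → (∀ x ∈ A, ∀ y, H.Adj x y → y ∈ A) → A = Set.univ) :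
    H.Preconnected := by
  intro a b
  have := h {x | H.Reachable a x} ⟨a, Reachable.refl a⟩ fun x hx y hxy => hx.trans hxy.reachable
  have hb : b ∈ {x | H.Reachable a x} := this ▸ Set.mem_univ b
  exact hb

lemma Preconnected.exists_adj_of_nonempty {H : SimpleGraph V} (hH : H.Preconnected) {A : Set V}
    {a b : V} (ha : a ∈ A) (hb : b ∉ A) : ∃ x ∈ A, ∃ y ∉ A, H.Adj x y := by
  obtain ⟨w⟩ := hH a b
  obtain ⟨d, -, h1, h2⟩ := w.exists_boundary_dart A ha hb
  exact ⟨d.fst, h1, d.snd, h2, d.adj⟩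

section

variable [Fintype V] [DecidableEq V]

lemma IsThreeEdgeConnected.preconnected (h : G.IsThreeEdgeConnected) : G.Preconnected := by
  classical
  refine preconnected_of_forall_closed G fun A hA hc => ?_
  by_contra hne
  have h1 := h A.toFinset (by simpa using hA) (by simpa using hne)
  have h2 : G.cutSize A.toFinset = 0 := by
    unfold cutSize
    rw [edgeCount_eq_zero]
    intro x hx y hy hxy
    simp only [Finset.mem_compl, Set.mem_toFinset] at hx hy
    exact hy (hc x hx y hxy)
  omega

/-- For cubic graphs, edge connectivity implies vertex connectivity. -/
theorem IsThreeEdgeConnected.isKConnected (h : G.IsThreeEdgeConnected) (hG : IsCubic G)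
    (hV : 3 < Fintype.card V) : IsKConnected 3 G := by
  classical
  refine ⟨by rwa [Nat.card_eq_fintype_card], fun S hS => ?_⟩
  have hne : Nonempty ((S : Set V)ᶜ : Set V) := by
    by_contra hn
    have : S = Finset.univ := by
      ext x
      simp only [Finset.mem_univ, iff_true]
      by_contra hx
      exact hn ⟨⟨x, hx⟩⟩
    rw [this, Finset.card_univ] at hS
    omega
  rw [connected_iff]
  refine ⟨preconnected_of_forall_closed _ fun A' hA' hc => ?_, hne⟩
  by_contra hne'
  -- `A` and `B` are unions of components of the graph without `S`
  set A : Finset V := Finset.univ.filter fun x => ∃ hx : x ∈ (S : Set V)ᶜ, ⟨x, hx⟩ ∈ A' with hA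
  set B : Finset V := (S ∪ A)ᶜ with hB
  have hAS : Disjoint A S := by
    rw [Finset.disjoint_left]
    rintro x hx hxS
    obtain ⟨h1, -⟩ := (Finset.mem_filter.1 hx).2
    exact h1 hxS
  have hAne : A.Nonempty := by
    obtain ⟨x, hx⟩ := hA'
    exact ⟨x, by simpa [hA] using ⟨x.2, hx⟩⟩
  have hBne : B.Nonempty := by
    obtain ⟨x, hx⟩ := (Set.ne_univ_iff_exists_notMem A').1 hne'
    refine ⟨x, ?_⟩
    have := x.2
    simp only [Set.mem_compl_iff, Finset.mem_coe] at this
    simp [hB, hA, this, hx]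
  have hAB : G.edgeCount A B = 0 := by
    rw [edgeCount_eq_zero]
    intro x hx y hy hxy
    simp only [hB, Finset.mem_compl, Finset.mem_union, not_or] at hy
    obtain ⟨h1, h2⟩ := (Finset.mem_filter.1 hx).2
    exact hy.2 (Finset.mem_filter.2 ⟨Finset.mem_univ _, hy.1, hc ⟨x, h1⟩ h2 ⟨y, hy.1⟩ hxy⟩)
  have hABd : Disjoint A B := by
    rw [Finset.disjoint_left]; intro x; simp [hB]; tauto
  have hSBd : Disjoint S B := by
    rw [Finset.disjoint_left]; intro x; simp [hB]; tauto
  have hAc : Aᶜ = S ∪ B := by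
    ext x
    have : x ∈ A → x ∉ S := fun h => Finset.disjoint_left.1 hAS h
    simp [hB]; tauto
  have hBc : Bᶜ = S ∪ A := by rw [hB, compl_compl]
  have cA : G.cutSize A = G.edgeCount S A := by
    unfold cutSize
    rw [hAc, edgeCount_union_right hSBd, hAB, add_zero, edgeCount_comm]
  have cB : G.cutSize B = G.edgeCount S B := by
    unfold cutSize
    rw [hBc, edgeCount_union_right hAS.symm, edgeCount_comm B A, hAB, add_zero, edgeCount_comm]
  have hAu : A ≠ Finset.univ := by
    rintro hu
    obtain ⟨x, hx⟩ := hBne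
    exact Finset.disjoint_left.1 hABd (hu ▸ Finset.mem_univ x) hx
  have hBu : B ≠ Finset.univ := by
    rintro hu
    obtain ⟨x, hx⟩ := hAne
    exact Finset.disjoint_left.1 hABd hx (hu ▸ Finset.mem_univ x)
  have gA := h A hAne hAu
  have gB := h B hBne hBu
  have hsum : G.edgeCount S S + (G.edgeCount S A + G.edgeCount S B) = 3 * S.card := by
    rw [← edgeCount_univ hG, ← edgeCount_union_right hABd, ← edgeCount_union_right]
    · congr 1
      rw [← Finset.union_assoc, hB, Finset.union_compl]
    · rw [Finset.disjoint_union_right]; exact ⟨hAS.symm, hSBd⟩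
  -- at least three edges go from `S` to each of `A` and `B`, which leaves no others at `S`
  have hS2 : S.card = 2 := by omega
  obtain ⟨s, t, hst, rfl⟩ := Finset.card_eq_two.1 hS2
  have hsA : s ∉ A := fun hs => Finset.disjoint_left.1 hAS hs (by simp)
  have hsB : s ∉ B := fun hs => Finset.disjoint_left.1 hSBd (by simp) hs
  -- `s` has two of its edges on one side, and moving `s` there leaves a cut with two edges
  have iA := cutSize_insert hG hsA
  have iB := cutSize_insert hG hsB
  have htA : t ∉ A := fun hs => Finset.disjoint_left.1 hAS hs (by simp)
  have htB : t ∉ B := fun hs => Finset.disjoint_left.1 hSBd (by simp) hs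
  have jA := h (insert s A) (Finset.insert_nonempty _ _) (fun hu => by
    have : t ∈ insert s A := hu ▸ Finset.mem_univ t
    rw [Finset.mem_insert] at this
    exact this.elim (fun h => hst h.symm) htA)
  have jB := h (insert s B) (Finset.insert_nonempty _ _) (fun hu => by
    have : t ∈ insert s B := hu ▸ Finset.mem_univ t
    rw [Finset.mem_insert] at this
    exact this.elim (fun h => hst h.symm) htB)
  have hs3 : G.edgeCount {s} A + G.edgeCount {s} B ≤ 3 := by
    rw [← edgeCount_singleton_univ hG s, ← edgeCount_union_right hABd]
    exact edgeCount_mono_right (Finset.subset_univ _) _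
  have ht3 : G.edgeCount {t} A + G.edgeCount {t} B ≤ 3 := by
    rw [← edgeCount_singleton_univ hG t, ← edgeCount_union_right hABd]
    exact edgeCount_mono_right (Finset.subset_univ _) _
  have hst' : s ∉ ({t} : Finset V) := by simpa using hst
  have kA := edgeCount_insert_left (G := G) hst' A
  have kB := edgeCount_insert_left (G := G) hst' B
  have hSS := G.even_edgeCount_self {s, t}
  omega

/-- At most two cut edges are covered by one of their ends on either side. -/
lemma cutSize_le_two_cover {X : Finset V} (h1 : X.Nonempty) (h2 : Xᶜ.Nonempty)
    (h : G.cutSize X ≤ 2) :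
    ∃ p ∈ X, ∃ q ∈ Xᶜ, ∀ x ∈ X, ∀ y ∈ Xᶜ, G.Adj x y → x = p ∨ y = q := by
  classical
  obtain ⟨a, ha⟩ := h1
  obtain ⟨b, hb⟩ := h2
  unfold cutSize at h
  rw [edgeCount_eq_card] at h
  set P := (X ×ˢ Xᶜ).filter fun p => G.Adj p.1 p.2 with hP
  have key : ∀ x ∈ X, ∀ y ∈ Xᶜ, G.Adj x y → (x, y) ∈ P := fun x hx y hy hxy => by
    rw [hP, Finset.mem_filter, Finset.mem_product]
    exact ⟨⟨hx, hy⟩, hxy⟩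
  have key' : ∀ p ∈ P, p.1 ∈ X ∧ p.2 ∈ Xᶜ := fun p hp => by
    rw [hP, Finset.mem_filter, Finset.mem_product] at hp
    exact hp.1
  clear_value P
  obtain h0 | h0 | h0 : P.card = 0 ∨ P.card = 1 ∨ P.card = 2 := by omega
  · rw [Finset.card_eq_zero] at h0
    subst h0
    exact ⟨a, ha, b, hb, fun x hx y hy hxy => absurd (key x hx y hy hxy) (by simp)⟩
  · obtain ⟨p, rfl⟩ := Finset.card_eq_one.1 h0
    refine ⟨p.1, (key' p (by simp)).1, b, hb, fun x hx y hy hxy => Or.inl ?_⟩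
    have := key x hx y hy hxy
    rw [Finset.mem_singleton] at this
    rw [← this]
  · obtain ⟨p, q, -, rfl⟩ := Finset.card_eq_two.1 h0
    refine ⟨p.1, (key' p (by simp)).1, q.2, (key' q (by simp)).2, fun x hx y hy hxy => ?_⟩
    have := key x hx y hy hxy
    rw [Finset.mem_insert, Finset.mem_singleton] at this
    rcases this with h | h
    · left; rw [← h]
    · right; rw [← h]

/-- For cubic graphs, vertex connectivity implies edge connectivity. -/
theorem _root_.IsKConnected.isThreeEdgeConnected (h : IsKConnected 3 G) (hG : IsCubic G) :
    G.IsThreeEdgeConnected := by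
  classical
  intro X hX hXu
  by_contra hc
  have hXc : Xᶜ.Nonempty := by
    rw [Finset.nonempty_iff_ne_empty]
    simpa using hXu
  obtain ⟨p, hp, q, hq, hpq⟩ := cutSize_le_two_cover (G := G) hX hXc (by omega)
  -- a side that is a single vertex has three outgoing edges
  have big : ∀ (Y : Finset V) (y : V), G.cutSize Y ≤ 2 → y ∈ Y → ∃ z ∈ Y, z ≠ y := by
    intro Y y hY hy
    by_contra! hn
    have : Y = {y} := by
      ext z
      simp only [Finset.mem_singleton]
      exact ⟨hn z, fun h => h ▸ hy⟩
    rw [this, cutSize_singleton hG] at hY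
    omega
  obtain ⟨a, ha, hap⟩ := big X p (by omega) hp
  obtain ⟨b, hb, hbq⟩ := big Xᶜ q (by rw [cutSize_compl]; omega) hq
  have hcon := h.2 {p, q} (by
    have := Finset.card_le_two (a := p) (b := q)
    omega)
  have hqX : q ∉ X := by simpa using hq
  have hbX : b ∉ X := by simpa using hb
  have ha' : a ∈ ((({p, q} : Finset V) : Set V)ᶜ) := by
    simp [hap]; rintro rfl; exact hqX ha
  have hb' : b ∈ ((({p, q} : Finset V) : Set V)ᶜ) := by
    simp [hbq]; rintro rfl; exact hbX hp
  obtain ⟨x, hx, y, hy, hxy⟩ := hcon.preconnected.exists_adj_of_nonempty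
    (A := {z | (z : V) ∈ X}) (a := ⟨a, ha'⟩) (b := ⟨b, hb'⟩) ha hbX
  have hx' := x.2
  have hy' := y.2
  simp only [Finset.coe_insert, Finset.coe_singleton, Set.mem_compl_iff, Set.mem_insert_iff,
    Set.mem_singleton_iff, not_or] at hx' hy'
  rcases hpq x hx y (by simpa using hy) hxy with h | h
  · exact hx'.1 h
  · exact hy'.2 h

end

/-! ### Neighbours in cubic bipartite graphs -/

lemma _root_.IsCubic.exists_third (hG : IsCubic G) {x a b : V} :
    ∃ c, G.Adj x c ∧ c ≠ a ∧ c ≠ b := by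
  by_contra! hn
  have h3 := hG x
  have hsub : G.neighborSet x ⊆ {a, b} := by
    intro c hc
    by_cases h : c = a
    · simp [h]
    · simp [hn c hc h]
  have := Set.ncard_le_ncard hsub (by simp)
  have h2 : ({a, b} : Set V).ncard ≤ 2 := (Set.ncard_insert_le a {b}).trans (by simp)
  omega

lemma _root_.IsCubic.eq_of_adj (hG : IsCubic G) {x a b c y : V} (ha : G.Adj x a) (hb : G.Adj x b)
    (hc : G.Adj x c) (hab : a ≠ b) (hac : a ≠ c) (hbc : b ≠ c) (hy : G.Adj x y) :
    y = a ∨ y = b ∨ y = c := by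
  have h3 := hG x
  have hf : (G.neighborSet x).Finite := Set.finite_of_ncard_pos (by omega)
  have hsub : {a, b, c} ⊆ G.neighborSet x := by
    rintro z (rfl | rfl | rfl) <;> assumption
  have h := Set.eq_of_subset_of_ncard_le hsub (by
    rw [h3, Set.ncard_eq_three.2 ⟨a, b, c, hab, hac, hbc, rfl⟩]) hf
  have hy' : y ∈ ({a, b, c} : Set V) := h ▸ hy
  simpa using hy'

lemma _root_.IsCubic.exists_adj (hG : IsCubic G) (v : V) : ∃ w, G.Adj v w := by
  obtain ⟨c, hc, -⟩ := hG.exists_third (x := v) (a := v) (b := v)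
  exact ⟨c, hc⟩

/-- In a cubic bipartite graph the numbers of edges leaving `X` from its vertices of either colour
are congruent modulo three. -/
lemma cut_colour_mod_three [Fintype V] [DecidableEq V] (hG : IsCubic G) (f : G.Coloring (Fin 2))
    (X : Finset V) :
    G.edgeCount (X.filter fun v => f v = 0) Xᶜ % 3 =
      G.edgeCount (X.filter fun v => f v = 1) Xᶜ % 3 := by
  have hXu : X.filter (fun v => f v = 0) ∪ X.filter (fun v => f v = 1) = X := by
    ext v
    have : f v = 0 ∨ f v = 1 := by omega
    simp only [Finset.mem_union, Finset.mem_filter]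
    tauto
  have hd : Disjoint (X.filter fun v => f v = 0) (X.filter fun v => f v = 1) := by
    rw [Finset.disjoint_left]
    intro v h1 h2
    simp only [Finset.mem_filter] at h1 h2
    omega
  have h1 : ∀ i : Fin 2, G.edgeCount (X.filter fun v => f v = i) (X.filter fun v => f v = i) = 0 := by
    intro i
    rw [edgeCount_eq_zero]
    intro x hx y hy hxy
    simp only [Finset.mem_filter] at hx hy
    exact f.valid hxy (hx.2.trans hy.2.symm)
  have h2 : ∀ A : Finset V, G.edgeCount A X + G.edgeCount A Xᶜ = 3 * A.card := by
    intro A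
    rw [← edgeCount_univ hG, ← edgeCount_union_right disjoint_compl_right, Finset.union_compl]
  have e0 := h2 (X.filter fun v => f v = 0)
  have e1 := h2 (X.filter fun v => f v = 1)
  have k : ∀ A : Finset V, G.edgeCount A X = G.edgeCount A (X.filter fun v => f v = 0) +
      G.edgeCount A (X.filter fun v => f v = 1) := by
    intro A
    rw [← edgeCount_union_right hd, hXu]
  rw [k, h1, edgeCount_comm] at e0
  rw [k, h1] at e1
  omega

/-- All edges of a 3-edge cut start at the same colour. -/
lemma colour_eq_of_cutSize_eq_three [Fintype V] [DecidableEq V] (hG : IsCubic G)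
    (f : G.Coloring (Fin 2)) {X : Finset V} (h : G.cutSize X = 3) {a a' b b' : V} (ha : a ∈ X)
    (ha' : a' ∉ X) (haa : G.Adj a a') (hb : b ∈ X) (hb' : b' ∉ X) (hbb : G.Adj b b') :
    f a = f b := by
  have h1 := cut_colour_mod_three hG f X
  have hXu : X.filter (fun v => f v = 0) ∪ X.filter (fun v => f v = 1) = X := by
    ext v
    have : f v = 0 ∨ f v = 1 := by omega
    simp only [Finset.mem_union, Finset.mem_filter]
    tauto
  have hd : Disjoint (X.filter fun v => f v = 0) (X.filter fun v => f v = 1) := by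
    rw [Finset.disjoint_left]
    intro v h1 h2
    simp only [Finset.mem_filter] at h1 h2
    omega
  have h2 : G.cutSize X = G.edgeCount (X.filter fun v => f v = 0) Xᶜ +
      G.edgeCount (X.filter fun v => f v = 1) Xᶜ := by
    unfold cutSize
    rw [← edgeCount_union_left hd, hXu]
  have p : ∀ {x y}, x ∈ X → y ∉ X → G.Adj x y →
      0 < G.edgeCount (X.filter fun v => f v = f x) Xᶜ := fun {x y} hx hy hxy =>
    edgeCount_pos (Finset.mem_filter.2 ⟨hx, rfl⟩) (Finset.mem_compl.2 hy) hxy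
  have pa := p ha ha' haa
  have pb := p hb hb' hbb
  have fa : f a = 0 ∨ f a = 1 := by omega
  have fb : f b = 0 ∨ f b = 1 := by omega
  rcases fa with fa | fa <;> rcases fb with fb | fb <;> rw [fa] at pa <;> rw [fb] at pb <;>
    first
    | exact fa.trans fb.symm
    | omega

end SimpleGraph

/-! ### Rotations and faces of cubic plane graphs -/

namespace SimpleGraph

variable {V : Type*} {G : SimpleGraph V}

lemma card_filter_dart (A B : Finset V) [Fintype G.Dart]
    [DecidablePred fun d : G.Dart => d.fst ∈ A ∧ d.snd ∈ B] :
    ((Finset.univ : Finset G.Dart).filter fun d => d.fst ∈ A ∧ d.snd ∈ B).card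
      = G.edgeCount A B := by
  classical
  rw [edgeCount_eq_card]
  refine Finset.card_bij (fun d _ => d.toProd) ?_ ?_ ?_
  · intro d hd
    rw [Finset.mem_filter] at hd
    rw [Finset.mem_filter, Finset.mem_product]
    exact ⟨hd.2, d.adj⟩
  · intro d _ e _ h
    exact Dart.ext _ _ h
  · rintro p hp
    rw [Finset.mem_filter, Finset.mem_product] at hp
    exact ⟨⟨p, hp.2⟩, by simpa using hp.1, rfl⟩

lemma two_mul_ncard_edgeSet [Fintype V] (H : SimpleGraph V) :
    2 * H.edgeSet.ncard = H.edgeCount Finset.univ Finset.univ := by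
  classical
  rw [edgeCount_eq_card, Set.ncard_eq_toFinset_card']
  have := H.two_mul_card_edgeFinset
  simpa [edgeFinset] using this

lemma two_mul_ncard_edgeSet_of_cubic [Fintype V] (hG : IsCubic G) :
    2 * G.edgeSet.ncard = 3 * Fintype.card V := by
  rw [two_mul_ncard_edgeSet, edgeCount_univ hG, Finset.card_univ]

section Rotation

variable {rot : Equiv.Perm G.Dart} (hG : IsCubic G) (hrot : ∀ d, (rot d).fst = d.fst)
  (hcyc : ∀ d e : G.Dart, d.fst = e.fst → rot.SameCycle d e)

include hG hcyc in
lemma rot_ne (d : G.Dart) : rot d ≠ d := by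
  intro h
  obtain ⟨c, hc, hne, -⟩ := hG.exists_third (x := d.fst) (a := d.snd) (b := d.snd)
  have h1 := hcyc d ⟨(d.fst, c), hc⟩ rfl
  have h2 := rel_of_sameCycle
    { r := fun a b => a = d ↔ b = d, iseqv := ⟨fun _ => Iff.rfl, Iff.symm, Iff.trans⟩ } rot
    (fun z => by
      constructor
      · rintro rfl; exact h
      · intro hz; exact rot.injective (hz.trans h.symm)) h1
  have h3 := h2.1 rfl
  exact hne (congrArg (fun e : G.Dart => e.snd) h3)

include hG hcyc in
lemma rot_rot_ne (d : G.Dart) : rot (rot d) ≠ d := by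
  intro h
  obtain ⟨c, hc, hne, hne'⟩ := hG.exists_third (x := d.fst) (a := d.snd) (b := (rot d).snd)
  have h1 := hcyc d ⟨(d.fst, c), hc⟩ rfl
  have h2 := rel_of_sameCycle
    { r := fun a b => (a = d ∨ a = rot d) ↔ (b = d ∨ b = rot d),
      iseqv := ⟨fun _ => Iff.rfl, Iff.symm, Iff.trans⟩ } rot
    (fun z => by
      constructor
      · rintro (rfl | rfl)
        · exact Or.inr rfl
        · exact Or.inl h
      · rintro (hz | hz)
        · exact Or.inr (rot.injective (hz.trans h.symm))
        · exact Or.inl (rot.injective hz)) h1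
  rcases h2.1 (Or.inl rfl) with h3 | h3
  · exact hne (congrArg (fun e : G.Dart => e.snd) h3)
  · exact hne' (congrArg (fun e : G.Dart => e.snd) h3)

include hG hrot hcyc in
lemma snd_rot_ne (d : G.Dart) : (rot d).snd ≠ d.snd := fun h =>
  rot_ne hG hcyc d (Dart.ext _ _ (Prod.ext (hrot d) h))

include hG hrot hcyc in
/-- The darts at a vertex of a cubic graph are the three iterates of any one of them. -/
lemma eq_rot_or (d e : G.Dart) (h : e.fst = d.fst) : e = d ∨ e = rot d ∨ e = rot (rot d) := by
  have h1 : G.Adj d.fst (rot d).snd := by rw [← hrot d]; exact (rot d).adj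
  have h2 : G.Adj d.fst (rot (rot d)).snd := by
    rw [← hrot d, ← hrot (rot d)]; exact (rot (rot d)).adj
  have h3 : (rot (rot d)).snd ≠ d.snd := fun h =>
    rot_rot_ne hG hcyc d (Dart.ext _ _ (Prod.ext ((hrot _).trans (hrot d)) h))
  rcases hG.eq_of_adj d.adj h1 h2 (snd_rot_ne hG hrot hcyc d).symm h3.symm
    (snd_rot_ne hG hrot hcyc (rot d)).symm (y := e.snd) (by rw [← h]; exact e.adj) with h | h' | h'
  · exact Or.inl (Dart.ext _ _ (Prod.ext (by assumption) h))
  · exact Or.inr (Or.inl (Dart.ext _ _ (Prod.ext (h.trans (hrot d).symm) h')))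
  · exact Or.inr (Or.inr (Dart.ext _ _
      (Prod.ext (h.trans ((hrot _).trans (hrot d)).symm) h')))

include hrot in
lemma facePerm_fst (d : G.Dart) : (facePerm rot d).fst = d.snd := hrot d.symm

include hG hrot hcyc in
lemma facePerm_sq_ne (d : G.Dart) : facePerm rot (facePerm rot d) ≠ d := by
  intro h
  have h1 : (facePerm rot d).snd = d.fst := by rw [← facePerm_fst hrot (facePerm rot d), h]
  exact rot_ne hG hcyc d.symm (Dart.ext _ _ (Prod.ext (hrot d.symm) h1))

include hrot in
lemma colour_facePerm (f : G.Coloring (Fin 2)) (d : G.Dart) :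
    f (facePerm rot d).fst = f d.fst + 1 := by
  have h := f.valid d.adj
  rw [facePerm_fst hrot]
  omega

include hG hrot hcyc in
/-- Faces of a bipartite cubic graph have length at least four, and at least six if not four:
odd lengths are excluded by the colours along the face. -/
lemma facePerm_pow_ne (f : G.Coloring (Fin 2)) (d : G.Dart) (n : ℕ) (hn : 0 < n) (hn5 : n < 6)
    (h4 : n = 4 → (facePerm rot ^ 4) d ≠ d) : (facePerm rot ^ n) d ≠ d := by
  have hc := fun e => colour_facePerm hrot f e
  intro h
  obtain rfl | rfl | rfl | rfl | rfl : n = 1 ∨ n = 2 ∨ n = 3 ∨ n = 4 ∨ n = 5 := by omega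
  · have hk := hc d
    change facePerm rot d = d at h
    rw [h] at hk
    omega
  · exact facePerm_sq_ne hG hrot hcyc d h
  · have hk := hc (facePerm rot (facePerm rot d))
    change facePerm rot (facePerm rot (facePerm rot d)) = d at h
    rw [h, hc, hc] at hk
    omega
  · exact h4 rfl h
  · have hk := hc (facePerm rot (facePerm rot (facePerm rot (facePerm rot d))))
    change facePerm rot (facePerm rot (facePerm rot (facePerm rot (facePerm rot d)))) = d at h
    rw [h, hc, hc, hc, hc] at hk
    omega

end Rotation

lemma injOn_pow_range {D : Type*} (π : Equiv.Perm D) (d : D) (m : ℕ)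
    (h : ∀ n, 0 < n → n < m → (π ^ n) d ≠ d) :
    Set.InjOn (fun k : ℕ => (π ^ k) d) (Finset.range m) := by
  have key : ∀ i j : ℕ, i < j → j < m → (π ^ i) d ≠ (π ^ j) d := by
    intro i j hij hj he
    refine h (j - i) (by omega) (by omega) ?_
    have : π ^ j = π ^ i * π ^ (j - i) := by rw [← pow_add]; congr 1; omega
    rw [this, Equiv.Perm.mul_apply] at he
    exact ((π ^ i).injective he).symm
  intro i hi j hj hij
  simp only [Finset.coe_range, Set.mem_Iio] at hi hj
  rcases lt_trichotomy i j with hlt | rfl | hlt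
  · exact absurd hij (key i j hlt hj)
  · rfl
  · exact absurd hij.symm (key j i hlt hi)

/-! ### The faces on one side of a 3-edge cut -/

/-- The edges with both ends in `X`. -/
def edgesWithin (G : SimpleGraph V) (X : Finset V) : Set (Sym2 V) :=
  {e | e ∈ G.edgeSet ∧ ∀ v ∈ e, v ∈ X}

lemma edgesWithin_subset (X : Finset V) : G.edgesWithin X ⊆ G.edgeSet := fun _ h => h.1

lemma mem_edgesWithin {X : Finset V} {d : G.Dart} :
    d.edge ∈ G.edgesWithin X ↔ d.fst ∈ X ∧ d.snd ∈ X := by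
  constructor
  · rintro ⟨-, h⟩
    exact ⟨h _ (Sym2.mem_mk_left _ _), h _ (Sym2.mem_mk_right _ _)⟩
  · rintro ⟨h1, h2⟩
    refine ⟨d.edge_mem, fun v hv => ?_⟩
    rcases Sym2.mem_iff.1 hv with rfl | rfl <;> assumption

lemma mem_edgesWithin_mk {X : Finset V} {x y : V} :
    s(x, y) ∈ G.edgesWithin X ↔ G.Adj x y ∧ x ∈ X ∧ y ∈ X := by
  simp [edgesWithin]

lemma two_mul_ncard_edgesWithin [Fintype V] (X : Finset V) :
    2 * (G.edgesWithin X).ncard = G.edgeCount X X := by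
  classical
  have h : (fromEdgeSet (G.edgesWithin X)).edgeSet = G.edgesWithin X := by
    ext e
    induction e using Sym2.ind with
    | h x y =>
    rw [mem_edgeSet, fromEdgeSet_adj, mem_edgesWithin_mk]
    constructor
    · exact fun h => h.1
    · exact fun h => ⟨h, h.1.ne⟩
  rw [← h, two_mul_ncard_edgeSet, edgeCount_eq_card, edgeCount_eq_card]
  refine congrArg Finset.card (Finset.ext fun p => ?_)
  simp only [Finset.mem_filter]
  rw [fromEdgeSet_adj, mem_edgesWithin_mk,
    Finset.mem_product, Finset.mem_product]
  constructor
  · rintro ⟨-, ⟨h1, h2⟩, -⟩; exact ⟨h2, h1⟩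
  · rintro ⟨h2, h1⟩; exact ⟨by simp, ⟨h1, h2⟩, h1.ne⟩

/-- Vertices outside `X` are isolated in the graph of the edges within `X`. -/
lemma card_compl_add_one_le_numComp [Fintype V] [DecidableEq V] (X : Finset V) (hX : X.Nonempty) :
    Fintype.card V - X.card + 1 ≤ numComp (G.edgesWithin X) := by
  have h0 : Nat.card (Option {v : V // v ∈ Xᶜ}) = Fintype.card V - X.card + 1 := by
    rw [Finite.card_option, Nat.card_eq_fintype_card, Fintype.card_coe, Finset.card_compl]
  rw [← h0]
  have hstep : ∀ a b, (fromEdgeSet (G.edgesWithin X)).Adj a b → a ∈ X ∧ b ∈ X := by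
    intro a b h
    rw [fromEdgeSet_adj, mem_edgesWithin_mk] at h
    exact h.1.2
  let g : V → Option {v : V // v ∈ Xᶜ} := fun v =>
    if h : v ∈ Xᶜ then some ⟨v, h⟩ else none
  have hg : ∀ a b, (fromEdgeSet (G.edgesWithin X)).Reachable a b → g a = g b := by
    rintro a b ⟨w⟩
    induction w with
    | nil => rfl
    | cons h w ih =>
      rw [← ih]
      obtain ⟨h1, h2⟩ := hstep _ _ h
      simp [g, h1, h2]
  refine Nat.card_le_card_of_surjective
    (fun c : (fromEdgeSet (G.edgesWithin X)).ConnectedComponent => Quot.lift g hg c) ?_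
  rintro (_ | ⟨v, hv⟩)
  · obtain ⟨x, hx⟩ := hX
    refine ⟨connectedComponentMk _ x, ?_⟩
    change g x = none
    simp [g, hx]
  · refine ⟨connectedComponentMk _ v, ?_⟩
    change g v = _
    simp only [g, hv, dite_true]

lemma numComp_of_preconnected [Finite V] [Nonempty V] {S : Set (Sym2 V)}
    (h : (fromEdgeSet S).Preconnected) : numComp S = 1 := by
  unfold numComp
  rw [Nat.card_eq_one_iff_unique]
  refine ⟨⟨fun a b => ?_⟩, ⟨connectedComponentMk _ (Classical.arbitrary V)⟩⟩
  induction a using ConnectedComponent.ind with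
  | h a =>
  induction b using ConnectedComponent.ind with
  | h b => exact ConnectedComponent.sound (h a b)

section

variable [Fintype V] [DecidableEq V]

/-- Deleting at most two edges leaves a 3-edge-connected graph connected. -/
lemma IsThreeEdgeConnected.preconnected_sdiff (h : G.IsThreeEdgeConnected) (D : Set (Sym2 V))
    (hD : D.ncard ≤ 2) : (fromEdgeSet (G.edgeSet \ D)).Preconnected := by
  classical
  refine preconnected_of_forall_closed _ fun A hA hc => ?_
  by_contra hne
  have h1 := h A.toFinset (by simpa using hA) (by simpa using hne)
  unfold cutSize at h1
  rw [edgeCount_eq_card] at h1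
  have h2 : ((A.toFinset ×ˢ A.toFinsetᶜ).filter fun p => G.Adj p.1 p.2).card ≤ D.ncard := by
    rw [Set.ncard_eq_toFinset_card']
    refine Finset.card_le_card_of_injOn (fun p => s(p.1, p.2)) ?_ ?_
    · intro p hp
      simp only [Finset.coe_filter, Finset.mem_product, Set.mem_toFinset, Finset.mem_compl,
        Set.mem_ofPred_eq] at hp
      rw [Set.coe_toFinset]
      by_contra hpD
      exact hp.1.2 (hc p.1 hp.1.1 p.2 (by
        rw [fromEdgeSet_adj]
        exact ⟨⟨hp.2, hpD⟩, hp.2.ne⟩))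
    · intro p hp q hq hpq
      simp only [Finset.coe_filter, Finset.mem_product, Set.mem_toFinset, Finset.mem_compl,
        Set.mem_ofPred_eq] at hp hq
      rcases Sym2.eq_iff.1 hpq with h | h
      · exact Prod.ext h.1 h.2
      · exact absurd hp.1.1 (h.1 ▸ hq.1.2)
  omega

/-- On a nontrivial side of a 3-edge cut every vertex keeps at least two neighbours. -/
lemma two_le_edgeCount_of_cutSize_eq_three (hG : IsCubic G) (h3 : G.IsThreeEdgeConnected)
    {X : Finset V} (hX : G.cutSize X = 3) (hX1 : 1 < X.card) {a : V} (ha : a ∈ X) :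
    2 ≤ G.edgeCount {a} X := by
  have h1 := cutSize_erase hG ha
  have h2 := Finset.card_erase_add_one ha
  have h4 := h3 (X.erase a) (Finset.card_pos.1 (by omega)) (fun h => by
    have := Finset.mem_univ a
    rw [← h] at this
    exact absurd this (Finset.notMem_erase a X))
  omega

lemma snd_eq_of_cutSize_eq_three (hG : IsCubic G) (h3 : G.IsThreeEdgeConnected)
    {X : Finset V} (hX : G.cutSize X = 3) (hX1 : 1 < X.card) {a p q : V} (ha : a ∈ X)
    (hp : p ∉ X) (hq : q ∉ X) (hap : G.Adj a p) (haq : G.Adj a q) : p = q := by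
  by_contra hpq
  have h1 := two_le_edgeCount_of_cutSize_eq_three hG h3 hX hX1 ha
  have h2 : G.edgeCount {a} X + G.edgeCount {a} {p, q} ≤ 3 := by
    rw [← edgeCount_singleton_univ hG a, ← edgeCount_union_right]
    · exact edgeCount_mono_right (Finset.subset_univ _) _
    · rw [Finset.disjoint_left]
      intro x hx hx'
      simp only [Finset.mem_insert, Finset.mem_singleton] at hx'
      rcases hx' with rfl | rfl <;> contradiction
  rw [edgeCount_insert_right (by simpa using hpq), edgeCount_singleton_of_adj hap,
    edgeCount_singleton_of_adj haq] at h2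
  omega

variable (M : PlaneEmbedding G) (hG : IsCubic G) (h3 : G.IsThreeEdgeConnected)
  (f : G.Coloring (Fin 2)) {X : Finset V}

omit [DecidableEq V] in
lemma fst_mem_of_sameCycle {d e : G.Dart}
    (h : (facePermIn M.rot (G.edgesWithin X)).SameCycle d e) : d.fst ∈ X ↔ e.fst ∈ X := by
  refine rel_of_sameCycle
    { r := fun a b : G.Dart => a.fst ∈ X ↔ b.fst ∈ X,
      iseqv := ⟨fun _ => Iff.rfl, Iff.symm, Iff.trans⟩ } _ (fun z => ?_) h
  change z.fst ∈ X ↔ (facePermIn M.rot (G.edgesWithin X) z).fst ∈ X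
  classical
  rw [facePermIn_fst M.rot_fst]
  split_ifs with hz
  · rw [mem_edgesWithin] at hz
    simp [hz.1, hz.2]
  · rfl

omit [Fintype V] [DecidableEq V] in
/-- Permutations that agree on a cycle have this cycle in common. -/
lemma sameCycle_of_agree {D : Type*} {ρ σ : Equiv.Perm D} {x z : D}
    (h : ∀ y, ρ.SameCycle x y → σ y = ρ y) (hz : σ.SameCycle x z) : ρ.SameCycle x z := by
  refine (rel_of_sameCycle
    { r := fun a b => ρ.SameCycle x a ↔ ρ.SameCycle x b,
      iseqv := ⟨fun _ => Iff.rfl, Iff.symm, Iff.trans⟩ } σ (fun w => ?_) hz).1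
      (Equiv.Perm.SameCycle.refl _ _)
  constructor
  · intro hw
    rw [h w hw]
    exact hw.apply_right
  · intro hw
    have h1 : ρ.SameCycle x (ρ.symm (σ w)) := by
      rw [← Equiv.Perm.sameCycle_apply_right, Equiv.apply_symm_apply]
      exact hw
    have h2 := h _ h1
    rw [Equiv.apply_symm_apply] at h2
    rwa [σ.injective h2] at h1

include hG h3 in
/-- The outer face of one side of an edge cut does not contain a single cut edge only: otherwise
deleting this edge would disconnect the graph. -/
lemma exists_other_cut_dart {x : G.Dart} (hx : x.fst ∈ X) (hx' : x.snd ∉ X) :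
    ∃ y : G.Dart, y ≠ x ∧ y.snd ∉ X ∧
      (facePermIn M.rot (G.edgesWithin X)).SameCycle x y := by
  classical
  by_contra! hn
  have : Nonempty V := ⟨x.fst⟩
  set T : Set (Sym2 V) := G.edgeSet \ {x.edge} with hT
  have hne := hG.exists_adj
  have e1 := numCycles_facePermIn M hne (S := T) Set.sdiff_subset
  have e2 := numCycles_facePermIn M hne (S := G.edgeSet) subset_rfl
  have n1 : numComp T = 1 := numComp_of_preconnected
    (h3.preconnected_sdiff _ (by simp))
  have n2 : numComp G.edgeSet = 1 := numComp_of_preconnected (by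
    rw [fromEdgeSet_edgeSet]; exact h3.preconnected)
  have n3 : T.ncard + 1 = G.edgeSet.ncard :=
    Set.ncard_sdiff_singleton_add_one x.edge_mem (Set.toFinite _)
  have hxT : x.edge ∉ T := by simp [hT]
  have hins : insert x.edge T = G.edgeSet := by
    rw [hT, Set.insert_sdiff_singleton, Set.insert_eq_of_mem x.edge_mem]
  have hmul := facePermIn_insert M.rot x hxT
  rw [hins] at hmul
  -- the edge of `x` has the same face of `G` minus this edge on both sides, by Euler's formula
  have hsame : (facePermIn M.rot T).SameCycle x x.symm := by
    by_contra hs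
    have h1 := numCycles_mul_swap_lt _ _ _ hs
    have h2 : numCycles (facePermIn M.rot G.edgeSet)
        = numCycles (facePermIn M.rot T * Equiv.swap x x.symm) := by rw [hmul]; congr!
    omega
  -- the outer face does not see that further edges are deleted, but it cannot leave `X`
  have hS : (facePermIn M.rot (G.edgesWithin X)).SameCycle x x.symm := by
    refine sameCycle_of_agree (fun y hy => ?_) hsame
    have hyX : y.fst ∈ X := (fst_mem_of_sameCycle M hy).1 hx
    by_cases hys : y.snd ∈ X
    · have h1 : y.edge ∈ G.edgesWithin X := mem_edgesWithin.2 ⟨hyX, hys⟩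
      have h2 : y.edge ∈ T := by
        refine ⟨y.edge_mem, fun h => hx' ?_⟩
        rw [Set.mem_singleton_iff] at h
        rw [h] at h1
        exact (mem_edgesWithin.1 h1).2
      rw [facePermIn_of_mem _ h1, facePermIn_of_mem _ h2]
    · have hyx : y = x := by
        by_contra hyx
        exact hn y hyx hys hy
      subst hyx
      rw [facePermIn_of_notMem _ hxT, facePermIn_of_notMem _ fun h => hys (mem_edgesWithin.1 h).2]
  exact hx' ((fst_mem_of_sameCycle M hS).1 hx)

include hG h3 in
/-- The three edges of a 3-edge cut lie on one face of either side, since each face that has one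
of them has two. -/
lemma sameCycle_cut_darts (hX : G.cutSize X = 3) {x y : G.Dart} (hx : x.fst ∈ X) (hx' : x.snd ∉ X)
    (hy : y.fst ∈ X) (hy' : y.snd ∉ X) :
    (facePermIn M.rot (G.edgesWithin X)).SameCycle x y := by
  classical
  by_contra hn
  obtain ⟨x2, hx2, hx2', hxx⟩ := exists_other_cut_dart M hG h3 hx hx'
  obtain ⟨y2, hy2, hy2', hyy⟩ := exists_other_cut_dart M hG h3 hy hy'
  have hx2X := (fst_mem_of_sameCycle M hxx).1 hx
  have hy2X := (fst_mem_of_sameCycle M hyy).1 hy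
  have hcard := (card_filter_dart (G := G) X Xᶜ).trans hX
  have h4 : ({x, x2, y, y2} : Finset G.Dart).card = 4 := by
    have a1 : x ≠ x2 := hx2.symm
    have a2 : x ≠ y := by rintro rfl; exact hn (Equiv.Perm.SameCycle.refl _ _)
    have a3 : x ≠ y2 := by rintro rfl; exact hn hyy.symm
    have a4 : x2 ≠ y := by rintro rfl; exact hn hxx
    have a5 : x2 ≠ y2 := by rintro rfl; exact hn (hxx.trans hyy.symm)
    have a6 : y ≠ y2 := hy2.symm
    rw [Finset.card_insert_of_notMem, Finset.card_insert_of_notMem, Finset.card_pair a6] <;>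
      simp [*]
  have h5 : ({x, x2, y, y2} : Finset G.Dart) ⊆
      (Finset.univ : Finset G.Dart).filter fun d => d.fst ∈ X ∧ d.snd ∈ Xᶜ := by
    intro z hz
    simp only [Finset.mem_insert, Finset.mem_singleton] at hz
    rw [Finset.mem_filter, Finset.mem_compl]
    rcases hz with rfl | rfl | rfl | rfl <;> exact ⟨Finset.mem_univ _, by assumption, by assumption⟩
  have := Finset.card_le_card h5
  omega

open Classical in
include hG h3 f in
/-- The outer face of one side of a 3-edge cut has at least nine darts: the three cut darts, the
three darts following these, and the three darts after that. -/
lemma nine_le_card_outer (hX : G.cutSize X = 3) (hX1 : 1 < X.card) {x : G.Dart}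
    (hx : x.fst ∈ X) (hx' : x.snd ∉ X) :
    9 ≤ ((Finset.univ : Finset G.Dart).filter fun e =>
      (facePermIn M.rot (G.edgesWithin X)).SameCycle x e).card := by
  set ρ := facePermIn M.rot (G.edgesWithin X) with hρ
  set C := (Finset.univ : Finset G.Dart).filter fun d => d.fst ∈ X ∧ d.snd ∈ Xᶜ with hC
  have hcard : C.card = 3 := by rw [hC, card_filter_dart]; exact hX
  have memC : ∀ {d}, d ∈ C ↔ d.fst ∈ X ∧ d.snd ∉ X := fun {d} => by simp [hC]
  have hρC : ∀ d ∈ C, ρ d = M.rot d := fun d hd =>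
    facePermIn_of_notMem _ fun h => (memC.1 hd).2 (mem_edgesWithin.1 h).2
  have hρfst : ∀ d ∈ C, (ρ d).fst = d.fst := fun d hd => by rw [hρC d hd, M.rot_fst]
  have hρsnd : ∀ d ∈ C, (ρ d).snd ∈ X := by
    intro d hd
    by_contra hs
    refine snd_rot_ne hG M.rot_fst M.rot_cyclic d ?_
    rw [← hρC d hd]
    refine snd_eq_of_cutSize_eq_three hG h3 hX hX1 (memC.1 hd).1 hs (memC.1 hd).2 ?_ d.adj
    rw [← hρfst d hd]
    exact (ρ d).adj
  have hρρ : ∀ d ∈ C, (ρ (ρ d)).fst = (ρ d).snd := by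
    intro d hd
    rw [hρ, facePermIn_fst M.rot_fst, if_pos]
    exact mem_edgesWithin.2 ⟨by rw [hρfst d hd]; exact (memC.1 hd).1, hρsnd d hd⟩
  have hxC : x ∈ C := memC.2 ⟨hx, hx'⟩
  -- a cut dart and its successor start at one colour, the dart after these at the other
  have col : ∀ d ∈ C, f d.fst = f x.fst := fun d hd =>
    colour_eq_of_cutSize_eq_three hG f hX (memC.1 hd).1 (memC.1 hd).2 d.adj hx hx' x.adj
  have col2 : ∀ d ∈ C, f (ρ (ρ d)).fst ≠ f x.fst := by
    intro d hd
    rw [hρρ d hd, ← col d hd, ← hρfst d hd]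
    exact fun h => f.valid (ρ d).adj h.symm
  have d1 : Disjoint C (C.image ρ) := by
    rw [Finset.disjoint_left]
    intro d hd hd'
    obtain ⟨e, he, rfl⟩ := Finset.mem_image.1 hd'
    exact (memC.1 hd).2 (hρsnd e he)
  have d2 : Disjoint (C ∪ C.image ρ) (C.image fun d => ρ (ρ d)) := by
    rw [Finset.disjoint_left]
    intro d hd hd'
    obtain ⟨e, he, rfl⟩ := Finset.mem_image.1 hd'
    rcases Finset.mem_union.1 hd with h | h
    · exact col2 e he (col _ h)
    · obtain ⟨e', he', h'⟩ := Finset.mem_image.1 h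
      refine col2 e he ?_
      rw [← h', hρfst e' he', col e' he']
  have hc : ((C ∪ C.image ρ) ∪ C.image fun d => ρ (ρ d)).card = 9 := by
    rw [Finset.card_union_of_disjoint d2, Finset.card_union_of_disjoint d1,
      Finset.card_image_of_injective _ ρ.injective,
      Finset.card_image_of_injective C (f := fun d => ρ (ρ d)) (ρ.injective.comp ρ.injective),
      hcard]
  rw [← hc]
  refine Finset.card_le_card fun z hz => ?_
  have hsame : ∀ d ∈ C, ρ.SameCycle x d := fun d hd =>
    sameCycle_cut_darts M hG h3 hX hx hx' (memC.1 hd).1 (memC.1 hd).2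
  rw [Finset.mem_filter]
  refine ⟨Finset.mem_univ _, ?_⟩
  simp only [Finset.mem_union, Finset.mem_image] at hz
  rcases hz with (h | ⟨e, he, rfl⟩) | ⟨e, he, rfl⟩
  · exact hsame z h
  · exact (hsame e he).apply_right
  · exact (hsame e he).apply_right.apply_right

open Classical in
include hG h3 f in
/-- Counting darts over the faces of one side of a 3-edge cut, when all inner faces have at least
`m` darts. For `m = 4` this says that the side has at least seven vertices; for `m = 6` it is
impossible. -/
lemma card_bound_of_inner_faces (hX : G.cutSize X = 3) (hX1 : 1 < X.card) {m : ℕ}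
    (hm : m = 4 ∨ m = 6)
    (hin : ∀ d : G.Dart, d.fst ∈ X →
      (∀ e, (facePermIn M.rot (G.edgesWithin X)).SameCycle d e → e.snd ∈ X) →
      m ≤ ((Finset.univ : Finset G.Dart).filter fun e =>
        (facePermIn M.rot (G.edgesWithin X)).SameCycle d e).card) :
    3 * m * (X.card - 1) + 54 ≤ 18 * X.card := by
  set ρ := facePermIn M.rot (G.edgesWithin X) with hρ
  have hXne : X.Nonempty := Finset.card_pos.1 (by omega)
  have hXle : X.card ≤ Fintype.card V := Finset.card_le_univ X
  -- Euler's formula gives the number of cycles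
  have e1 := numCycles_facePermIn M hG.exists_adj (edgesWithin_subset X)
  have e2 := two_mul_ncard_edgesWithin (G := G) X
  have e3 := edgeCount_self_add_cutSize hG X
  have e4 := card_compl_add_one_le_numComp (G := G) X hXne
  rw [← hρ, Nat.card_eq_fintype_card] at e1
  -- Weight the darts such that all cycles except the outer face of `X` weigh at least `3 * m`:
  -- the vertices outside `X` are isolated and carry cycles of length three.
  set ω : G.Dart → ℕ := fun d => if d.fst ∈ X then 3 else m with hω
  have htot : ∑ d, ω d = 9 * X.card + 3 * m * (Fintype.card V - X.card) := by
    have a1 := card_filter_dart (G := G) X Finset.univ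
    have a2 := card_filter_dart (G := G) Xᶜ Finset.univ
    rw [edgeCount_univ hG] at a1 a2
    rw [Finset.card_compl] at a2
    simp only [Finset.mem_univ, and_true, Finset.mem_compl] at a1 a2
    rw [hω, Finset.sum_ite, Finset.sum_const, Finset.sum_const, a1, a2]
    simp only [smul_eq_mul]
    ring
  let cyc := Quotient (Equiv.Perm.SameCycle.setoid ρ)
  have : Fintype cyc := Fintype.ofFinite _
  let mk : G.Dart → cyc := fun d => Quotient.mk _ d
  have hfib := Finset.sum_fiberwise (Finset.univ : Finset G.Dart) mk ω
  have hfilt : ∀ d : G.Dart, (Finset.univ.filter fun e => mk e = mk d)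
      = Finset.univ.filter fun e => ρ.SameCycle d e := by
    intro d
    ext e
    simp only [Finset.mem_filter, Finset.mem_univ, true_and]
    exact ⟨fun h => (Quotient.exact h).symm, fun h => Quotient.sound h.symm⟩
  -- a cycle in `X` has weight three times its length
  have hwt : ∀ d : G.Dart, d.fst ∈ X → ∑ e with mk e = mk d, ω e
      = 3 * (Finset.univ.filter fun e => ρ.SameCycle d e).card := by
    intro d hd
    rw [hfilt, Finset.sum_congr rfl (g := fun _ => 3), Finset.sum_const, smul_eq_mul, mul_comm]
    intro e he
    rw [Finset.mem_filter] at he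
    simp only [hω]
    rw [if_pos ((fst_mem_of_sameCycle M he.2).1 hd)]
  obtain ⟨a, ha, b, hb, hab⟩ : ∃ a ∈ X, ∃ b ∈ Xᶜ, G.Adj a b := by
    by_contra! hn
    have : G.cutSize X = 0 := edgeCount_eq_zero.2 hn
    omega
  let x : G.Dart := ⟨(a, b), hab⟩
  have hx : x.fst ∈ X := ha
  have hx' : x.snd ∉ X := by simpa using hb
  have h9 := nine_le_card_outer M hG h3 f hX hX1 hx hx'
  rw [← hρ] at h9
  have hother : ∀ q : cyc, q ≠ mk x → 3 * m ≤ ∑ e with mk e = q, ω e := by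
    intro q hq
    induction q using Quotient.inductionOn with
    | h d =>
    change 3 * m ≤ ∑ e with mk e = mk d, ω e
    by_cases hd : d.fst ∈ X
    · rw [hwt d hd]
      refine Nat.mul_le_mul_left 3 (hin d hd fun e he => ?_)
      by_contra hes
      refine hq (Quotient.sound (he.trans ?_))
      exact sameCycle_cut_darts M hG h3 hX ((fst_mem_of_sameCycle M he).1 hd) hes hx hx'
    · rw [hfilt]
      have hout : ∀ e : G.Dart, e.fst ∉ X → ρ e = M.rot e := fun e he =>
        facePermIn_of_notMem _ fun h => he (mem_edgesWithin.1 h).1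
      have r1 : ρ d = M.rot d := hout d hd
      have r2 : ρ (ρ d) = M.rot (M.rot d) := by
        rw [r1, hout _ (by rwa [M.rot_fst])]
      have hsub : ({d, M.rot d, M.rot (M.rot d)} : Finset G.Dart) ⊆
          Finset.univ.filter fun e => ρ.SameCycle d e := by
        intro e he
        simp only [Finset.mem_insert, Finset.mem_singleton] at he
        rw [Finset.mem_filter]
        refine ⟨Finset.mem_univ _, ?_⟩
        rcases he with rfl | rfl | rfl
        · exact Equiv.Perm.SameCycle.refl _ _
        · rw [← r1]; exact (Equiv.Perm.SameCycle.refl _ _).apply_right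
        · rw [← r2]; exact (Equiv.Perm.SameCycle.refl _ _).apply_right.apply_right
      have hc3 : ({d, M.rot d, M.rot (M.rot d)} : Finset G.Dart).card = 3 := by
        have n1 := rot_ne hG M.rot_cyclic d
        have n2 := rot_ne hG M.rot_cyclic (M.rot d)
        have n3 := rot_rot_ne hG M.rot_cyclic d
        rw [Finset.card_insert_of_notMem, Finset.card_pair n2.symm]
        simp [n1.symm, n3.symm]
      refine le_trans ?_ (Finset.sum_le_sum_of_subset hsub)
      rw [Finset.sum_congr rfl (g := fun _ => m), Finset.sum_const, hc3, smul_eq_mul]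
      intro e he
      simp only [Finset.mem_insert, Finset.mem_singleton] at he
      simp only [hω]
      rw [if_neg]
      rcases he with rfl | rfl | rfl <;> simpa [M.rot_fst] using hd
  have hsum : 27 + (numCycles ρ - 1) * (3 * m) ≤ ∑ d, ω d := by
    rw [← hfib, ← Finset.add_sum_erase _ _ (Finset.mem_univ (mk x))]
    refine Nat.add_le_add ?_ ?_
    · rw [hwt x hx]; omega
    · have hce : (Finset.univ.erase (mk x)).card = numCycles ρ - 1 := by
        rw [Finset.card_erase_of_mem (Finset.mem_univ _), Finset.card_univ, numCycles,
          Nat.card_eq_fintype_card]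
      rw [← hce, ← smul_eq_mul]
      refine Finset.card_nsmul_le_sum _ _ _ fun q hq => hother q (Finset.ne_of_mem_erase hq)
  rw [htot] at hsum
  rcases hm with rfl | rfl <;> omega

omit [DecidableEq V] in
/-- Inner faces of one side of an edge cut are faces of the whole graph. -/
lemma facePermIn_pow_eq {d : G.Dart} (hd : d.fst ∈ X)
    (hin : ∀ e, (facePermIn M.rot (G.edgesWithin X)).SameCycle d e → e.snd ∈ X) (k : ℕ) :
    (facePermIn M.rot (G.edgesWithin X) ^ k) d = (facePerm M.rot ^ k) d := by
  induction k with
  | zero => rfl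
  | succ k ih =>
    have hs : (facePermIn M.rot (G.edgesWithin X)).SameCycle d
        ((facePermIn M.rot (G.edgesWithin X) ^ k) d) :=
      (Equiv.Perm.SameCycle.refl _ _).pow_right
    have hmem : ((facePermIn M.rot (G.edgesWithin X) ^ k) d).edge ∈ G.edgesWithin X :=
      mem_edgesWithin.2 ⟨(fst_mem_of_sameCycle M hs).1 hd, hin _ hs⟩
    rw [pow_succ', pow_succ', Equiv.Perm.mul_apply, Equiv.Perm.mul_apply, ← ih,
      facePermIn_of_mem _ hmem]
    rfl

omit [DecidableEq V] in
include hG f in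
lemma le_card_inner_face {m : ℕ} (hm : m ≤ 6) {d : G.Dart} (hd : d.fst ∈ X)
    (hin : ∀ e, (facePermIn M.rot (G.edgesWithin X)).SameCycle d e → e.snd ∈ X)
    (h4 : 4 < m → (facePermIn M.rot (G.edgesWithin X) ^ 4) d ≠ d) [Fintype G.Dart]
    [DecidablePred fun e => (facePermIn M.rot (G.edgesWithin X)).SameCycle d e] :
    m ≤ ((Finset.univ : Finset G.Dart).filter fun e =>
        (facePermIn M.rot (G.edgesWithin X)).SameCycle d e).card := by
  classical
  have hpow := facePermIn_pow_eq M hd hin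
  have hinj := injOn_pow_range (facePermIn M.rot (G.edgesWithin X)) d m (fun n h0 hn => by
    rw [hpow]
    refine facePerm_pow_ne hG M.rot_fst M.rot_cyclic f d n h0 (by omega) fun h => ?_
    rw [← hpow]
    exact h4 (by omega))
  calc m = (Finset.range m).card := (Finset.card_range m).symm
    _ = ((Finset.range m).image fun k => (facePermIn M.rot (G.edgesWithin X) ^ k) d).card :=
      (Finset.card_image_of_injOn hinj).symm
    _ ≤ _ := by
      refine Finset.card_le_card fun e he => ?_
      obtain ⟨k, -, rfl⟩ := Finset.mem_image.1 he
      rw [Finset.mem_filter]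
      exact ⟨Finset.mem_univ _, (Equiv.Perm.SameCycle.refl _ _).pow_right⟩

include M hG h3 f in
/-- A nontrivial side of a 3-edge cut has room for at least a cube minus a vertex. -/
lemma seven_le_card_of_cutSize_eq_three (hX : G.cutSize X = 3) (hX1 : 1 < X.card) :
    7 ≤ X.card := by
  classical
  have h := card_bound_of_inner_faces M hG h3 f hX hX1 (Or.inl rfl)
    (fun d hd hin => le_card_inner_face M hG f (by omega) hd hin (by omega))
  omega

include hG h3 f in
/-- Either side of a nontrivial 3-edge cut contains a 4-face. -/
theorem exists_fourFace_within (hX : G.cutSize X = 3) (hX1 : 1 < X.card) :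
    ∃ d : G.Dart, (facePerm M.rot ^ 4) d = d ∧ ∀ k, ((facePerm M.rot ^ k) d).fst ∈ X := by
  classical
  set ρ := facePermIn M.rot (G.edgesWithin X) with hρ
  obtain ⟨d, hd, hin, h4⟩ : ∃ d : G.Dart, d.fst ∈ X ∧ (∀ e, ρ.SameCycle d e → e.snd ∈ X) ∧
      (ρ ^ 4) d = d := by
    by_contra! hn
    have h := card_bound_of_inner_faces M hG h3 f hX hX1 (Or.inr rfl)
      (fun d hd hin => le_card_inner_face M hG f le_rfl hd hin fun _ => hn d hd hin)
    omega
  have hpow := facePermIn_pow_eq M hd hin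
  refine ⟨d, by rw [← hpow, h4], fun k => ?_⟩
  rw [← hpow]
  exact (fst_mem_of_sameCycle M (Equiv.Perm.SameCycle.refl _ _).pow_right).1 hd

end

end SimpleGraph

/-! ### Four-cycles whose reductions are both obstructed -/

namespace SimpleGraph

variable {V : Type*} {G : SimpleGraph V}

/-- A 4-cycle `v 0, v 1, v 2, v 3` together with the neighbours `u i` of the `v i` off the cycle,
all eight vertices being distinct. Indices are taken modulo four. -/
structure IsSquare (G : SimpleGraph V) (v u : Fin 4 → V) : Prop where
  adj : ∀ i, G.Adj (v i) (v (i + 1))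
  adj_out : ∀ i, G.Adj (v i) (u i)
  v_inj : Function.Injective v
  u_inj : Function.Injective u
  ne : ∀ i j, v i ≠ u j

/-- Relabelling a square from its `k`-th vertex on. -/
lemma IsSquare.rotate {v u : Fin 4 → V} (h : IsSquare G v u) (k : Fin 4) :
    IsSquare G (fun i => v (i + k)) (fun i => u (i + k)) where
  adj i := by rw [add_right_comm]; exact h.adj _
  adj_out i := h.adj_out _
  v_inj := h.v_inj.comp (add_left_injective k)
  u_inj := h.u_inj.comp (add_left_injective k)
  ne i j := h.ne _ _

lemma IsSquare.adj_prev {v u : Fin 4 → V} (h : IsSquare G v u) (i : Fin 4) :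
    G.Adj (v i) (v (i + 3)) := by
  have := h.adj (i + 3)
  rw [show i + 3 + 1 = i by omega] at this
  exact this.symm

lemma IsSquare.eq_of_adj {v u : Fin 4 → V} (h : IsSquare G v u) (hG : IsCubic G) {i : Fin 4} {y : V}
    (hy : G.Adj (v i) y) : y = v (i + 1) ∨ y = v (i + 3) ∨ y = u i :=
  hG.eq_of_adj (h.adj i) (h.adj_prev i) (h.adj_out i) (h.v_inj.ne (by omega)) (h.ne _ _)
    (h.ne _ _) hy

open Classical in
/-- The number of neighbours in `A` of a vertex with the three neighbours `a`, `b` and `c`. -/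
lemma edgeCount_singleton_eq (hG : IsCubic G) {x a b c : V} (ha : G.Adj x a) (hb : G.Adj x b)
    (hc : G.Adj x c) (hab : a ≠ b) (hac : a ≠ c) (hbc : b ≠ c) (A : Finset V) :
    G.edgeCount {x} A = (if a ∈ A then 1 else 0) + (if b ∈ A then 1 else 0)
      + (if c ∈ A then 1 else 0) := by
  have h : ∀ y, (if G.Adj x y then 1 else 0) = (if a = y then 1 else 0) + (if b = y then 1 else 0)
      + (if c = y then 1 else 0) := by
    intro y
    by_cases hy : G.Adj x y
    · rw [if_pos hy]
      rcases hG.eq_of_adj ha hb hc hab hac hbc hy with rfl | rfl | rfl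
      · simp [hab.symm, hac.symm]
      · simp [hab, hbc.symm]
      · simp [hac, hbc]
    · have h1 : a ≠ y := by rintro rfl; exact hy ha
      have h2 : b ≠ y := by rintro rfl; exact hy hb
      have h3 : c ≠ y := by rintro rfl; exact hy hc
      simp [hy, h1, h2, h3]
  rw [edgeCount, Finset.sum_singleton, Finset.sum_congr rfl fun y _ => h y,
    Finset.sum_add_distrib, Finset.sum_add_distrib, Finset.sum_ite_eq, Finset.sum_ite_eq,
    Finset.sum_ite_eq]

lemma edgeCount_eq_sum (A B : Finset V) : G.edgeCount A B = ∑ x ∈ A, G.edgeCount {x} B := by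
  simp only [edgeCount, Finset.sum_singleton]

lemma edgeCount_singleton_le (x : V) {A B : Finset V} (h : ∀ y ∈ A, G.Adj x y → y ∈ B) :
    G.edgeCount {x} A ≤ G.edgeCount {x} B := by
  classical
  rw [edgeCount, edgeCount, Finset.sum_singleton, Finset.sum_singleton, ← Finset.card_filter,
    ← Finset.card_filter]
  refine Finset.card_le_card fun y hy => ?_
  rw [Finset.mem_filter] at hy ⊢
  exact ⟨h y hy.1 hy.2, hy.2⟩

/-- A set with exactly four outgoing edges that separates `v 0`, `v 1` from `v 2`, `v 3`: the
obstruction to the reduction that adds the edges `u 0 u 1` and `u 2 u 3`. -/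
structure IsObstruction [Fintype V] [DecidableEq V] (G : SimpleGraph V) (v u : Fin 4 → V)
    (X : Finset V) : Prop where
  cutSize : G.cutSize X = 4
  v0 : v 0 ∈ X
  v1 : v 1 ∈ X
  u0 : u 0 ∈ X
  u1 : u 1 ∈ X
  v2 : v 2 ∉ X
  v3 : v 3 ∉ X
  u2 : u 2 ∉ X
  u3 : u 3 ∉ X

/-- The sets `R i` are the remaining vertices of `G` grouped such that contracting each of them
turns `G` into the cube with the 4-face `v 0, v 1, v 2, v 3`. -/
structure IsCubeLike [Fintype V] [DecidableEq V] (G : SimpleGraph V) (v u : Fin 4 → V)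
    (R : Fin 4 → Finset V) : Prop where
  cutSize : ∀ i, G.cutSize (R i) = 3
  mem : ∀ i, u i ∈ R i
  notMem : ∀ i j, v j ∉ R i
  cover : ∀ x, (∃ i, x = v i) ∨ ∃ i, x ∈ R i
  disj : ∀ i j, i ≠ j → Disjoint (R i) (R j)
  opp : ∀ i, ∀ x ∈ R i, ∀ y ∈ R (i + 2), ¬ G.Adj x y

section

variable [Fintype V] [DecidableEq V]

lemma IsCubeLike.rotate {v u : Fin 4 → V} {R : Fin 4 → Finset V} (h : IsCubeLike G v u R)
    (k : Fin 4) :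
    IsCubeLike G (fun i => v (i + k)) (fun i => u (i + k)) (fun i => R (i + k)) where
  cutSize i := h.cutSize _
  mem i := h.mem _
  notMem i j := h.notMem _ _
  cover x := by
    rcases h.cover x with ⟨i, hi⟩ | ⟨i, hi⟩
    · exact Or.inl ⟨i - k, by simpa using hi⟩
    · exact Or.inr ⟨i - k, by simpa using hi⟩
  disj i j hij := h.disj _ _ ((add_left_injective k).ne hij)
  opp i x hx y hy := h.opp (i + k) x hx y (by rwa [add_right_comm])

lemma IsSquare.cutSize_erase (hG : IsCubic G) {v u : Fin 4 → V} (hs : IsSquare G v u) {i : Fin 4}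
    {Q : Finset V} (hv : v i ∈ Q) (hu : u i ∈ Q) (h1 : v (i + 1) ∉ Q) (h3 : v (i + 3) ∉ Q) :
    G.cutSize (Q.erase (v i)) + 1 = G.cutSize Q := by
  have h := SimpleGraph.cutSize_erase hG hv
  rw [edgeCount_singleton_eq hG (hs.adj i) (hs.adj_prev i) (hs.adj_out i)
    (hs.v_inj.ne (by omega)) (hs.ne _ _) (hs.ne _ _), if_neg h1, if_neg h3, if_pos hu] at h
  omega

omit [Fintype V] [DecidableEq V] in
/-- Edge counts `e` between the four parts of two crossing 4-edge cuts, when each part loses one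
outgoing edge and keeps `r ≥ 3` of them on deletion of its vertex of the square. -/
lemma crossing_cuts_arith {e01 e02 e03 e12 e13 e23 r0 r1 r2 r3 : ℕ}
    (hX : e02 + e03 + (e12 + e13) = 4) (hY : e01 + e13 + (e02 + e23) = 4)
    (h0 : r0 + 1 = e01 + (e02 + e03)) (h1 : r1 + 1 = e01 + (e12 + e13))
    (h2 : r2 + 1 = e02 + (e12 + e23)) (h3 : r3 + 1 = e03 + (e13 + e23))
    (g0 : 3 ≤ r0) (g1 : 3 ≤ r1) (g2 : 3 ≤ r2) (g3 : 3 ≤ r3) :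
    e02 = 0 ∧ e13 = 0 ∧ r0 = 3 ∧ r1 = 3 ∧ r2 = 3 ∧ r3 = 3 := by
  omega

/-- Obstructions to both reductions at a square cross, and each of the four parts into which they
divide the graph has the least possible number of outgoing edges. -/
theorem exists_isCubeLike (hG : IsCubic G) (h3 : G.IsThreeEdgeConnected) {v u : Fin 4 → V}
    (hs : IsSquare G v u) {X Y : Finset V} (hX : IsObstruction G v u X)
    (hY : IsObstruction G (fun i => v (i + 1)) (fun i => u (i + 1)) Y) :
    ∃ R, IsCubeLike G v u R := by
  obtain ⟨y4, yv1, yv2, yu1, yu2, yv3, yv0, yu3, yu0⟩ := hY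
  obtain ⟨x4, xv0, xv1, xu0, xu1, xv2, xv3, xu2, xu3⟩ := hX
  simp only [Fin.isValue, zero_add, show (1 : Fin 4) + 1 = 2 from rfl,
    show (2 : Fin 4) + 1 = 3 from rfl, show (3 : Fin 4) + 1 = 0 from rfl] at *
  set Q0 := X \ Y with hQ0
  set Q1 := X ∩ Y with hQ1
  set Q2 := Y \ X with hQ2
  set Q3 := (X ∪ Y)ᶜ with hQ3
  have d01 : Disjoint Q0 Q1 := by rw [Finset.disjoint_left]; simp [hQ0, hQ1]; tauto
  have d02 : Disjoint Q0 Q2 := by rw [Finset.disjoint_left]; simp [hQ0, hQ2]; tauto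
  have d03 : Disjoint Q0 Q3 := by rw [Finset.disjoint_left]; simp [hQ0, hQ3]; tauto
  have d12 : Disjoint Q1 Q2 := by rw [Finset.disjoint_left]; simp [hQ1, hQ2]; tauto
  have d13 : Disjoint Q1 Q3 := by rw [Finset.disjoint_left]; simp [hQ1, hQ3]; tauto
  have d23 : Disjoint Q2 Q3 := by rw [Finset.disjoint_left]; simp [hQ2, hQ3]; tauto
  have c0 : Q0ᶜ = Q1 ∪ (Q2 ∪ Q3) := by ext; simp [hQ0, hQ1, hQ2, hQ3]; tauto
  have c1 : Q1ᶜ = Q0 ∪ (Q2 ∪ Q3) := by ext; simp [hQ0, hQ1, hQ2, hQ3]; tauto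
  have c2 : Q2ᶜ = Q0 ∪ (Q1 ∪ Q3) := by ext; simp [hQ0, hQ1, hQ2, hQ3]; tauto
  have c3 : Q3ᶜ = Q0 ∪ (Q1 ∪ Q2) := by ext; simp [hQ0, hQ1, hQ2, hQ3]; tauto
  have eX : X = Q0 ∪ Q1 := by ext; simp [hQ0, hQ1]; tauto
  have eY : Y = Q1 ∪ Q2 := by ext; simp [hQ1, hQ2]; tauto
  have eXc : Xᶜ = Q2 ∪ Q3 := by ext; simp [hQ2, hQ3]; tauto
  have eYc : Yᶜ = Q0 ∪ Q3 := by ext; simp [hQ0, hQ3]; tauto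
  have v0 : v 0 ∈ Q0 := Finset.mem_sdiff.2 ⟨xv0, yv0⟩
  have u0 : u 0 ∈ Q0 := Finset.mem_sdiff.2 ⟨xu0, yu0⟩
  have v1 : v 1 ∈ Q1 := Finset.mem_inter.2 ⟨xv1, yv1⟩
  have u1 : u 1 ∈ Q1 := Finset.mem_inter.2 ⟨xu1, yu1⟩
  have v2 : v 2 ∈ Q2 := Finset.mem_sdiff.2 ⟨yv2, xv2⟩
  have u2 : u 2 ∈ Q2 := Finset.mem_sdiff.2 ⟨yu2, xu2⟩
  have v3 : v 3 ∈ Q3 := by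
    rw [hQ3, Finset.mem_compl, Finset.mem_union, not_or]
    exact ⟨xv3, yv3⟩
  have u3 : u 3 ∈ Q3 := by
    rw [hQ3, Finset.mem_compl, Finset.mem_union, not_or]
    exact ⟨xu3, yu3⟩
  have sX : G.edgeCount Q0 Q2 + G.edgeCount Q0 Q3 + (G.edgeCount Q1 Q2 + G.edgeCount Q1 Q3) = 4 := by
    rw [← x4, cutSize, eXc, eX, edgeCount_union_left d01, edgeCount_union_right d23,
      edgeCount_union_right d23]
  have sY : G.edgeCount Q0 Q1 + G.edgeCount Q1 Q3 + (G.edgeCount Q0 Q2 + G.edgeCount Q2 Q3) = 4 := by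
    rw [← y4, cutSize, eYc, eY, edgeCount_union_left d12, edgeCount_union_right d03,
      edgeCount_union_right d03, edgeCount_comm Q1 Q0, edgeCount_comm Q2 Q0]
  have s0 : G.cutSize Q0 = G.edgeCount Q0 Q1 + (G.edgeCount Q0 Q2 + G.edgeCount Q0 Q3) := by
    rw [cutSize, c0, edgeCount_union_right (Finset.disjoint_union_right.2 ⟨d12, d13⟩),
      edgeCount_union_right d23]
  have s1 : G.cutSize Q1 = G.edgeCount Q0 Q1 + (G.edgeCount Q1 Q2 + G.edgeCount Q1 Q3) := by
    rw [cutSize, c1, edgeCount_union_right (Finset.disjoint_union_right.2 ⟨d02, d03⟩),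
      edgeCount_union_right d23, edgeCount_comm Q1 Q0]
  have s2 : G.cutSize Q2 = G.edgeCount Q0 Q2 + (G.edgeCount Q1 Q2 + G.edgeCount Q2 Q3) := by
    rw [cutSize, c2, edgeCount_union_right (Finset.disjoint_union_right.2 ⟨d01, d03⟩),
      edgeCount_union_right d13, edgeCount_comm Q2 Q0, edgeCount_comm Q2 Q1]
  have s3 : G.cutSize Q3 = G.edgeCount Q0 Q3 + (G.edgeCount Q1 Q3 + G.edgeCount Q2 Q3) := by
    rw [cutSize, c3, edgeCount_union_right (Finset.disjoint_union_right.2 ⟨d01, d02⟩),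
      edgeCount_union_right d12, edgeCount_comm Q3 Q0, edgeCount_comm Q3 Q1, edgeCount_comm Q3 Q2]
  have n {A B : Finset V} (h : Disjoint A B) {x : V} (hx : x ∈ A) : x ∉ B :=
    Finset.disjoint_left.1 h hx
  have ge : ∀ {Q : Finset V} {x y z : V}, y ∈ Q → y ≠ x → z ∉ Q → 3 ≤ G.cutSize (Q.erase x) := by
    intro Q x y z hy hyx hz
    exact h3 _ ⟨y, Finset.mem_erase.2 ⟨hyx, hy⟩⟩ fun h =>
      hz (Finset.mem_of_mem_erase (h ▸ Finset.mem_univ z))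
  have r0 := hs.cutSize_erase hG (i := 0) v0 u0 (n d01.symm v1) (n d03.symm v3)
  have r1 := hs.cutSize_erase hG (i := 1) v1 u1 (n d12.symm v2) (n d01 v0)
  have r2 := hs.cutSize_erase hG (i := 2) v2 u2 (n d23.symm v3) (n d12 v1)
  have r3 := hs.cutSize_erase hG (i := 3) v3 u3 (n d03 v0) (n d23 v2)
  have g0 := ge u0 (hs.ne 0 0).symm (n d01.symm v1)
  have g1 := ge u1 (hs.ne 1 1).symm (n d01 v0)
  have g2 := ge u2 (hs.ne 2 2).symm (n d02 v0)
  have g3 := ge u3 (hs.ne 3 3).symm (n d03 v0)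
  rw [s0] at r0
  rw [s1] at r1
  rw [s2] at r2
  rw [s3] at r3
  obtain ⟨z02, z13, t0, t1, t2, t3⟩ := crossing_cuts_arith sX sY r0 r1 r2 r3 g0 g1 g2 g3
  rw [edgeCount_eq_zero] at z02 z13
  have me {Q : Finset V} {x y : V} (h : x ∈ Q.erase y) : x ∈ Q := Finset.mem_of_mem_erase h
  have ds {A B : Finset V} {x y : V} (h : Disjoint A B) : Disjoint (A.erase x) (B.erase y) :=
    Finset.disjoint_of_subset_left (Finset.erase_subset _ _)
      (Finset.disjoint_of_subset_right (Finset.erase_subset _ _) h)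
  refine ⟨![Q0.erase (v 0), Q1.erase (v 1), Q2.erase (v 2), Q3.erase (v 3)], ?_, ?_, ?_, ?_, ?_, ?_⟩
  · intro i
    fin_cases i
    · exact t0
    · exact t1
    · exact t2
    · exact t3
  · intro i
    fin_cases i
    · exact Finset.mem_erase.2 ⟨(hs.ne 0 0).symm, u0⟩
    · exact Finset.mem_erase.2 ⟨(hs.ne 1 1).symm, u1⟩
    · exact Finset.mem_erase.2 ⟨(hs.ne 2 2).symm, u2⟩
    · exact Finset.mem_erase.2 ⟨(hs.ne 3 3).symm, u3⟩
  · intro i j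
    fin_cases i <;> fin_cases j
    · exact Finset.notMem_erase _ _
    · exact fun h => n d01.symm v1 (me h)
    · exact fun h => n d02.symm v2 (me h)
    · exact fun h => n d03.symm v3 (me h)
    · exact fun h => n d01 v0 (me h)
    · exact Finset.notMem_erase _ _
    · exact fun h => n d12.symm v2 (me h)
    · exact fun h => n d13.symm v3 (me h)
    · exact fun h => n d02 v0 (me h)
    · exact fun h => n d12 v1 (me h)
    · exact Finset.notMem_erase _ _
    · exact fun h => n d23.symm v3 (me h)
    · exact fun h => n d03 v0 (me h)
    · exact fun h => n d13 v1 (me h)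
    · exact fun h => n d23 v2 (me h)
    · exact Finset.notMem_erase _ _
  · intro x
    by_cases hx : ∃ i, x = v i
    · exact Or.inl hx
    · push Not at hx
      right
      by_cases h1 : x ∈ X <;> by_cases h2 : x ∈ Y
      · exact ⟨1, Finset.mem_erase.2 ⟨hx 1, Finset.mem_inter.2 ⟨h1, h2⟩⟩⟩
      · exact ⟨0, Finset.mem_erase.2 ⟨hx 0, Finset.mem_sdiff.2 ⟨h1, h2⟩⟩⟩
      · exact ⟨2, Finset.mem_erase.2 ⟨hx 2, Finset.mem_sdiff.2 ⟨h2, h1⟩⟩⟩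
      · exact ⟨3, Finset.mem_erase.2 ⟨hx 3, by rw [hQ3]; simp [h1, h2]⟩⟩
  · intro i j hij
    fin_cases i <;> fin_cases j <;> first | exact absurd rfl hij | skip
    · exact ds d01
    · exact ds d02
    · exact ds d03
    · exact ds d01.symm
    · exact ds d12
    · exact ds d13
    · exact ds d02.symm
    · exact ds d12.symm
    · exact ds d23
    · exact ds d03.symm
    · exact ds d13.symm
    · exact ds d23.symm
  · intro i x hx y hy hxy
    fin_cases i
    · exact z02 x (me hx) y (me hy) hxy
    · exact z13 x (me hx) y (me hy) hxy
    · exact z02 y (me hy) x (me hx) hxy.symm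
    · exact z13 y (me hy) x (me hx) hxy.symm

end

/-! ### Minimal 3-edge cuts -/

/-- Seven vertices that carry the cube with one vertex removed. The vertex removed from the cube
would be joined to `a`, `b` and `c`. -/
structure IsCubeMinusVertex (G : SimpleGraph V) (j g h i a b c : V) : Prop where
  nodup : [j, g, h, i, a, b, c].Nodup
  jg : G.Adj j g
  jh : G.Adj j h
  ji : G.Adj j i
  ah : G.Adj a h
  ai : G.Adj a i
  bg : G.Adj b g
  bh : G.Adj b h
  cg : G.Adj c g
  ci : G.Adj c i

section

variable [Fintype V] [DecidableEq V]

lemma IsCubeLike.adj_v {v u : Fin 4 → V} {R : Fin 4 → Finset V} (h : IsCubeLike G v u R)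
    (hs : IsSquare G v u) (hG : IsCubic G) {i j : Fin 4} {x : V} (hx : x ∈ R i)
    (hxv : G.Adj x (v j)) : j = i ∧ x = u i := by
  rcases hs.eq_of_adj hG hxv.symm with rfl | rfl | rfl
  · exact absurd hx (h.notMem _ _)
  · exact absurd hx (h.notMem _ _)
  · by_cases hij : j = i
    · exact ⟨hij, by rw [hij]⟩
    · exact absurd hx (Finset.disjoint_left.1 (h.disj j i hij) (h.mem j))

omit [Fintype V] in
lemma adj_of_two_le_edgeCount {x a b : V} {X : Finset V} (h2 : 2 ≤ G.edgeCount {x} X)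
    (h : ∀ y ∈ X, G.Adj x y → y = a ∨ y = b) : G.Adj x a ∧ G.Adj x b ∧ a ≠ b := by
  have h1 : G.edgeCount {x} X ≤ G.edgeCount {x} {a, b} :=
    edgeCount_singleton_le x fun y hy hxy => by simpa using h y hy hxy
  by_cases hab : a = b
  · subst hab
    have := edgeCount_le_one (G := G) x a
    simp only [Finset.mem_singleton, Finset.insert_eq_of_mem] at h1
    omega
  rw [edgeCount_insert_right (by simpa using hab), edgeCount_singleton, edgeCount_singleton] at h1
  refine ⟨?_, ?_, hab⟩
  · by_contra hn
    rw [if_neg hn] at h1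
    split_ifs at h1 <;> omega
  · by_contra hn
    rw [if_neg hn] at h1
    split_ifs at h1 <;> omega

/-- A 3-edge cut around a square that meets three of the four parts in one vertex each cuts out
the cube with one vertex removed. -/
lemma IsCubeLike.isCubeMinusVertex (hG : IsCubic G) (h3 : G.IsThreeEdgeConnected)
    {v u : Fin 4 → V} {R : Fin 4 → Finset V} (hR : IsCubeLike G v u R) (hs : IsSquare G v u)
    {X : Finset V} (hX : G.cutSize X = 3) (hv : ∀ i, v i ∈ X) {w0 w1 w2 : V}
    (h0 : R 0 ∩ X = {w0}) (h1 : R 1 ∩ X = {w1}) (h2 : R 2 ∩ X = {w2}) (h3' : R 3 ∩ X = ∅) :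
    IsCubeMinusVertex G (v 1) (v 0) (v 2) w1 w2 (v 3) w0 := by
  have hX1 : 1 < X.card :=
    Finset.one_lt_card.2 ⟨v 0, hv 0, v 1, hv 1, hs.v_inj.ne (by decide)⟩
  have two := fun {a : V} (ha : a ∈ X) => two_le_edgeCount_of_cutSize_eq_three hG h3 hX hX1 ha
  have m0 : w0 ∈ R 0 ∩ X := by simp [h0]
  have m1 : w1 ∈ R 1 ∩ X := by simp [h1]
  have m2 : w2 ∈ R 2 ∩ X := by simp [h2]
  rw [Finset.mem_inter] at m0 m1 m2
  have e0 : ∀ x ∈ R 0, x ∈ X → x = w0 := fun x hx hx' => by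
    simpa [h0] using Finset.mem_inter.2 ⟨hx, hx'⟩
  have e1 : ∀ x ∈ R 1, x ∈ X → x = w1 := fun x hx hx' => by
    simpa [h1] using Finset.mem_inter.2 ⟨hx, hx'⟩
  have e2 : ∀ x ∈ R 2, x ∈ X → x = w2 := fun x hx hx' => by
    simpa [h2] using Finset.mem_inter.2 ⟨hx, hx'⟩
  have e3 : ∀ x ∈ R 3, x ∉ X := fun x hx hx' => by
    simpa [h3'] using Finset.mem_inter.2 ⟨hx, hx'⟩
  have n0 : ∀ y ∈ X, G.Adj w0 y → y = v 0 ∨ y = w1 := by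
    intro y hy hwy
    rcases hR.cover y with ⟨i, rfl⟩ | ⟨i, hi⟩
    · rw [(hR.adj_v hs hG m0.1 hwy).1]; exact Or.inl rfl
    · fin_cases i
      · exact absurd hwy (by rw [e0 y hi hy]; exact G.loopless.irrefl _)
      · exact Or.inr (e1 y hi hy)
      · exact absurd hwy (hR.opp 0 w0 m0.1 y hi)
      · exact absurd hy (e3 y hi)
  have n2 : ∀ y ∈ X, G.Adj w2 y → y = v 2 ∨ y = w1 := by
    intro y hy hwy
    rcases hR.cover y with ⟨i, rfl⟩ | ⟨i, hi⟩
    · rw [(hR.adj_v hs hG m2.1 hwy).1]; exact Or.inl rfl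
    · fin_cases i
      · exact absurd hwy (hR.opp 2 w2 m2.1 y hi)
      · exact Or.inr (e1 y hi hy)
      · exact absurd hwy (by rw [e2 y hi hy]; exact G.loopless.irrefl _)
      · exact absurd hy (e3 y hi)
  obtain ⟨a1, a2, -⟩ := adj_of_two_le_edgeCount (two m0.2) n0
  obtain ⟨b1, b2, -⟩ := adj_of_two_le_edgeCount (two m2.2) n2
  have hw : ∀ {i x} (_ : x ∈ R i) (j), x ≠ v j := fun hx j h => hR.notMem _ j (h ▸ hx)
  have hd : ∀ {i j x y} (_ : i ≠ j) (_ : x ∈ R i) (_ : y ∈ R j), x ≠ y := fun hij hx hy h =>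
    Finset.disjoint_left.1 (hR.disj _ _ hij) hx (h ▸ hy)
  have hu3 : u 3 ∉ X := e3 _ (hR.mem 3)
  have c : G.Adj (v 1) w1 := by
    by_cases hu1 : u 1 ∈ X
    · rw [← e1 _ (hR.mem 1) hu1]; exact hs.adj_out 1
    exfalso
    -- otherwise four vertices of `X` have a neighbour outside
    have hout : ∀ x ∈ ({v 1, v 3, w0, w2} : Finset V), 1 ≤ G.edgeCount {x} Xᶜ := by
      intro x hx
      have ht : G.edgeCount {x} X + G.edgeCount {x} Xᶜ = 3 := by
        rw [← edgeCount_singleton_univ hG x, ← edgeCount_union_right disjoint_compl_right,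
          Finset.union_compl]
      simp only [Finset.mem_insert, Finset.mem_singleton] at hx
      rcases hx with rfl | rfl | rfl | rfl
      · exact edgeCount_pos (Finset.mem_singleton_self _) (by simpa using hu1) (hs.adj_out 1)
      · exact edgeCount_pos (Finset.mem_singleton_self _) (by simpa using hu3) (hs.adj_out 3)
      · have := edgeCount_singleton_le (G := G) x (A := X) (B := {v 0, w1})
          (by simpa using n0)
        rw [edgeCount_insert_right (by simpa using (hw m1.1 0).symm)] at this
        have i1 := edgeCount_le_one (G := G) x (v 0)
        have i2 := edgeCount_le_one (G := G) x w1
        omega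
      · have := edgeCount_singleton_le (G := G) x (A := X) (B := {v 2, w1})
          (by simpa using n2)
        rw [edgeCount_insert_right (by simpa using (hw m1.1 2).symm)] at this
        have i1 := edgeCount_le_one (G := G) x (v 2)
        have i2 := edgeCount_le_one (G := G) x w1
        omega
    have hc4 : ({v 1, v 3, w0, w2} : Finset V).card = 4 := by
      have q1 : v 1 ≠ v 3 := hs.v_inj.ne (by decide)
      have q2 := fun j => (hw m0.1 j).symm
      have q3 := fun j => (hw m2.1 j).symm
      have q4 : w0 ≠ w2 := hd (by decide) m0.1 m2.1
      rw [Finset.card_insert_of_notMem, Finset.card_insert_of_notMem, Finset.card_pair q4] <;>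
        simp [*]
    have hsum : ∑ x ∈ ({v 1, v 3, w0, w2} : Finset V), G.edgeCount {x} Xᶜ ≤ G.cutSize X := by
      rw [SimpleGraph.cutSize, edgeCount_eq_sum X]
      refine Finset.sum_le_sum_of_subset fun x hx => ?_
      simp only [Finset.mem_insert, Finset.mem_singleton] at hx
      rcases hx with rfl | rfl | rfl | rfl
      · exact hv 1
      · exact hv 3
      · exact m0.2
      · exact m2.2
    have := Finset.card_nsmul_le_sum _ _ 1 hout
    rw [hc4] at this
    simp only [smul_eq_mul] at this
    omega
  refine ⟨?_, (hs.adj 0).symm, hs.adj 1, c, b1, b2, hs.adj 3, (hs.adj 2).symm, a1, a2⟩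
  have q : ∀ {i j}, i ≠ j → v i ≠ v j := fun h => hs.v_inj.ne h
  have p0 := fun j => (hw m0.1 j)
  have p1 := fun j => (hw m1.1 j)
  have p2 := fun j => (hw m2.1 j)
  have p02 : w0 ≠ w2 := hd (by decide) m0.1 m2.1
  have p01 : w0 ≠ w1 := hd (by decide) m0.1 m1.1
  have p12 : w1 ≠ w2 := hd (by decide) m1.1 m2.1
  have q1 : v 1 ≠ v 0 := q (by decide)
  have q2 : v 1 ≠ v 2 := q (by decide)
  have q3 : v 1 ≠ v 3 := q (by decide)
  have q4 : v 0 ≠ v 2 := q (by decide)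
  have q5 : v 0 ≠ v 3 := q (by decide)
  have q6 : v 2 ≠ v 3 := q (by decide)
  simp [p1, p2, p02.symm, p01.symm, p12, q1, q2, q3, q4, q5, q6, fun j => (p0 j).symm,
    fun j => (p1 j).symm, fun j => (p2 j).symm]

/-- If the square lies in a smallest nontrivial side `X` of a 3-edge cut and contracts to a 4-face
of the cube, then `X` is the cube with one vertex removed: by submodularity, `X` has at most one
vertex in each of the parts `R i`. -/
theorem IsCubeLike.exists_isCubeMinusVertex (hG : IsCubic G) (h3 : G.IsThreeEdgeConnected)
    {v u : Fin 4 → V} {R : Fin 4 → Finset V} (hR : IsCubeLike G v u R) (hs : IsSquare G v u)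
    {X : Finset V} (hX : G.cutSize X = 3) (hv : ∀ i, v i ∈ X)
    (hmin : ∀ Y, G.cutSize Y = 3 → 1 < Y.card → X.card ≤ Y.card) :
    ∃ j g h i a b c, IsCubeMinusVertex G j g h i a b c := by
  have hX1 : 1 < X.card :=
    Finset.one_lt_card.2 ⟨v 0, hv 0, v 1, hv 1, hs.v_inj.ne (by decide)⟩
  have two := fun {a : V} (ha : a ∈ X) => two_le_edgeCount_of_cutSize_eq_three hG h3 hX hX1 ha
  -- If `R i` and `X` cover all vertices, then `X` is the complement of `R i` by minimality.
  -- Otherwise `R i ∩ X` has three outgoing edges and is smaller than `X`.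
  have hle : ∀ i, (R i ∩ X).card ≤ 1 := by
    intro i
    by_cases hU : R i ∪ X = Finset.univ
    · have hsub : (R i)ᶜ ⊆ X := by
        intro x hx
        have : x ∈ R i ∪ X := hU ▸ Finset.mem_univ x
        rcases Finset.mem_union.1 this with h | h
        · exact absurd h (by simpa using hx)
        · exact h
      have heq : (R i)ᶜ = X := Finset.eq_of_subset_of_card_le hsub
        (hmin _ (by rw [cutSize_compl, hR.cutSize]) (Finset.one_lt_card.2
          ⟨v 0, by simpa using hR.notMem i 0, v 1, by simpa using hR.notMem i 1,
            hs.v_inj.ne (by decide)⟩))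
      rw [← heq]
      simp
    · by_contra hc
      have hsm := G.cutSize_inter_add_union_le (R i) X
      have a1 := h3 (R i ∪ X) ⟨v 0, Finset.mem_union_right _ (hv 0)⟩ hU
      have a2 := h3 (R i ∩ X) (Finset.card_pos.1 (by omega)) (fun h => hR.notMem i 0
        (Finset.mem_of_mem_inter_left (h ▸ Finset.mem_univ (v 0))))
      have a3 := hmin (R i ∩ X) (by rw [hR.cutSize, hX] at hsm; omega) (by omega)
      have a4 : (R i ∩ X).card < X.card := Finset.card_lt_card
        ⟨Finset.inter_subset_right, fun h =>
          hR.notMem i 0 (Finset.mem_of_mem_inter_left (h (hv 0)))⟩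
      omega
  -- a vertex of `X` outside the square has a neighbour in `X` in a neighbouring part
  have hnb : ∀ i, (R i ∩ X).card = 1 →
      (R (i + 1) ∩ X).card = 1 ∨ (R (i + 3) ∩ X).card = 1 := by
    intro i hi
    by_contra! hn
    have z1 : R (i + 1) ∩ X = ∅ := by
      have := hle (i + 1)
      rw [← Finset.card_eq_zero]; omega
    have z3 : R (i + 3) ∩ X = ∅ := by
      have := hle (i + 3)
      rw [← Finset.card_eq_zero]; omega
    obtain ⟨w, hw⟩ := Finset.card_eq_one.1 hi
    have hwm : w ∈ R i ∩ X := by simp [hw]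
    rw [Finset.mem_inter] at hwm
    refine (adj_of_two_le_edgeCount (two hwm.2) (a := v i) (b := v i) ?_).2.2 rfl
    intro y hy hwy
    rw [or_self]
    rcases hR.cover y with ⟨j, rfl⟩ | ⟨j, hj⟩
    · rw [(hR.adj_v hs hG hwm.1 hwy).1]
    · exfalso
      have hyj : y ∈ R j ∩ X := Finset.mem_inter.2 ⟨hj, hy⟩
      obtain h | h | h | h : j = i ∨ j = i + 1 ∨ j = i + 2 ∨ j = i + 3 := by omega
      · rw [h, hw, Finset.mem_singleton] at hyj
        exact hwy.ne hyj.symm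
      · rw [h, z1] at hyj; simp at hyj
      · exact hR.opp i w hwm.1 y (h ▸ hj) hwy
      · rw [h, z3] at hyj; simp at hyj
  have hcard : X.card = 4 + ((R 0 ∩ X).card + (R 1 ∩ X).card + (R 2 ∩ X).card
      + (R 3 ∩ X).card) := by
    have hXu : X = Finset.univ.image v ∪ (Finset.univ.biUnion fun i => R i ∩ X) := by
      ext x
      simp only [Finset.mem_union, Finset.mem_image, Finset.mem_univ, true_and, Finset.mem_biUnion,
        Finset.mem_inter]
      constructor
      · intro hx
        rcases hR.cover x with ⟨i, hi⟩ | ⟨i, hi⟩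
        · exact Or.inl ⟨i, hi.symm⟩
        · exact Or.inr ⟨i, hi, hx⟩
      · rintro (⟨i, rfl⟩ | ⟨i, -, hx⟩)
        · exact hv i
        · exact hx
    have hdisj : Disjoint (Finset.univ.image v) (Finset.univ.biUnion fun i => R i ∩ X) := by
      rw [Finset.disjoint_left]
      intro x hx hx'
      obtain ⟨j, -, rfl⟩ := Finset.mem_image.1 hx
      obtain ⟨i, -, hi⟩ := Finset.mem_biUnion.1 hx'
      exact hR.notMem i j (Finset.mem_of_mem_inter_left hi)
    conv_lhs => rw [hXu]
    rw [Finset.card_union_of_disjoint hdisj, Finset.card_image_of_injective _ hs.v_inj,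
      Finset.card_biUnion, Fin.sum_univ_four]
    · simp
    · intro i _ j _ hij
      exact Finset.disjoint_of_subset_left Finset.inter_subset_left
        (Finset.disjoint_of_subset_right Finset.inter_subset_left (hR.disj i j hij))
  -- `X` has an odd number of vertices, so it meets one or three of the parts, and not just one
  have hpar := cutSize_mod_two hG X
  obtain ⟨k, k0, k1, k2, k3⟩ : ∃ k : Fin 4, (R (0 + k) ∩ X).card = 1 ∧ (R (1 + k) ∩ X).card = 1 ∧
      (R (2 + k) ∩ X).card = 1 ∧ (R (3 + k) ∩ X).card = 0 := by
    have l0 := hle 0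
    have l1 := hle 1
    have l2 := hle 2
    have l3 := hle 3
    have b0 := hnb 0
    have b1 := hnb 1
    have b2 := hnb 2
    have b3 := hnb 3
    simp only [Fin.isValue, zero_add, show (1 : Fin 4) + 1 = 2 from rfl,
      show (2 : Fin 4) + 1 = 3 from rfl, show (3 : Fin 4) + 1 = 0 from rfl,
      show (1 : Fin 4) + 3 = 0 from rfl, show (2 : Fin 4) + 3 = 1 from rfl,
      show (3 : Fin 4) + 3 = 2 from rfl] at b0 b1 b2 b3
    obtain h | h | h | h : (R 3 ∩ X).card = 0 ∨ (R 0 ∩ X).card = 0 ∨ (R 1 ∩ X).card = 0 ∨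
        (R 2 ∩ X).card = 0 := by omega
    · refine ⟨0, ?_, ?_, ?_, ?_⟩ <;> simp only [add_zero] <;> omega
    · refine ⟨1, ?_, ?_, ?_, ?_⟩ <;> simp only [Fin.isValue, zero_add,
        show (1 : Fin 4) + 1 = 2 from rfl, show (2 : Fin 4) + 1 = 3 from rfl,
        show (3 : Fin 4) + 1 = 0 from rfl] <;> omega
    · refine ⟨2, ?_, ?_, ?_, ?_⟩ <;> simp only [Fin.isValue, zero_add,
        show (1 : Fin 4) + 2 = 3 from rfl, show (2 : Fin 4) + 2 = 0 from rfl,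
        show (3 : Fin 4) + 2 = 1 from rfl] <;> omega
    · refine ⟨3, ?_, ?_, ?_, ?_⟩ <;> simp only [Fin.isValue, zero_add,
        show (1 : Fin 4) + 3 = 0 from rfl, show (2 : Fin 4) + 3 = 1 from rfl,
        show (3 : Fin 4) + 3 = 2 from rfl] <;> omega
  obtain ⟨w0, h0⟩ := Finset.card_eq_one.1 k0
  obtain ⟨w1, h1⟩ := Finset.card_eq_one.1 k1
  obtain ⟨w2, h2⟩ := Finset.card_eq_one.1 k2
  exact ⟨_, _, _, _, _, _, _, (hR.rotate k).isCubeMinusVertex hG h3 (hs.rotate k) hX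
    (fun i => hv _) h0 h1 h2 (Finset.card_eq_zero.1 k3)⟩

end

end SimpleGraph

/-! ### Replacing paths by edges in plane cubic graphs -/

namespace SimpleGraph

/-- Planarity passes to topological minors: `G'` is obtained from the connected spanning subgraph
with edge set `S` by suppressing vertices of degree two; the dart `Ψ d` is the first dart of the
path in `G` that becomes the edge of `d`. Degrees are counted by `hcard`: three at the vertices
kept and two at the others. The condition `hface` says that a face of the subgraph runs along this
path and continues behind it as in `G`, and `hcov` that every face of the subgraph has such a
path. -/
theorem isPlanar_of_topologicalMinor {V V' : Type*} [Finite V] [Finite V'] {G : SimpleGraph V}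
    {G' : SimpleGraph V'} (M : PlaneEmbedding G) (hG : IsCubic G) (hG' : IsCubic G')
    (hcon : G'.Connected) {S : Set (Sym2 V)} (hS : S ⊆ G.edgeSet)
    (hcard : Nat.card V' + 2 * Nat.card V ≤ 2 * S.ncard)
    (hScon : (fromEdgeSet S).Preconnected) (ι : V' → V) (hι : Function.Injective ι)
    (Ψ : G'.Dart → G.Dart) (hfst : ∀ d, (Ψ d).fst = ι d.fst)
    (hsurj : ∀ e : G.Dart, ∀ x, e.fst = ι x → ∃ d, Ψ d = e)
    (hface : ∀ d, (facePermIn M.rot S).SameCycle (Ψ d) (M.rot (Ψ d.symm)))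
    (hcov : ∀ e, ∃ d, (facePermIn M.rot S).SameCycle (Ψ d) e) : IsPlanar G' := by
  classical
  have := Fintype.ofFinite V
  have := Fintype.ofFinite V'
  have hne : Nonempty V := hcon.nonempty.map ι
  -- `Ψ` is a bijection onto the darts at the vertices kept
  let E0 : G'.Dart → {e : G.Dart // e.fst ∈ Set.range ι} := fun d => ⟨Ψ d, d.fst, (hfst d).symm⟩
  have hE0s : Function.Surjective E0 := by
    rintro ⟨e, x, hx⟩
    obtain ⟨d, rfl⟩ := hsurj e x hx.symm
    exact ⟨d, rfl⟩
  have hcd : Fintype.card G'.Dart = Fintype.card {e : G.Dart // e.fst ∈ Set.range ι} := by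
    have a1 := card_filter_dart (G := G') Finset.univ Finset.univ
    have a2 := card_filter_dart (G := G) (Finset.univ.image ι) Finset.univ
    rw [edgeCount_univ hG', Finset.card_univ] at a1
    rw [edgeCount_univ hG, Finset.card_image_of_injective _ hι, Finset.card_univ] at a2
    simp only [Finset.mem_univ, and_true, Finset.filter_true, Finset.card_univ] at a1
    rw [a1, Fintype.card_subtype, ← a2]
    congr 1
    ext e
    simp
  have hE0 : Function.Bijective E0 := by
    rw [Fintype.bijective_iff_surjective_and_card]
    exact ⟨hE0s, hcd⟩
  let E : G'.Dart ≃ {e : G.Dart // e.fst ∈ Set.range ι} := Equiv.ofBijective E0 hE0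
  let σ : Equiv.Perm {e : G.Dart // e.fst ∈ Set.range ι} :=
    M.rot.subtypePerm fun e => by rw [M.rot_fst]
  let rot' : Equiv.Perm G'.Dart := (E.trans σ).trans E.symm
  have hE : ∀ d, (E d : G.Dart) = Ψ d := fun d => rfl
  have hΨ : Function.Injective Ψ := fun d e h => hE0.1 (Subtype.ext h)
  have hrot : ∀ d, Ψ (rot' d) = M.rot (Ψ d) := by
    intro d
    rw [← hE]
    simp only [rot', Equiv.trans_apply, Equiv.apply_symm_apply]
    rfl
  have hpow : ∀ (n : ℕ) d, Ψ ((rot' ^ n) d) = (M.rot ^ n) (Ψ d) := by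
    intro n d
    induction n with
    | zero => rfl
    | succ n ih => rw [pow_succ', pow_succ', Equiv.Perm.mul_apply, Equiv.Perm.mul_apply, hrot, ih]
  have hr1 : ∀ d, (rot' d).fst = d.fst := by
    intro d
    apply hι
    rw [← hfst, ← hfst, hrot, M.rot_fst]
  have hr2 : ∀ d e : G'.Dart, d.fst = e.fst → rot'.SameCycle d e := by
    intro d e hde
    obtain ⟨n, hn⟩ := (M.rot_cyclic (Ψ d) (Ψ e) (by rw [hfst, hfst, hde])).exists_nat_pow_eq
    refine ⟨n, hΨ ?_⟩
    rw [zpow_natCast, hpow, hn]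
  -- `Ψ` maps each face of `G'` into a face of the subgraph, and onto all of them
  have hc : numCycles (facePermIn M.rot S) ≤ numCycles (facePerm rot') := by
    refine le_numCycles_of_surjective (facePerm rot')
      (fun d => (Quotient.mk (Equiv.Perm.SameCycle.setoid (facePermIn M.rot S)) (Ψ d))) ?_ ?_
    · intro d
      refine Quotient.sound ?_
      have : Ψ (facePerm rot' d) = M.rot (Ψ d.symm) := hrot d.symm
      rw [this]
      exact (hface d).symm
    · intro q
      induction q using Quotient.inductionOn with
      | h e =>
      obtain ⟨d, hd⟩ := hcov e
      exact ⟨d, Quotient.sound hd⟩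
  refine isPlanar_of_card_le rot' hr1 hr2 hG'.exists_adj ?_
  have e1 := numCycles_facePermIn M hG.exists_adj hS
  rw [numComp_of_preconnected hScon] at e1
  have e2 := two_mul_ncard_edgeSet_of_cubic hG'
  have e3 : Nat.card G'.ConnectedComponent = 1 := by
    have := hcon.nonempty
    have h := numComp_of_preconnected (S := G'.edgeSet) (by
      rw [fromEdgeSet_edgeSet]; exact hcon.preconnected)
    rwa [numComp, fromEdgeSet_edgeSet] at h
  rw [← Nat.card_eq_fintype_card] at e2
  omega

section Path

variable {V : Type*} {G : SimpleGraph V} [Finite V] (M : PlaneEmbedding G) (hG : IsCubic G)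
  {S : Set (Sym2 V)}

include hG in
/-- A face of the subgraph with edge set `S` passes straight through a vertex of degree two. -/
lemma sameCycle_pass {p q : G.Dart} (hp : p.edge ∈ S) (hpq : q ≠ p) (hfst : q.fst = p.fst)
    (hr : ∀ r : G.Dart, r.fst = p.fst → r ≠ p → r ≠ q → r.edge ∉ S) :
    (facePermIn M.rot S).SameCycle p.symm q := by
  have h1 : facePermIn M.rot S p.symm = M.rot p := by
    rw [facePermIn_of_mem _ (by simpa using hp), Dart.symm_symm]
  have h2 : (facePermIn M.rot S).SameCycle p.symm (M.rot p) := by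
    rw [← h1]
    exact (Equiv.Perm.SameCycle.refl _ _).apply_right
  rcases eq_rot_or hG M.rot_fst M.rot_cyclic p q hfst with h | h | h
  · exact absurd h hpq
  · rwa [h]
  · have h3 : (M.rot p).edge ∉ S := hr _ (M.rot_fst p) (rot_ne hG M.rot_cyclic p) (by
      rw [h]; exact (rot_ne hG M.rot_cyclic _).symm)
    rw [h, ← facePermIn_of_notMem M.rot h3]
    exact h2.apply_right

variable {x a b y : V} (hxa : G.Adj x a) (hab : G.Adj a b) (hby : G.Adj b y)
  (hSxa : s(x, a) ∈ S) (hSab : s(a, b) ∈ S) (hSby : s(b, y) ∈ S) (hxb : x ≠ b) (hay : a ≠ y)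
  (ha : ∀ z, G.Adj a z → z ≠ x → z ≠ b → s(a, z) ∉ S)
  (hb : ∀ z, G.Adj b z → z ≠ a → z ≠ y → s(b, z) ∉ S)

include hG hSxa hxb ha in
lemma sameCycle_path_start :
    (facePermIn M.rot S).SameCycle ⟨(x, a), hxa⟩ ⟨(a, b), hab⟩ := by
  have h := sameCycle_pass M hG (S := S) (p := ⟨(a, x), hxa.symm⟩) (q := ⟨(a, b), hab⟩)
    (by rw [Dart.edge_mk, Sym2.eq_swap]; exact hSxa)
    (fun h => hxb (congrArg (fun e : G.Dart => e.snd) h).symm) rfl ?_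
  · exact h
  · intro r hr hrp hrq
    have hr' : a = r.fst := hr.symm
    subst hr'
    refine ha r.snd r.adj ?_ ?_
    · rintro rfl; exact hrp rfl
    · rintro rfl; exact hrq rfl

include hG hab hSxa hSab hSby hxb hay ha hb in
lemma sameCycle_path_end :
    (facePermIn M.rot S).SameCycle ⟨(x, a), hxa⟩ (M.rot ⟨(y, b), hby.symm⟩) := by
  have h1 := sameCycle_path_start M hG hxa hab hSxa hxb ha
  have h2 := sameCycle_path_start M hG hab hby hSab hay fun z hz h1 h2 => hb z hz h1 h2
  have h3 := (h1.trans h2).apply_right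
  rwa [facePermIn_of_mem _ (by exact hSby)] at h3

include hG hab hSxa hSab hSby hxb hay ha hb in
lemma sameCycle_path_cover (e : G.Dart) (he : e.fst = a) :
    (facePermIn M.rot S).SameCycle ⟨(x, a), hxa⟩ e ∨
      (facePermIn M.rot S).SameCycle ⟨(y, b), hby.symm⟩ e := by
  have h1 := sameCycle_path_start M hG hxa hab hSxa hxb ha
  have h2 := sameCycle_path_start M hG hby.symm hab.symm (by rwa [Sym2.eq_swap]) hay.symm
    fun z hz h1 h2 => hb z hz h2 h1
  have h3 := sameCycle_path_start M hG hab.symm hxa.symm (by rwa [Sym2.eq_swap]) hxb.symm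
    fun z hz h1 h2 => ha z hz h2 h1
  have key : ∀ e' : G.Dart, e'.fst = a → (e'.snd = x ∨ e'.snd = b) →
      (facePermIn M.rot S).SameCycle ⟨(x, a), hxa⟩ e' ∨
      (facePermIn M.rot S).SameCycle ⟨(y, b), hby.symm⟩ e' := by
    rintro ⟨⟨p, q⟩, hpq⟩ h4 h5
    simp only at h4 h5
    subst h4
    rcases h5 with rfl | rfl
    · exact Or.inr (h2.trans h3)
    · exact Or.inl h1
  by_cases hex : e.snd = x ∨ e.snd = b
  · exact key e he hex
  push Not at hex
  have hadj : G.Adj a e.snd := by rw [← he]; exact e.adj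
  have heS : e.edge ∉ S := by
    have := ha e.snd hadj hex.1 hex.2
    rwa [← he] at this
  have hadj' : G.Adj a (M.rot e).snd := by rw [← he, ← M.rot_fst e]; exact (M.rot e).adj
  have h6 : (M.rot e).snd = x ∨ (M.rot e).snd = b := by
    rcases hG.eq_of_adj hxa.symm hab hadj hxb hex.1.symm hex.2.symm hadj' with h | h | h
    · exact Or.inl h
    · exact Or.inr h
    · exact absurd h (snd_rot_ne hG M.rot_fst M.rot_cyclic e)
  have h7 : facePermIn M.rot S e = M.rot e := facePermIn_of_notMem _ heS
  rcases key (M.rot e) ((M.rot_fst e).trans he) h6 with h | h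
  · left
    rw [← h7] at h
    exact Equiv.Perm.sameCycle_apply_right.1 h
  · right
    rw [← h7] at h
    exact Equiv.Perm.sameCycle_apply_right.1 h

end Path

/-- Paths `x i, a i, b i, y i` in `G` whose inner vertices are all distinct and have their third
neighbours among the inner vertices again. Both reductions delete the inner vertices of such paths
and join their ends by new edges. -/
structure IsLinkage {V ι : Type*} (G : SimpleGraph V) (x a b y : ι → V) : Prop where
  xa : ∀ i, G.Adj (x i) (a i)
  ab : ∀ i, G.Adj (a i) (b i)
  yb : ∀ i, G.Adj (y i) (b i)
  a_inj : Function.Injective a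
  b_inj : Function.Injective b
  a_ne_b : ∀ i j, a i ≠ b j
  x_ne_a : ∀ i j, x i ≠ a j
  x_ne_b : ∀ i j, x i ≠ b j
  y_ne_a : ∀ i j, y i ≠ a j
  y_ne_b : ∀ i j, y i ≠ b j
  x_ne_y : ∀ i, x i ≠ y i
  not_adj : ∀ i, ¬ G.Adj (x i) (y i)
  pair : ∀ i j, s(x i, y i) = s(x j, y j) → i = j
  third_a : ∀ i z, G.Adj (a i) z → z = x i ∨ ∃ j, z = a j ∨ z = b j
  third_b : ∀ i z, G.Adj (b i) z → z = y i ∨ ∃ j, z = a j ∨ z = b j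

section Linkage

variable {V ι : Type*} {G H : SimpleGraph V} {x a b y : ι → V} {K : Set V}

/-- The edge `pq` of the reduced graph stands for a path in `G` that starts with the edge `pw`. -/
def Represents (G : SimpleGraph V) (x a b y : ι → V) (p q w : V) : Prop :=
  (G.Adj p q ∧ w = q) ∨ ∃ i, (p = x i ∧ q = y i ∧ w = a i) ∨ (p = y i ∧ q = x i ∧ w = b i)

lemma IsLinkage.represents_unique (L : IsLinkage G x a b y) {p q w w' : V}
    (h : Represents G x a b y p q w) (h' : Represents G x a b y p q w') : w = w' := by
  rcases h with ⟨h1, rfl⟩ | ⟨i, ⟨rfl, rfl, rfl⟩ | ⟨rfl, rfl, rfl⟩⟩ <;>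
  rcases h' with ⟨h2, rfl⟩ | ⟨k, ⟨e1, e2, rfl⟩ | ⟨e1, e2, rfl⟩⟩
  · rfl
  · exact absurd (e1 ▸ e2 ▸ h1) (L.not_adj k)
  · exact absurd (e1 ▸ e2 ▸ h1).symm (L.not_adj k)
  · exact absurd h2 (L.not_adj i)
  · rw [L.pair i k (by rw [e1, e2])]
  · have := L.pair i k (by rw [e1, e2, Sym2.eq_swap])
    subst this
    exact absurd e1 (L.x_ne_y i)
  · exact absurd h2.symm (L.not_adj i)
  · have := L.pair i k (by rw [e1, e2, Sym2.eq_swap])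
    subst this
    exact absurd e2 (L.x_ne_y i)
  · rw [L.pair i k (by rw [e1, e2])]

variable (L : IsLinkage G x a b y) (hK : ∀ v, v ∈ K ↔ ∀ i, v ≠ a i ∧ v ≠ b i)
  (hH : ∀ p q, p ∈ K → q ∈ K → (H.Adj p q ↔ G.Adj p q ∨ ∃ i, s(p, q) = s(x i, y i)))

include L hK in
lemma IsLinkage.x_mem (i : ι) : x i ∈ K := (hK _).2 fun j => ⟨L.x_ne_a i j, L.x_ne_b i j⟩

include L hK in
lemma IsLinkage.y_mem (i : ι) : y i ∈ K := (hK _).2 fun j => ⟨L.y_ne_a i j, L.y_ne_b i j⟩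

include hK in
lemma mem_or_of_linkage (v : V) : v ∈ K ∨ ∃ i, v = a i ∨ v = b i := by
  by_cases h : v ∈ K
  · exact Or.inl h
  · right
    rw [hK] at h
    push Not at h
    obtain ⟨i, hi⟩ := h
    exact ⟨i, or_iff_not_imp_left.2 hi⟩

include L hH in
lemma IsLinkage.exists_represents {p q : V} (hp : p ∈ K) (hq : q ∈ K) (h : H.Adj p q) :
    ∃ w, G.Adj p w ∧ Represents G x a b y p q w := by
  rcases (hH p q hp hq).1 h with h | ⟨i, hi⟩
  · exact ⟨q, h, Or.inl ⟨h, rfl⟩⟩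
  · rcases Sym2.eq_iff.1 hi with ⟨rfl, rfl⟩ | ⟨rfl, rfl⟩
    · exact ⟨a i, L.xa i, Or.inr ⟨i, Or.inl ⟨rfl, rfl, rfl⟩⟩⟩
    · exact ⟨b i, L.yb i, Or.inr ⟨i, Or.inr ⟨rfl, rfl, rfl⟩⟩⟩

include L hK hH in
lemma IsLinkage.exists_adj_represents {p w : V} (hp : p ∈ K) (h : G.Adj p w) :
    ∃ q, q ∈ K ∧ H.Adj p q ∧ Represents G x a b y p q w := by
  have hpK := (hK p).1 hp
  have hno : ¬ ∃ j, p = a j ∨ p = b j := by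
    rintro ⟨j, hj | hj⟩
    · exact (hpK j).1 hj
    · exact (hpK j).2 hj
  rcases mem_or_of_linkage hK w with hw | ⟨i, rfl | rfl⟩
  · exact ⟨w, hw, (hH p w hp hw).2 (Or.inl h), Or.inl ⟨h, rfl⟩⟩
  · have hpx := (L.third_a i p h.symm).resolve_right hno
    refine ⟨y i, L.y_mem hK i, (hH _ _ hp (L.y_mem hK i)).2 (Or.inr ⟨i, by rw [hpx]⟩),
      Or.inr ⟨i, Or.inl ⟨hpx, rfl, rfl⟩⟩⟩
  · have hpy := (L.third_b i p h.symm).resolve_right hno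
    refine ⟨x i, L.x_mem hK i, (hH _ _ hp (L.x_mem hK i)).2 (Or.inr ⟨i, by
      rw [hpy, Sym2.eq_swap]⟩), Or.inr ⟨i, Or.inr ⟨hpy, rfl, rfl⟩⟩⟩

include L hK in
lemma IsLinkage.represents_inj {p q q' w : V} (hq : q ∈ K) (hq' : q' ∈ K)
    (h : Represents G x a b y p q w) (h' : Represents G x a b y p q' w) : q = q' := by
  rcases h with ⟨h1, rfl⟩ | ⟨i, ⟨rfl, rfl, rfl⟩ | ⟨rfl, rfl, rfl⟩⟩ <;>
  rcases h' with ⟨h2, rfl⟩ | ⟨k, ⟨e1, e2, e3⟩ | ⟨e1, e2, e3⟩⟩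
  · rfl
  · exact absurd e3 ((hK _).1 hq k).1
  · exact absurd e3 ((hK _).1 hq k).2
  · exact absurd rfl ((hK _).1 hq' i).1
  · rw [e2, L.a_inj e3]
  · exact absurd e3 (L.a_ne_b _ _)
  · exact absurd rfl ((hK _).1 hq' i).2
  · exact absurd e3.symm (L.a_ne_b _ _)
  · rw [e2, L.b_inj e3]

include L hK hH in
/-- The reduced graph is cubic again. -/
theorem IsLinkage.isCubic (hG : IsCubic G) : IsCubic (H.induce K) := by
  intro p
  rw [← hG p]
  choose g hg using fun (q : K) (hq : (H.induce K).Adj p q) =>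
    L.exists_represents hH p.2 q.2 hq
  refine Set.ncard_congr g (fun q hq => (hg q hq).1) ?_ ?_
  · intro q q' hq hq' h
    have h2 := (hg q hq).2
    rw [h] at h2
    exact Subtype.ext (L.represents_inj hK q.2 q'.2 h2 (hg q' hq').2)
  · intro w hw
    obtain ⟨q, hq, hpq, hr⟩ := L.exists_adj_represents hK hH p.2 hw
    exact ⟨⟨q, hq⟩, hpq, L.represents_unique (hg ⟨q, hq⟩ hpq).2 hr⟩

include L in
lemma IsLinkage.reverse : IsLinkage G y b a x where
  xa := L.yb
  ab i := (L.ab i).symm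
  yb := L.xa
  a_inj := L.b_inj
  b_inj := L.a_inj
  a_ne_b i j := (L.a_ne_b j i).symm
  x_ne_a := L.y_ne_b
  x_ne_b := L.y_ne_a
  y_ne_a := L.x_ne_b
  y_ne_b := L.x_ne_a
  x_ne_y i := (L.x_ne_y i).symm
  not_adj i h := L.not_adj i h.symm
  pair i j h := L.pair i j (by rw [Sym2.eq_swap, h, Sym2.eq_swap])
  third_a i z h := by simpa only [or_comm] using L.third_b i z h
  third_b i z h := by simpa only [or_comm] using L.third_a i z h

/-- The edges of `G` except those that join inner vertices of different paths. -/
def linkEdges (G : SimpleGraph V) (a b : ι → V) (K : Set V) : Set (Sym2 V) :=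
  {e | e ∈ G.edgeSet ∧ ((∃ v ∈ e, v ∈ K) ∨ ∃ i, e = s(a i, b i))}

lemma mem_linkEdges_left {p q : V} (h : G.Adj p q) (hp : p ∈ K) : s(p, q) ∈ linkEdges G a b K :=
  ⟨h, Or.inl ⟨p, Sym2.mem_mk_left _ _, hp⟩⟩

lemma mem_linkEdges_right {p q : V} (h : G.Adj p q) (hq : q ∈ K) : s(p, q) ∈ linkEdges G a b K :=
  ⟨h, Or.inl ⟨q, Sym2.mem_mk_right _ _, hq⟩⟩

include L in
lemma IsLinkage.mem_linkEdges (i : ι) : s(a i, b i) ∈ linkEdges G a b K :=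
  ⟨L.ab i, Or.inr ⟨i, rfl⟩⟩

lemma linkEdges_reverse : linkEdges G b a K = linkEdges G a b K := by
  unfold linkEdges
  simp only [Sym2.eq_swap]

include L hK in
lemma IsLinkage.notMem_linkEdges (i : ι) (z : V) (hz : G.Adj (a i) z) (hzx : z ≠ x i)
    (hzb : z ≠ b i) : s(a i, z) ∉ linkEdges G a b K := by
  rintro ⟨-, ⟨v, hv, hvK⟩ | ⟨j, hj⟩⟩
  · rw [hK] at hvK
    rcases Sym2.mem_iff.1 hv with rfl | rfl
    · exact (hvK i).1 rfl
    · obtain ⟨j, hj | hj⟩ := (L.third_a i v hz).resolve_left hzx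
      · exact (hvK j).1 hj
      · exact (hvK j).2 hj
  · rcases Sym2.eq_iff.1 hj with ⟨h1, h2⟩ | ⟨h1, -⟩
    · rw [← L.a_inj h1] at h2
      exact hzb h2
    · exact L.a_ne_b _ _ h1

include L hK hH in
lemma IsLinkage.preconnected_linkEdges (hcon : (H.induce K).Preconnected) :
    (fromEdgeSet (linkEdges G a b K)).Preconnected := by
  refine preconnected_of_forall_closed _ fun A hA hc => ?_
  have step : ∀ {p q}, p ∈ A → s(p, q) ∈ linkEdges G a b K → q ∈ A := fun {p q} hp hpq =>
    hc p hp q (by rw [fromEdgeSet_adj]; exact ⟨hpq, (show G.Adj p q from hpq.1).ne⟩)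
  have hx : ∀ i, a i ∈ A → x i ∈ A := fun i h =>
    step h (mem_linkEdges_right (L.xa i).symm (L.x_mem hK i))
  have hy : ∀ i, b i ∈ A → y i ∈ A := fun i h =>
    step h (mem_linkEdges_right (L.yb i).symm (L.y_mem hK i))
  have hx' : ∀ i, x i ∈ A → a i ∈ A := fun i h =>
    step h (mem_linkEdges_left (L.xa i) (L.x_mem hK i))
  have hy' : ∀ i, y i ∈ A → b i ∈ A := fun i h =>
    step h (mem_linkEdges_left (L.yb i) (L.y_mem hK i))
  have hab : ∀ i, a i ∈ A → b i ∈ A := fun i h => step h (L.mem_linkEdges i)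
  have hba : ∀ i, b i ∈ A → a i ∈ A := fun i h =>
    step h (by rw [Sym2.eq_swap]; exact L.mem_linkEdges i)
  obtain ⟨k, hkK, hkA⟩ : ∃ k ∈ K, k ∈ A := by
    obtain ⟨v, hv⟩ := hA
    rcases mem_or_of_linkage hK v with h | ⟨i, rfl | rfl⟩
    · exact ⟨v, h, hv⟩
    · exact ⟨x i, L.x_mem hK i, hx i hv⟩
    · exact ⟨y i, L.y_mem hK i, hy i hv⟩
  have hKA : ∀ v ∈ K, v ∈ A := by
    intro v hv
    by_contra hvA
    obtain ⟨p, hp, q, hq, hpq⟩ := hcon.exists_adj_of_nonempty (A := {k : K | (k : V) ∈ A})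
      (a := ⟨k, hkK⟩) (b := ⟨v, hv⟩) hkA hvA
    apply hq
    rcases (hH p q p.2 q.2).1 hpq with h | ⟨i, hi⟩
    · exact step hp (mem_linkEdges_left h p.2)
    · change (q : V) ∈ A
      change (p : V) ∈ A at hp
      rcases Sym2.eq_iff.1 hi with ⟨h1, h2⟩ | ⟨h1, h2⟩
      · rw [h2]; rw [h1] at hp
        exact hy i (hab i (hx' i hp))
      · rw [h2]; rw [h1] at hp
        exact hx i (hba i (hy' i hp))
  ext v
  simp only [Set.mem_univ, iff_true]
  rcases mem_or_of_linkage hK v with h | ⟨i, rfl | rfl⟩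
  · exact hKA v h
  · exact hx' i (hKA _ (L.x_mem hK i))
  · exact hy' i (hKA _ (L.y_mem hK i))

include L hK in
/-- In the subgraph of the edges `linkEdges`, the vertices kept have degree three and the inner
vertices of the paths at least two. -/
lemma IsLinkage.card_le_ncard_linkEdges [Finite V] (hG : IsCubic G) :
    Nat.card K + 2 * Nat.card V ≤ 2 * (linkEdges G a b K).ncard := by
  classical
  have := Fintype.ofFinite V
  set F := fromEdgeSet (linkEdges G a b K) with hF
  have hadj : ∀ p q, F.Adj p q ↔ s(p, q) ∈ linkEdges G a b K := by
    intro p q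
    rw [hF, fromEdgeSet_adj]
    exact ⟨fun h => h.1, fun h => ⟨h, (show G.Adj p q from h.1).ne⟩⟩
  have hE : F.edgeSet = linkEdges G a b K := by
    ext e
    induction e using Sym2.ind with
    | h p q => exact hadj p q
  rw [← hE, two_mul_ncard_edgeSet, edgeCount_eq_sum]
  have hdeg : ∀ v, (if v ∈ K then 1 else 0) + 2 ≤ F.edgeCount {v} Finset.univ := by
    intro v
    rcases mem_or_of_linkage hK v with h | ⟨i, hi⟩
    · rw [if_pos h]
      refine le_of_eq ((edgeCount_singleton_univ hG v).symm.trans ?_)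
      unfold edgeCount
      refine Finset.sum_congr rfl fun p hp => Finset.sum_congr rfl fun q _ => ?_
      rw [Finset.mem_singleton] at hp
      subst hp
      rw [hadj]
      by_cases hpq : G.Adj p q
      · rw [if_pos hpq, if_pos (mem_linkEdges_left hpq h)]
      · rw [if_neg hpq, if_neg fun h => hpq h.1]
    · have key : ∀ {c d : V}, c ≠ d → F.Adj v c → F.Adj v d → 2 ≤ F.edgeCount {v} Finset.univ := by
        intro c d hcd hc hd
        refine le_trans ?_ (edgeCount_mono_right (Finset.subset_univ {c, d}) _)
        rw [edgeCount_insert_right (by simpa using hcd), edgeCount_singleton_of_adj hc,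
          edgeCount_singleton_of_adj hd]
      have hvK : v ∉ K := by
        rw [hK]
        intro h
        rcases hi with hi | hi
        · exact (h i).1 hi
        · exact (h i).2 hi
      rw [if_neg hvK, zero_add]
      rcases hi with rfl | rfl
      · exact key (L.x_ne_b i i) ((hadj _ _).2 (mem_linkEdges_right (L.xa i).symm (L.x_mem hK i)))
          ((hadj _ _).2 (L.mem_linkEdges i))
      · exact key (L.y_ne_a i i) ((hadj _ _).2 (mem_linkEdges_right (L.yb i).symm (L.y_mem hK i)))
          ((hadj _ _).2 (by rw [Sym2.eq_swap]; exact L.mem_linkEdges i))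
  refine le_trans (le_of_eq ?_) (Finset.sum_le_sum fun v _ => hdeg v)
  rw [Finset.sum_add_distrib, Finset.sum_const, ← Finset.card_filter, Finset.card_univ,
    Nat.card_eq_fintype_card (α := V), Nat.card_eq_fintype_card, Fintype.card_subtype]
  simp [mul_comm]

include L hK hH in
/-- The reduced graph is planar again. -/
theorem IsLinkage.isPlanar [Finite V] (M : PlaneEmbedding G) (hG : IsCubic G)
    (hcon : (H.induce K).Connected) : IsPlanar (H.induce K) := by
  set S := linkEdges G a b K with hS
  choose g hg using fun d : (H.induce K).Dart =>
    L.exists_represents hH d.fst.2 d.snd.2 d.adj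
  let Ψ : (H.induce K).Dart → G.Dart := fun d => ⟨(d.fst, g d), (hg d).1⟩
  have hsurj : ∀ e : G.Dart, e.fst ∈ K → ∃ d, Ψ d = e := by
    intro e he
    obtain ⟨q, hq, hpq, hr⟩ := L.exists_adj_represents hK hH he e.adj
    refine ⟨⟨(⟨e.fst, he⟩, ⟨q, hq⟩), hpq⟩, Dart.ext _ _ (Prod.ext rfl ?_)⟩
    exact L.represents_unique (hg _).2 hr
  have hL' := L.reverse
  have hK' : ∀ v, v ∈ K ↔ ∀ i, v ≠ b i ∧ v ≠ a i := fun v => by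
    rw [hK]; simp only [and_comm]
  have hSr : linkEdges G b a K = S := linkEdges_reverse
  have na := fun i => L.notMem_linkEdges hK i
  have nb := fun i => hL'.notMem_linkEdges hK' i
  rw [hSr] at nb
  have hxa : ∀ i, s(x i, a i) ∈ S := fun i => mem_linkEdges_left (L.xa i) (L.x_mem hK i)
  have hyb : ∀ i, s(y i, b i) ∈ S := fun i => mem_linkEdges_left (L.yb i) (L.y_mem hK i)
  have hab : ∀ i, s(a i, b i) ∈ S := fun i => L.mem_linkEdges i
  refine isPlanar_of_topologicalMinor M hG (L.isCubic hK hH hG) hcon (S := S) (fun e he => he.1)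
    (L.card_le_ncard_linkEdges hK hG) (L.preconnected_linkEdges hK hH hcon.preconnected)
    Subtype.val Subtype.val_injective Ψ (fun d => rfl) ?_ ?_ ?_
  · intro e p hp
    exact hsurj e (by rw [hp]; exact p.2)
  · intro d
    have hg1 := (hg d).2
    have hg2 := (hg d.symm).2
    rcases hg1 with ⟨h1, h2⟩ | ⟨i, ⟨h1, h2, h3⟩ | ⟨h1, h2, h3⟩⟩
    · have h4 : g d.symm = d.fst := L.represents_unique hg2 (Or.inl ⟨h1.symm, rfl⟩)
      have h5 : Ψ d.symm = (Ψ d).symm := Dart.ext _ _ (Prod.ext h2.symm h4)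
      have h6 : (Ψ d).edge ∈ S := mem_linkEdges_left (hg d).1 d.fst.2
      rw [h5, ← facePermIn_of_mem M.rot h6]
      exact (Equiv.Perm.SameCycle.refl _ _).apply_right
    · have h4 : g d.symm = b i := L.represents_unique hg2 (Or.inr ⟨i, Or.inr ⟨h2, h1, rfl⟩⟩)
      have h5 : Ψ d = ⟨(x i, a i), L.xa i⟩ := Dart.ext _ _ (Prod.ext h1 h3)
      have h6 : Ψ d.symm = ⟨(y i, b i), L.yb i⟩ := Dart.ext _ _ (Prod.ext h2 h4)
      rw [h5, h6]
      exact sameCycle_path_end M hG (L.xa i) (L.ab i) (L.yb i).symm (hxa i) (hab i)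
        (by rw [Sym2.eq_swap]; exact hyb i) (L.x_ne_b i i) (L.y_ne_a i i).symm
        (na i) (fun z hz h1 h2 => nb i z hz h2 h1)
    · have h4 : g d.symm = a i := L.represents_unique hg2 (Or.inr ⟨i, Or.inl ⟨h2, h1, rfl⟩⟩)
      have h5 : Ψ d = ⟨(y i, b i), L.yb i⟩ := Dart.ext _ _ (Prod.ext h1 h3)
      have h6 : Ψ d.symm = ⟨(x i, a i), L.xa i⟩ := Dart.ext _ _ (Prod.ext h2 h4)
      rw [h5, h6]
      exact sameCycle_path_end M hG (L.yb i) (L.ab i).symm (L.xa i).symm (hyb i)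
        (by rw [Sym2.eq_swap]; exact hab i)
        (by rw [Sym2.eq_swap]; exact hxa i) (L.y_ne_a i i) (L.x_ne_b i i).symm
        (nb i) (fun z hz h1 h2 => na i z hz h2 h1)
  · intro e
    have conv : ∀ (i : ι), (facePermIn M.rot S).SameCycle ⟨(x i, a i), L.xa i⟩ e ∨
        (facePermIn M.rot S).SameCycle ⟨(y i, b i), L.yb i⟩ e →
        ∃ d, (facePermIn M.rot S).SameCycle (Ψ d) e := by
      rintro i (h | h)
      · obtain ⟨d, hd⟩ := hsurj ⟨(x i, a i), L.xa i⟩ (L.x_mem hK i)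
        exact ⟨d, by rwa [hd]⟩
      · obtain ⟨d, hd⟩ := hsurj ⟨(y i, b i), L.yb i⟩ (L.y_mem hK i)
        exact ⟨d, by rwa [hd]⟩
    rcases mem_or_of_linkage hK e.fst with h | ⟨i, h | h⟩
    · obtain ⟨d, rfl⟩ := hsurj e h
      exact ⟨d, Equiv.Perm.SameCycle.refl _ _⟩
    · exact conv i (sameCycle_path_cover M hG (L.xa i) (L.ab i) (L.yb i).symm (hxa i) (hab i)
        (by rw [Sym2.eq_swap]; exact hyb i) (L.x_ne_b i i) (L.y_ne_a i i).symm
        (na i) (fun z hz h1 h2 => nb i z hz h2 h1) e h)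
    · exact conv i (sameCycle_path_cover M hG (L.yb i) (L.ab i).symm (L.xa i).symm (hyb i)
        (by rw [Sym2.eq_swap]; exact hab i)
        (by rw [Sym2.eq_swap]; exact hxa i) (L.y_ne_a i i) (L.x_ne_b i i).symm
        (nb i) (fun z hz h1 h2 => na i z hz h2 h1) e h).symm

include L hK hH in
/-- A cut of the reduced graph lifts to one of `G` of no greater size, apart from the edges that
join inner vertices of different paths. The inner vertices of each path may be put on the side of
either of its ends. -/
theorem IsLinkage.edgeCount_lift_le [Fintype V] [DecidableEq V] {A C : Finset V}
    {T : Finset V} (hT : ∀ v, v ∈ T ↔ v ∈ K) (hA : A ⊆ T)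
    (hC : ∀ i, (a i ∈ C ↔ b i ∈ C) ∧ ((a i ∈ C ↔ x i ∈ A) ∨ (a i ∈ C ↔ y i ∈ A)))
    (hCK : Disjoint C T) :
    G.cutSize (A ∪ C) ≤ H.edgeCount A (T \ A) + G.edgeCount C (Tᶜ \ C) := by
  classical
  rw [cutSize, edgeCount_eq_card, edgeCount_eq_card, edgeCount_eq_card,
    ← Finset.card_filter_add_card_filter_not
      (p := fun p : V × V => p.1 ∈ C ∧ p.2 ∈ Tᶜ \ C), add_comm]
  have hCT : ∀ {v}, v ∈ C → v ∉ K := fun hv hvK => Finset.disjoint_left.1 hCK hv ((hT _).2 hvK)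
  have hAK : ∀ {v}, v ∈ A → v ∈ K := fun hv => (hT _).1 (hA hv)
  have hxK := fun i => L.x_mem hK i
  have hyK := fun i => L.y_mem hK i
  have haK : ∀ i, a i ∉ K := fun i h => ((hK _).1 h i).1 rfl
  have hbK : ∀ i, b i ∉ K := fun i h => ((hK _).1 h i).2 rfl
  refine Nat.add_le_add ?_ (Finset.card_le_card fun p hp => ?_)
  -- an edge of the lifted cut at a vertex kept goes to itself, or to the new edge for its path
  · refine Finset.card_le_card_of_forall_subsingleton
      (fun p q => q = p ∨ ∃ i, (q = (x i, y i) ∧ (p = (x i, a i) ∨ p = (b i, y i))) ∨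
        (q = (y i, x i) ∧ (p = (y i, b i) ∨ p = (a i, x i)))) ?_ ?_
    · rintro ⟨p, q⟩ hpq
      rw [Finset.mem_filter, Finset.mem_filter, Finset.mem_product] at hpq
      obtain ⟨⟨⟨hp, hq⟩, hadj⟩, hn⟩ := hpq
      simp only [Finset.mem_compl, Finset.mem_union, not_or] at hp hq hadj
      simp only [Finset.mem_sdiff, Finset.mem_compl, hq.2, not_false_eq_true, and_true, not_and,
        not_not] at hn
      have hmem : ∀ {c d : V}, c ∈ A → d ∈ K → d ∉ A → H.Adj c d →
          (c, d) ∈ ((A ×ˢ (T \ A)).filter fun p => H.Adj p.1 p.2) := fun hc hd hd' h =>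
        Finset.mem_filter.2 ⟨Finset.mem_product.2 ⟨hc, Finset.mem_sdiff.2 ⟨(hT _).2 hd, hd'⟩⟩, h⟩
      have hxy : ∀ i, H.Adj (x i) (y i) := fun i =>
        (hH _ _ (hxK i) (hyK i)).2 (Or.inr ⟨i, rfl⟩)
      have hno : ∀ {v}, v ∈ K → ¬ ∃ j, v = a j ∨ v = b j := by
        rintro v hv ⟨j, rfl | rfl⟩
        · exact haK j hv
        · exact hbK j hv
      rcases hp with hp | hp
      · rcases mem_or_of_linkage hK q with hqK | ⟨i, rfl | rfl⟩
        · exact ⟨(p, q), hmem hp hqK hq.1 ((hH _ _ (hAK hp) hqK).2 (Or.inl hadj)), Or.inl rfl⟩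
        · obtain rfl := (L.third_a i p hadj.symm).resolve_right (hno (hAK hp))
          refine ⟨(x i, y i), hmem hp (hyK i) (fun hy => ?_) (hxy i),
            Or.inr ⟨i, Or.inl ⟨rfl, Or.inl rfl⟩⟩⟩
          rcases (hC i).2 with h | h
          · exact hq.2 (h.2 hp)
          · exact hq.2 (h.2 hy)
        · obtain rfl := (L.third_b i p hadj.symm).resolve_right (hno (hAK hp))
          refine ⟨(y i, x i), hmem hp (hxK i) (fun hx => ?_) (hxy i).symm,
            Or.inr ⟨i, Or.inr ⟨rfl, Or.inl rfl⟩⟩⟩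
          rcases (hC i).2 with h | h
          · exact hq.2 ((hC i).1.1 (h.2 hx))
          · exact hq.2 ((hC i).1.1 (h.2 hp))
      · have hqK : q ∈ K := (hT q).1 (hn hp)
        rcases mem_or_of_linkage hK p with hpK | ⟨i, rfl | rfl⟩
        · exact absurd hpK (hCT hp)
        · obtain rfl := (L.third_a i q hadj).resolve_right (hno hqK)
          have hy : y i ∈ A := by
            rcases (hC i).2 with h | h
            · exact absurd (h.1 hp) hq.1
            · exact h.1 hp
          exact ⟨(y i, x i), hmem hy (hxK i) hq.1 (hxy i).symm,
            Or.inr ⟨i, Or.inr ⟨rfl, Or.inr rfl⟩⟩⟩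
        · obtain rfl := (L.third_b i q hadj).resolve_right (hno hqK)
          have hx : x i ∈ A := by
            rcases (hC i).2 with h | h
            · exact h.1 ((hC i).1.2 hp)
            · exact absurd (h.1 ((hC i).1.2 hp)) hq.1
          exact ⟨(x i, y i), hmem hx (hyK i) hq.1 (hxy i),
            Or.inr ⟨i, Or.inl ⟨rfl, Or.inr rfl⟩⟩⟩
    · rintro q -
      have hCa : ∀ {v}, v ∈ A ∪ C → v ∉ K → v ∈ C := fun hv hvK =>
        (Finset.mem_union.1 hv).resolve_left fun h => hvK (hAK h)
      -- the preimage of a new edge is determined by the side on which its path lies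
      have c1 : ∀ i (p : V × V), p.1 ∈ A ∪ C → p.2 ∈ (A ∪ C)ᶜ → G.Adj p.1 p.2 → q = (x i, y i) →
          (q = p ∨ ∃ i, (q = (x i, y i) ∧ (p = (x i, a i) ∨ p = (b i, y i))) ∨
            (q = (y i, x i) ∧ (p = (y i, b i) ∨ p = (a i, x i)))) →
          p = if a i ∈ C then (b i, y i) else (x i, a i) := by
        rintro i p h1 h2 h3 rfl (rfl | ⟨k, ⟨hk, h⟩ | ⟨hk, h⟩⟩)
        · exact absurd h3 (L.not_adj i)
        · obtain ⟨e1, e2⟩ := Prod.mk.inj hk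
          obtain rfl := L.pair i k (by rw [e1, e2])
          rcases h with rfl | rfl
          · rw [if_neg fun h => Finset.mem_compl.1 h2 (Finset.mem_union_right _ h)]
          · rw [if_pos ((hC i).1.2 (hCa h1 (hbK i)))]
        · obtain ⟨e1, e2⟩ := Prod.mk.inj hk
          obtain rfl := L.pair i k (by rw [e1, e2, Sym2.eq_swap])
          exact absurd e1 (L.x_ne_y i)
      have c2 : ∀ i (p : V × V), p.1 ∈ A ∪ C → p.2 ∈ (A ∪ C)ᶜ → G.Adj p.1 p.2 → q = (y i, x i) →
          (q = p ∨ ∃ i, (q = (x i, y i) ∧ (p = (x i, a i) ∨ p = (b i, y i))) ∨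
            (q = (y i, x i) ∧ (p = (y i, b i) ∨ p = (a i, x i)))) →
          p = if a i ∈ C then (a i, x i) else (y i, b i) := by
        rintro i p h1 h2 h3 rfl (rfl | ⟨k, ⟨hk, h⟩ | ⟨hk, h⟩⟩)
        · exact absurd h3.symm (L.not_adj i)
        · obtain ⟨e1, e2⟩ := Prod.mk.inj hk
          obtain rfl := L.pair i k (by rw [← e1, ← e2, Sym2.eq_swap])
          exact absurd e2 (L.x_ne_y i)
        · obtain ⟨e1, e2⟩ := Prod.mk.inj hk
          obtain rfl := L.pair i k (by rw [e1, e2])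
          rcases h with rfl | rfl
          · rw [if_neg fun h => Finset.mem_compl.1 h2 (Finset.mem_union_right _ ((hC i).1.1 h))]
          · rw [if_pos (hCa h1 (haK i))]
      rintro p ⟨hp, hpr⟩ p' ⟨hp', hpr'⟩
      simp only [Finset.mem_filter, Finset.mem_product] at hp hp'
      by_cases h1 : ∃ i, q = (x i, y i)
      · obtain ⟨i, hi⟩ := h1
        rw [c1 i p hp.1.1.1 hp.1.1.2 hp.1.2 hi hpr, c1 i p' hp'.1.1.1 hp'.1.1.2 hp'.1.2 hi hpr']
      by_cases h2 : ∃ i, q = (y i, x i)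
      · obtain ⟨i, hi⟩ := h2
        rw [c2 i p hp.1.1.1 hp.1.1.2 hp.1.2 hi hpr, c2 i p' hp'.1.1.1 hp'.1.1.2 hp'.1.2 hi hpr']
      have h3 : ∀ {p : V × V}, (q = p ∨ ∃ i, (q = (x i, y i) ∧ (p = (x i, a i) ∨ p = (b i, y i))) ∨
            (q = (y i, x i) ∧ (p = (y i, b i) ∨ p = (a i, x i)))) → q = p := by
        rintro p (h | ⟨i, h | h⟩)
        · exact h
        · exact absurd ⟨i, h.1⟩ h1
        · exact absurd ⟨i, h.1⟩ h2
      rw [← h3 hpr, ← h3 hpr']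
  · simp only [Finset.mem_filter, Finset.mem_product] at hp ⊢
    exact ⟨hp.2, hp.1.2⟩

include L hH in
/-- The ends of each path have different colours, so the reduced graph is bipartite again. -/
theorem IsLinkage.isBipartite (hb : G.IsBipartite) :
    (H.induce K).IsBipartite := by
  obtain ⟨f⟩ := hb
  refine ⟨Coloring.mk (fun v => f v) ?_⟩
  intro p q hpq
  have hxy : ∀ i, f (x i) ≠ f (y i) := by
    intro i
    have h1 := f.valid (L.xa i)
    have h2 := f.valid (L.ab i)
    have h3 := f.valid (L.yb i)
    omega
  rcases (hH p q p.2 q.2).1 hpq with h | ⟨i, hi⟩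
  · exact f.valid h
  · rcases Sym2.eq_iff.1 hi with ⟨h1, h2⟩ | ⟨h1, h2⟩
    · rw [h1, h2]; exact hxy i
    · rw [h1, h2]; exact (hxy i).symm

lemma edgeCount_induce {T : Finset K} {U : Finset K} :
    (H.induce K).edgeCount T U =
      H.edgeCount (T.map (Function.Embedding.subtype _)) (U.map (Function.Embedding.subtype _)) := by
  unfold edgeCount
  rw [Finset.sum_map]
  refine Finset.sum_congr rfl fun p _ => ?_
  rw [Finset.sum_map]
  rfl

include L hK hH in
/-- A reduction that leaves the graph 3-edge-connected leads from a C3CBP to a C3CBP. -/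
theorem IsLinkage.isC3CBP [Fintype V] [DecidableEq V] [Finite K] [Nonempty ι] (M : PlaneEmbedding G)
    (hG : IsCubic G) (hb : G.IsBipartite) {T : Finset V} (hT : ∀ v, v ∈ T ↔ v ∈ K)
    (hcut : ∀ A ⊆ T, A.Nonempty → A ≠ T → 3 ≤ H.edgeCount A (T \ A)) :
    IsC3CBP (H.induce K) := by
  classical
  have := Fintype.ofFinite K
  have hc := L.isCubic hK hH hG
  have h3 : (H.induce K).IsThreeEdgeConnected := by
    intro X hX hXu
    have h := hcut (X.map (Function.Embedding.subtype _)) (fun v hv => by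
      obtain ⟨w, -, rfl⟩ := Finset.mem_map.1 hv
      exact (hT _).2 w.2) (by simpa using hX) (fun h => hXu (by
        ext w
        have hw : (w : V) ∈ X.map (Function.Embedding.subtype _) := h ▸ (hT w).2 w.2
        obtain ⟨w', hw', he⟩ := Finset.mem_map.1 hw
        have : w' = w := Subtype.ext he
        simpa [← this] using hw'))
    rw [cutSize, edgeCount_induce]
    convert h using 2
    ext v
    simp only [Finset.mem_map, Finset.mem_compl, Finset.mem_sdiff, hT,
      Function.Embedding.coe_subtype]
    constructor
    · rintro ⟨w, hw, rfl⟩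
      refine ⟨w.2, ?_⟩
      rintro ⟨w', hw', he⟩
      exact hw (Subtype.ext he ▸ hw')
    · rintro ⟨h1, h2⟩
      exact ⟨⟨v, h1⟩, fun h => h2 ⟨_, h, rfl⟩, rfl⟩
  have hne : Nonempty K := ⟨⟨x (Classical.arbitrary ι), L.x_mem hK _⟩⟩
  have hcon : (H.induce K).Connected := by
    rw [connected_iff]
    exact ⟨h3.preconnected, hne⟩
  have hcard : 3 < Fintype.card K := by
    obtain ⟨k⟩ := hne
    have h1 := hc k
    have h2 : ((H.induce K).neighborSet k).ncard < (Set.univ : Set K).ncard :=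
      Set.ncard_lt_ncard ⟨Set.subset_univ _, fun h =>
        (H.induce K).loopless.irrefl k (h (Set.mem_univ k))⟩
    rw [Set.ncard_univ, Nat.card_eq_fintype_card, h1] at h2
    exact h2
  exact ⟨hc, h3.isKConnected hc hcard, L.isBipartite hH hb, L.isPlanar hK hH M hG hcon⟩

end Linkage

end SimpleGraph

/-! ### The cube -/

namespace SimpleGraph

/-- The neighbours of the vertices of the cube in their clockwise order. -/
def cubeNbr : Fin 8 → Fin 3 → Fin 8 :=
  ![![1, 4, 3], ![2, 5, 0], ![3, 6, 1], ![0, 7, 2], ![0, 5, 7], ![1, 6, 4], ![2, 7, 5], ![3, 4, 6]]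

/-- The position of `x` in the list of the neighbours of its neighbour `cubeNbr x k`. -/
def cubeBack : Fin 8 → Fin 3 → Fin 3 :=
  ![![2, 0, 0], ![2, 0, 0], ![2, 0, 0], ![2, 0, 0], ![1, 2, 1], ![1, 2, 1], ![1, 2, 1], ![1, 2, 1]]

lemma cubeGraph_adj {x y : Fin 8} : cubeGraph.Adj x y ↔ ∃ k, cubeNbr x k = y := by
  unfold cubeGraph
  simp only [fromEdgeSet_adj, Set.mem_insert_iff, Set.mem_singleton_iff, Sym2.eq_iff]
  revert x y
  decide

lemma cubeNbr_injective (x : Fin 8) : Function.Injective (cubeNbr x) := by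
  revert x; decide

lemma isCubic_cubeGraph : IsCubic cubeGraph := by
  intro x
  have : cubeGraph.neighborSet x = Set.range (cubeNbr x) := by
    ext y
    exact cubeGraph_adj
  rw [this, ← Set.image_univ, Set.ncard_image_of_injective _ (cubeNbr_injective x), Set.ncard_univ,
    Nat.card_eq_fintype_card, Fintype.card_fin]

lemma three_le_cube_cut : ∀ X : Finset (Fin 8), X.Nonempty → X ≠ Finset.univ →
    3 ≤ ∑ x ∈ X, ∑ k, if cubeNbr x k ∈ X then 0 else 1 := by
  decide +kernel

lemma isThreeEdgeConnected_cubeGraph : cubeGraph.IsThreeEdgeConnected := by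
  intro X hX hXu
  refine (three_le_cube_cut X hX hXu).trans (le_of_eq ?_)
  rw [cutSize, edgeCount_eq_sum X]
  refine Finset.sum_congr rfl fun x _ => ?_
  have h : ∀ k, cubeGraph.Adj x (cubeNbr x k) := fun k => cubeGraph_adj.2 ⟨k, rfl⟩
  have hi := fun k l (hkl : k ≠ l) => (cubeNbr_injective x).ne hkl
  rw [edgeCount_singleton_eq isCubic_cubeGraph (h 0) (h 1) (h 2) (hi 0 1 (by decide))
    (hi 0 2 (by decide)) (hi 1 2 (by decide)), Fin.sum_univ_three]
  simp only [Finset.mem_compl, ite_not]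

lemma isBipartite_cubeGraph : cubeGraph.IsBipartite := by
  refine ⟨Coloring.mk ![0, 1, 0, 1, 1, 0, 1, 0] ?_⟩
  intro x y h
  obtain ⟨k, rfl⟩ := cubeGraph_adj.1 h
  clear h
  revert x k
  decide

/-- The darts of the cube. -/
noncomputable def cubeDart : Fin 8 × Fin 3 ≃ cubeGraph.Dart :=
  Equiv.ofBijective (fun p => ⟨(p.1, cubeNbr p.1 p.2), cubeGraph_adj.2 ⟨p.2, rfl⟩⟩) (by
    constructor
    · rintro ⟨x, k⟩ ⟨y, l⟩ h
      have h1 : (x, cubeNbr x k) = (y, cubeNbr y l) := congrArg Dart.toProd h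
      obtain ⟨rfl, h2⟩ := Prod.mk.inj h1
      rw [cubeNbr_injective x h2]
    · rintro ⟨⟨x, y⟩, h⟩
      obtain ⟨k, hk⟩ : ∃ k, cubeNbr x k = y := cubeGraph_adj.1 h
      exact ⟨(x, k), Dart.ext _ _ (Prod.ext rfl hk)⟩)

lemma cubeDart_symm (p : Fin 8 × Fin 3) :
    (cubeDart p).symm = cubeDart (cubeNbr p.1 p.2, cubeBack p.1 p.2) := by
  refine Dart.ext _ _ (Prod.ext rfl ?_)
  change p.1 = cubeNbr (cubeNbr p.1 p.2) (cubeBack p.1 p.2)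
  obtain ⟨x, k⟩ := p
  revert x k
  decide

/-- The rotation system of the cube given by `cubeNbr`. -/
noncomputable def cubeRot : Equiv.Perm cubeGraph.Dart :=
  cubeDart.permCongr ((Equiv.refl _).prodCongr (Equiv.addRight 1))

lemma cubeRot_cubeDart (x : Fin 8) (k : Fin 3) :
    cubeRot (cubeDart (x, k)) = cubeDart (x, k + 1) := by
  simp [cubeRot]

/-- The number of the face that the dart `cubeDart (x, k)` of the cube belongs to. -/
def cubeFace : Fin 8 → Fin 3 → Fin 6 :=
  ![![0, 1, 2], ![0, 3, 1], ![0, 4, 3], ![0, 2, 4], ![2, 1, 5], ![1, 3, 5], ![3, 4, 5], ![4, 2, 5]]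

lemma isPlanar_cubeGraph : IsPlanar cubeGraph := by
  refine isPlanar_of_card_le cubeRot ?_ ?_ isCubic_cubeGraph.exists_adj ?_
  · intro d
    obtain ⟨⟨x, k⟩, rfl⟩ := cubeDart.surjective d
    rw [cubeRot_cubeDart]
    rfl
  · intro d e h
    obtain ⟨⟨x, k⟩, rfl⟩ := cubeDart.surjective d
    obtain ⟨⟨y, l⟩, rfl⟩ := cubeDart.surjective e
    obtain rfl : x = y := h
    obtain rfl | rfl | rfl : l = k ∨ l = k + 1 ∨ l = k + 1 + 1 := by omega
    · exact Equiv.Perm.SameCycle.refl _ _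
    · rw [← cubeRot_cubeDart]
      exact (Equiv.Perm.SameCycle.refl _ _).apply_right
    · rw [← cubeRot_cubeDart, ← cubeRot_cubeDart]
      exact (Equiv.Perm.SameCycle.refl _ _).apply_right.apply_right
  · have h1 := two_mul_ncard_edgeSet_of_cubic isCubic_cubeGraph
    have h2 : Nat.card cubeGraph.ConnectedComponent = 1 := by
      have h := numComp_of_preconnected (S := cubeGraph.edgeSet) (by
        rw [fromEdgeSet_edgeSet]; exact isThreeEdgeConnected_cubeGraph.preconnected)
      rwa [numComp, fromEdgeSet_edgeSet] at h
    have h3 : Nat.card (Fin 6) ≤ numCycles (facePerm cubeRot) := by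
      refine le_numCycles_of_surjective _
        (fun d => cubeFace (cubeDart.symm d).1 (cubeDart.symm d).2) ?_ ?_
      · intro d
        obtain ⟨⟨x, k⟩, rfl⟩ := cubeDart.surjective d
        have h4 : facePerm cubeRot (cubeDart (x, k))
            = cubeDart (cubeNbr x k, cubeBack x k + 1) := by
          change cubeRot (cubeDart (x, k)).symm = _
          rw [cubeDart_symm, cubeRot_cubeDart]
        rw [h4, Equiv.symm_apply_apply, Equiv.symm_apply_apply]
        clear h1 h2 h4
        revert x k
        decide
      · intro c
        obtain ⟨p, hp⟩ : ∃ p : Fin 8 × Fin 3, cubeFace p.1 p.2 = c := by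
          revert c; decide
        exact ⟨cubeDart p, by simpa using hp⟩
    rw [Fintype.card_fin] at h1
    rw [Nat.card_eq_fintype_card, Fintype.card_fin] at h3
    rw [h2, Nat.card_eq_fintype_card, Fintype.card_fin]
    omega

theorem isC3CBP_cubeGraph : IsC3CBP cubeGraph where
  cubic := isCubic_cubeGraph
  connected := isThreeEdgeConnected_cubeGraph.isKConnected isCubic_cubeGraph (by simp)
  bipartite := isBipartite_cubeGraph
  planar := isPlanar_cubeGraph

/-- Eight vertices that consist of the cube minus a vertex and a common neighbour of its three
vertices of degree two form the cube. -/
theorem IsCubeMinusVertex.nonempty_iso {V : Type*} [Fintype V] {G : SimpleGraph V} (hG : IsCubic G)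
    {j g h i a b c z : V} (hQ : IsCubeMinusVertex G j g h i a b c)
    (hz : [j, g, h, i, a, b, c, z].Nodup) (ha : G.Adj a z) (hb : G.Adj b z) (hc : G.Adj c z)
    (hV : Fintype.card V = 8) : Nonempty (G ≃g cubeGraph) := by
  -- the outer face `j g b h` is opposite the inner face `i c z a`
  let F : Fin 8 → V := ![j, g, b, h, i, c, z, a]
  have hF : Function.Injective F := by
    rw [← List.nodup_ofFn]
    refine (List.Perm.nodup_iff ?_).1 hz
    simp only [F, List.ofFn_succ, Fin.isValue, List.ofFn_zero]
    change [j, g, h, i, a, b, c, z].Perm [j, g, b, h, i, c, z, a]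
    rw [← Multiset.coe_eq_coe]
    simp only [← Multiset.cons_coe]
    rw [Multiset.cons_swap a b, Multiset.cons_swap i b, Multiset.cons_swap h b,
      Multiset.cons_swap a c, Multiset.cons_swap a z]
  have hFb : Function.Bijective F := by
    rw [Fintype.bijective_iff_injective_and_card]
    exact ⟨hF, by simp [hV]⟩
  have hmap : ∀ x k, G.Adj (F x) (F (cubeNbr x k)) := by
    obtain ⟨-, h1, h2, h3, h4, h5, h6, h7, h8, h9⟩ := hQ
    intro x k
    fin_cases x <;> fin_cases k <;>
      first
      | assumption
      | exact (by assumption : G.Adj _ _).symm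
  have hiff : ∀ {x y}, G.Adj (F x) (F y) ↔ cubeGraph.Adj x y := by
    intro x y
    rw [cubeGraph_adj]
    constructor
    · intro hxy
      have hi := fun k l (hkl : k ≠ l) => hF.ne ((cubeNbr_injective x).ne hkl)
      rcases hG.eq_of_adj (hmap x 0) (hmap x 1) (hmap x 2) (hi 0 1 (by decide))
        (hi 0 2 (by decide)) (hi 1 2 (by decide)) hxy with h | h | h
      · exact ⟨0, (hF h).symm⟩
      · exact ⟨1, (hF h).symm⟩
      · exact ⟨2, (hF h).symm⟩
    · rintro ⟨k, rfl⟩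
      exact hmap x k
  exact ⟨(⟨Equiv.ofBijective F hFb, hiff⟩ : cubeGraph ≃g G).symm⟩

end SimpleGraph

/-! ### Reducing a square -/

namespace SimpleGraph

variable {V : Type*} {G : SimpleGraph V}

lemma edge_adj_iff_of_ne {s t : V} (hst : s ≠ t) (p q : V) :
    (edge s t).Adj p q ↔ s(p, q) = s(s, t) := by
  rw [edge, fromEdgeSet_adj, Set.mem_singleton_iff]
  refine ⟨fun h => h.1, fun h => ⟨h, ?_⟩⟩
  rintro rfl
  rcases Sym2.eq_iff.1 h with ⟨h1, h2⟩ | ⟨h1, h2⟩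
  · exact hst (h1.symm.trans h2)
  · exact hst (h2.symm.trans h1)

section

variable [Fintype V] [DecidableEq V]

lemma IsObstruction.of_rotate_two {v u : Fin 4 → V} {X : Finset V}
    (h : IsObstruction G (fun i => v (i + 2)) (fun i => u (i + 2)) X) :
    IsObstruction G v u Xᶜ := by
  obtain ⟨h0, h1, h2, h3, h4, h5, h6, h7, h8⟩ := h
  refine ⟨by rw [cutSize_compl, h0], ?_, ?_, ?_, ?_, ?_, ?_, ?_, ?_⟩ <;>
    simpa using by assumption

/-- If the edge `u 0 u 1` is present already, then `u 0`, `u 1`, `v 1`, `v 0` is a 4-cycle, and its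
vertices form an obstruction. -/
lemma IsSquare.isObstruction_of_adj (hG : IsCubic G) (h3 : G.IsThreeEdgeConnected)
    {v u : Fin 4 → V} (hs : IsSquare G v u) (h : G.Adj (u 0) (u 1)) :
    IsObstruction G v u {u 1, u 0, v 1, v 0} := by
  have n1 : v 1 ∉ ({v 0} : Finset V) := by simpa using hs.v_inj.ne (by decide)
  have n2 : u 0 ∉ ({v 1, v 0} : Finset V) := by simp [(hs.ne _ _).symm]
  have n3 : u 1 ∉ ({u 0, v 1, v 0} : Finset V) := by
    simpa [(hs.ne _ _).symm] using hs.u_inj.ne (a₁ := 1) (a₂ := 0) (by decide)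
  have n4 : v 2 ∉ ({u 1, u 0, v 1, v 0} : Finset V) := by
    simpa [hs.ne] using ⟨hs.v_inj.ne (a₁ := 2) (a₂ := 1) (by decide),
      hs.v_inj.ne (a₁ := 2) (a₂ := 0) (by decide)⟩
  have c0 := cutSize_singleton hG (v 0)
  have c1 := cutSize_insert hG n1
  have c2 := cutSize_insert hG n2
  have c3 := cutSize_insert hG n3
  have e1 : 0 < G.edgeCount {v 1} {v 0} := edgeCount_pos (by simp) (by simp) (hs.adj 0).symm
  have e2 : 0 < G.edgeCount {u 0} {v 1, v 0} :=
    edgeCount_pos (Finset.mem_singleton_self _) (by simp) (hs.adj_out 0).symm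
  have e3 : 0 < G.edgeCount {u 1} {v 1, v 0} :=
    edgeCount_pos (Finset.mem_singleton_self _) (by simp) (hs.adj_out 1).symm
  rw [edgeCount_insert_right n2, edgeCount_singleton_of_adj h.symm] at c3
  have c4 := cutSize_mod_two hG {u 1, u 0, v 1, v 0}
  have c5 : ({u 1, u 0, v 1, v 0} : Finset V).card = 4 := by
    rw [Finset.card_insert_of_notMem n3, Finset.card_insert_of_notMem n2,
      Finset.card_insert_of_notMem n1, Finset.card_singleton]
  have c6 := h3 {u 1, u 0, v 1, v 0} (by simp) (fun h => n4 (h ▸ Finset.mem_univ _))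
  refine ⟨by omega, by simp, by simp, by simp, by simp, n4, ?_, ?_, ?_⟩
  · simpa [hs.ne] using ⟨hs.v_inj.ne (a₁ := 3) (a₂ := 1) (by decide),
      hs.v_inj.ne (a₁ := 3) (a₂ := 0) (by decide)⟩
  · simpa [(hs.ne _ _).symm] using ⟨hs.u_inj.ne (a₁ := 2) (a₂ := 1) (by decide),
      hs.u_inj.ne (a₁ := 2) (a₂ := 0) (by decide)⟩
  · simpa [(hs.ne _ _).symm] using ⟨hs.u_inj.ne (a₁ := 3) (a₂ := 1) (by decide),
      hs.u_inj.ne (a₁ := 3) (a₂ := 0) (by decide)⟩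

omit [Fintype V] [DecidableEq V] in
lemma IsSquare.isLinkage (hG : IsCubic G) {v u : Fin 4 → V} (hs : IsSquare G v u)
    (h01 : ¬ G.Adj (u 0) (u 1)) (h23 : ¬ G.Adj (u 2) (u 3)) :
    IsLinkage G ![u 0, u 2] ![v 0, v 2] ![v 1, v 3] ![u 1, u 3] := by
  have hv := fun i j (hij : i ≠ j) => hs.v_inj.ne hij
  have hu := fun i j (hij : i ≠ j) => hs.u_inj.ne hij
  have hvu := hs.ne
  have huv := fun i j => (hs.ne i j).symm
  have key : ∀ i z, G.Adj (v i) z → z = v (i + 1) ∨ z = v (i + 3) ∨ z = u i :=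
    fun i z hz => hs.eq_of_adj hG hz
  constructor
  · exact Fin.forall_fin_two.2 ⟨(hs.adj_out 0).symm, (hs.adj_out 2).symm⟩
  · exact Fin.forall_fin_two.2 ⟨hs.adj 0, hs.adj 2⟩
  · exact Fin.forall_fin_two.2 ⟨(hs.adj_out 1).symm, (hs.adj_out 3).symm⟩
  · intro i j hij
    fin_cases i <;> fin_cases j <;> first | rfl | exact absurd (hs.v_inj hij) (by decide)
  · intro i j hij
    fin_cases i <;> fin_cases j <;> first | rfl | exact absurd (hs.v_inj hij) (by decide)
  · intro i j
    fin_cases i <;> fin_cases j <;> exact hs.v_inj.ne (by decide)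
  · intro i j
    fin_cases i <;> fin_cases j <;> exact huv _ _
  · intro i j
    fin_cases i <;> fin_cases j <;> exact huv _ _
  · intro i j
    fin_cases i <;> fin_cases j <;> exact huv _ _
  · intro i j
    fin_cases i <;> fin_cases j <;> exact huv _ _
  · intro i
    fin_cases i <;> exact hs.u_inj.ne (by decide)
  · exact Fin.forall_fin_two.2 ⟨h01, h23⟩
  · intro i j hij
    fin_cases i <;> fin_cases j <;>
      first
      | rfl
      | (rcases Sym2.eq_iff.1 hij with ⟨h, -⟩ | ⟨h, -⟩ <;>
          exact absurd (hs.u_inj h) (by decide))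
  · intro i z hz
    fin_cases i
    · rcases key 0 z hz with h | h | h
      · exact Or.inr ⟨0, Or.inr h⟩
      · exact Or.inr ⟨1, Or.inr h⟩
      · exact Or.inl h
    · rcases key 2 z hz with h | h | h
      · exact Or.inr ⟨1, Or.inr h⟩
      · exact Or.inr ⟨0, Or.inr h⟩
      · exact Or.inl h
  · intro i z hz
    fin_cases i
    · rcases key 1 z hz with h | h | h
      · exact Or.inr ⟨1, Or.inl h⟩
      · exact Or.inr ⟨0, Or.inl h⟩
      · exact Or.inl h
    · rcases key 3 z hz with h | h | h
      · exact Or.inr ⟨0, Or.inl h⟩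
      · exact Or.inr ⟨1, Or.inl h⟩
      · exact Or.inl h

/-- The graph obtained from `G` by the reduction at the square `v` that adds the edges `u 0 u 1`
and `u 2 u 3`, before the deletion of the square. -/
abbrev squareSup (G : SimpleGraph V) (u : Fin 4 → V) : SimpleGraph V :=
  G ⊔ edge (u 0) (u 1) ⊔ edge (u 2) (u 3)

omit [Fintype V] [DecidableEq V] in
lemma IsSquare.squareSup_adj {v u : Fin 4 → V} (hs : IsSquare G v u) (p q : V) :
    (squareSup G u).Adj p q ↔
      G.Adj p q ∨ ∃ i, s(p, q) = s(![u 0, u 2] i, ![u 1, u 3] i) := by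
  rw [sup_adj, sup_adj, edge_adj_iff_of_ne (hs.u_inj.ne (by decide)),
    edge_adj_iff_of_ne (hs.u_inj.ne (by decide)), Fin.exists_fin_two, or_assoc]
  rfl

/-- A cut with at most two edges after the reduction, with `u 0` and `u 1` on one side and `u 2` and
`u 3` on the other, comes from an obstruction. It cannot come from a cut with three edges, since
those would include `v 0 v 3` and `v 1 v 2`, whose ends on either side have different colours. -/
lemma IsSquare.isObstruction_of_cut (hG : IsCubic G) (h3 : G.IsThreeEdgeConnected)
    (f : G.Coloring (Fin 2)) {v u : Fin 4 → V} (hs : IsSquare G v u) (h01 : ¬ G.Adj (u 0) (u 1))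
    (h23 : ¬ G.Adj (u 2) (u 3)) {T A : Finset V} (hT : T = {v 0, v 1, v 2, v 3}ᶜ) (hA : A ⊆ T)
    (h : (squareSup G u).edgeCount A (T \ A) ≤ 2) (h0 : u 0 ∈ A) (h1 : u 1 ∈ A) (h2 : u 2 ∉ A)
    (h3' : u 3 ∉ A) : IsObstruction G v u (A ∪ {v 0, v 1}) := by
  have hv : ∀ i, v i ∉ A := fun i hi => by
    have := hA hi
    rw [hT] at this
    fin_cases i <;> simp at this
  have hvn := fun i j (hij : i ≠ j) => hs.v_inj.ne hij
  have hTC : Tᶜ \ {v 0, v 1} = {v 2, v 3} := by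
    rw [hT, compl_compl]
    ext z
    simp only [Finset.mem_sdiff, Finset.mem_insert, Finset.mem_singleton]
    have a1 := hvn 2 0 (by decide)
    have a2 := hvn 2 1 (by decide)
    have a3 := hvn 3 0 (by decide)
    have a4 := hvn 3 1 (by decide)
    constructor
    · tauto
    · rintro (rfl | rfl) <;> tauto
  have m0 : v 2 ∉ A ∪ {v 0, v 1} := by
    simp [hv, hvn 2 0 (by decide), hvn 2 1 (by decide)]
  have m1 : v 3 ∉ A ∪ {v 0, v 1} := by
    simp [hv, hvn 3 0 (by decide), hvn 3 1 (by decide)]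
  have hle := (hs.isLinkage hG h01 h23).edgeCount_lift_le
    (K := ({v 0, v 1, v 2, v 3} : Set V)ᶜ) (H := squareSup G u) (T := T) (A := A)
    (C := {v 0, v 1})
    (fun z => by simp [Fin.forall_fin_two]; tauto) (fun p q _ _ => hs.squareSup_adj p q)
    (fun z => by rw [hT]; simp) hA (by
      rw [Fin.forall_fin_two]
      simp [h0, h1, h2, h3', hvn 2 0 (by decide), hvn 2 1 (by decide), hvn 3 0 (by decide),
        hvn 3 1 (by decide)]) (by rw [hT, Finset.disjoint_left]; simp)
  have hC : G.edgeCount {v 0, v 1} {v 2, v 3} ≤ 2 := by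
    have n : ∀ i : Fin 4, ¬ G.Adj (v i) (v (i + 2)) := fun i hi => by
      rcases hs.eq_of_adj hG hi with h | h | h
      · exact absurd (hs.v_inj h) (by omega)
      · exact absurd (hs.v_inj h) (by omega)
      · exact hs.ne _ _ h
    rw [edgeCount_insert_left (by simpa using hvn 0 1 (by decide)),
      edgeCount_insert_right (by simpa using hvn 2 3 (by decide)),
      edgeCount_insert_right (by simpa using hvn 2 3 (by decide)),
      edgeCount_singleton_of_not_adj (show ¬ G.Adj (v 0) (v 2) from n 0),
      edgeCount_singleton_of_not_adj (show ¬ G.Adj (v 1) (v 3) from n 1)]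
    have := edgeCount_le_one (G := G) (v 0) (v 3)
    have := edgeCount_le_one (G := G) (v 1) (v 2)
    omega
  rw [hTC] at hle
  have hge := h3 (A ∪ {v 0, v 1}) (by simp) (fun h => m0 (h ▸ Finset.mem_univ _))
  have hne : G.cutSize (A ∪ {v 0, v 1}) ≠ 3 := fun hc =>
    f.valid (hs.adj 0) (colour_eq_of_cutSize_eq_three hG f hc (by simp) m1 (hs.adj_prev 0)
      (by simp) m0 (hs.adj 1))
  exact ⟨by omega, by simp, by simp, by simp [h0], by simp [h1], m0, m1,
    by simp [h2, (hs.ne _ _).symm], by simp [h3', (hs.ne _ _).symm]⟩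

/-- The reduction at a square of a Barnette graph leads to a Barnette graph unless it is
obstructed. -/
theorem IsSquare.isC3CBP_or (M : PlaneEmbedding G) (hG : IsCubic G) (h3 : G.IsThreeEdgeConnected)
    (hb : G.IsBipartite) {v u : Fin 4 → V} (hs : IsSquare G v u) :
    IsC3CBP ((squareSup G u).induce (({v 0, v 1, v 2, v 3} : Set V)ᶜ)) ∨
      ∃ X, IsObstruction G v u X := by
  by_contra! hn
  obtain ⟨hn, hX⟩ := hn
  have h01 : ¬ G.Adj (u 0) (u 1) := fun h => hX _ (hs.isObstruction_of_adj hG h3 h)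
  have h23 : ¬ G.Adj (u 2) (u 3) := fun h =>
    hX _ ((hs.rotate 2).isObstruction_of_adj hG h3 h).of_rotate_two
  obtain ⟨f⟩ := hb
  have hK : ∀ z, z ∈ (({v 0, v 1, v 2, v 3} : Set V)ᶜ) ↔
      ∀ i, z ≠ ![v 0, v 2] i ∧ z ≠ ![v 1, v 3] i :=
    fun z => by simp [Fin.forall_fin_two]; tauto
  set T : Finset V := {v 0, v 1, v 2, v 3}ᶜ with hT
  have hTK : ∀ z, z ∈ T ↔ z ∈ (({v 0, v 1, v 2, v 3} : Set V)ᶜ) := fun z => by simp [hT]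
  have L := hs.isLinkage hG h01 h23
  refine hn (L.isC3CBP hK (fun p q _ _ => hs.squareSup_adj p q) M hG ⟨f⟩ hTK ?_)
  intro A hA hA0 hAT
  by_contra! hc
  have lift := fun (C : Finset V) => L.edgeCount_lift_le hK (fun p q _ _ => hs.squareSup_adj p q)
    (C := C) hTK hA
  have huT : ∀ i, u i ∈ T := fun i => by simp [hT, (hs.ne _ _).symm]
  -- Each new edge that the cut does not separate takes its path along. The two paths lie on
  -- different sides only if one new edge is contained in `A` and the other in `T \ A`.
  by_cases c1 : (u 0 ∈ A ∨ u 1 ∈ A) ∧ (u 2 ∈ A ∨ u 3 ∈ A)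
  · have := lift Tᶜ (by rw [Fin.forall_fin_two]; simpa [hT] using c1) disjoint_compl_left
    have h := h3 (A ∪ Tᶜ) (hA0.mono Finset.subset_union_left) (fun h => hAT (by
      refine hA.antisymm fun z hz => ?_
      have hz' : z ∈ A ∪ Tᶜ := h ▸ Finset.mem_univ z
      simpa [hz] using hz'))
    rw [Finset.sdiff_self, edgeCount_empty_right] at this
    omega
  by_cases c2 : (u 0 ∉ A ∨ u 1 ∉ A) ∧ (u 2 ∉ A ∨ u 3 ∉ A)
  · have := lift ∅ (by rw [Fin.forall_fin_two]; simpa using c2) (Finset.disjoint_empty_left _)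
    have h := h3 (A ∪ ∅) (hA0.mono Finset.subset_union_left) (fun h => by
      have hz' : v 0 ∈ A ∪ ∅ := h ▸ Finset.mem_univ _
      rw [Finset.union_empty] at hz'
      have := hA hz'
      simp [hT] at this)
    rw [edgeCount_empty_left] at this
    omega
  by_cases c3 : u 0 ∈ A ∧ u 1 ∈ A ∧ u 2 ∉ A ∧ u 3 ∉ A
  · exact hX _ (hs.isObstruction_of_cut hG h3 f h01 h23 hT hA (by omega) c3.1 c3.2.1 c3.2.2.1
      c3.2.2.2)
  · have c4 : u 0 ∉ A ∧ u 1 ∉ A ∧ u 2 ∈ A ∧ u 3 ∈ A := by tauto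
    refine hX _ (hs.isObstruction_of_cut hG h3 f h01 h23 hT (A := T \ A) Finset.sdiff_subset ?_
      (Finset.mem_sdiff.2 ⟨huT 0, c4.1⟩) (Finset.mem_sdiff.2 ⟨huT 1, c4.2.1⟩) (by simp [c4])
      (by simp [c4]))
    rw [Finset.sdiff_sdiff_eq_self hA, edgeCount_comm]
    omega

end

end SimpleGraph

/-! ### Replacing the cube minus a vertex -/

namespace SimpleGraph

variable {V : Type*} {G : SimpleGraph V} {j g h i a b c : V}

/-- The edges `a d`, `b e`, `c f` attach the cube minus a vertex to vertices outside it. -/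
structure IsAttached (G : SimpleGraph V) (j g h i a b c d e f : V) : Prop where
  ad : G.Adj a d
  be : G.Adj b e
  cf : G.Adj c f
  d_notMem : d ∉ [j, g, h, i, a, b, c]
  e_notMem : e ∉ [j, g, h, i, a, b, c]
  f_notMem : f ∉ [j, g, h, i, a, b, c]

/-- The third neighbour of `a` lies outside the cube minus a vertex: it differs in colour from `j`,
`a`, `b`, `c`, and `g` has the three neighbours `j`, `b`, `c`. -/
lemma IsCubeMinusVertex.exists_adj_notMem (hQ : IsCubeMinusVertex G j g h i a b c) (hG : IsCubic G)
    (C : G.Coloring (Fin 2)) : ∃ d, G.Adj a d ∧ d ∉ [j, g, h, i, a, b, c] := by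
  obtain ⟨nd, jg, jh, ji, ah, ai, bg, bh, cg, ci⟩ := hQ
  simp only [List.nodup_cons, List.mem_cons, List.not_mem_nil, not_or, or_false] at nd
  obtain ⟨d, hd, hdh, hdi⟩ := hG.exists_third (x := a) (a := h) (b := i)
  refine ⟨d, hd, ?_⟩
  have hg : d ≠ g := by
    rintro rfl
    rcases hG.eq_of_adj jg.symm bg.symm cg.symm (by tauto) (by tauto) (by tauto) hd.symm
      with h | h | h <;> tauto
  have v1 := C.valid jh
  have v2 := C.valid ah
  have v3 := C.valid bh
  have v4 := C.valid ci
  have v5 := C.valid ji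
  have v6 := C.valid hd
  have key : ∀ z, C z = C a → d ≠ z := by
    rintro z hz rfl
    exact v6 hz.symm
  have k1 := key j (by omega)
  have k2 := key a rfl
  have k3 := key b (by omega)
  have k4 := key c (by omega)
  simp only [List.mem_cons, List.not_mem_nil, not_or, or_false]
  tauto

/-- The symmetry of the cube minus a vertex that rotates `a`, `b`, `c`. -/
lemma IsCubeMinusVertex.rotate (hQ : IsCubeMinusVertex G j g h i a b c) :
    IsCubeMinusVertex G j i g h b c a where
  nodup := by
    have nd := hQ.nodup
    simp only [List.nodup_cons, List.mem_cons, List.not_mem_nil, not_or, or_false] at nd ⊢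
    have := fun x y : V => @ne_comm _ x y
    grind
  jg := hQ.ji
  jh := hQ.jg
  ji := hQ.jh
  ah := hQ.bg
  ai := hQ.bh
  bg := hQ.ci
  bh := hQ.cg
  cg := hQ.ai
  ci := hQ.ah

lemma IsCubeMinusVertex.exists_isAttached (hQ : IsCubeMinusVertex G j g h i a b c) (hG : IsCubic G)
    (C : G.Coloring (Fin 2)) : ∃ d e f, IsAttached G j g h i a b c d e f := by
  obtain ⟨d, had, hd⟩ := hQ.exists_adj_notMem hG C
  obtain ⟨e, hbe, he⟩ := hQ.rotate.exists_adj_notMem hG C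
  obtain ⟨f, hcf, hf⟩ := hQ.rotate.rotate.exists_adj_notMem hG C
  refine ⟨d, e, f, had, hbe, hcf, hd, ?_, ?_⟩
  · simp only [List.mem_cons, List.not_mem_nil, not_or, or_false] at he ⊢
    tauto
  · simp only [List.mem_cons, List.not_mem_nil, not_or, or_false] at hf ⊢
    tauto

lemma IsCubeMinusVertex.cutSize_le [Fintype V] [DecidableEq V]
    (hQ : IsCubeMinusVertex G j g h i a b c) (hG : IsCubic G) :
    G.cutSize {c, b, a, i, h, g, j} ≤ 3 := by
  obtain ⟨nd, jg, jh, ji, ah, ai, bg, bh, cg, ci⟩ := hQ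
  simp only [List.nodup_cons, List.mem_cons, List.not_mem_nil, not_or, or_false] at nd
  have c0 := cutSize_singleton hG j
  have n1 : g ∉ ({j} : Finset V) := by simp; grind
  have n2 : h ∉ ({g, j} : Finset V) := by simp; grind
  have n3 : i ∉ ({h, g, j} : Finset V) := by simp; grind
  have n4 : a ∉ ({i, h, g, j} : Finset V) := by simp; grind
  have n5 : b ∉ ({a, i, h, g, j} : Finset V) := by simp; grind
  have n6 : c ∉ ({b, a, i, h, g, j} : Finset V) := by simp; grind
  have c1 := cutSize_insert hG n1
  have c2 := cutSize_insert hG n2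
  have c3 := cutSize_insert hG n3
  have c4 := cutSize_insert hG n4
  have c5 := cutSize_insert hG n5
  have c6 := cutSize_insert hG n6
  -- `g`, `h`, `i` are inserted with one edge into the set each, and `a`, `b`, `c` with two
  have two : ∀ {x p q : V} {S : Finset V}, G.Adj x p → G.Adj x q → p ≠ q → p ∈ S → q ∈ S →
      2 ≤ G.edgeCount {x} S := fun {x p q S} hp hq hpq hpS hqS => by
    refine le_trans ?_ (edgeCount_mono_right (A := {p, q}) (B := S)
      (by simp [Finset.insert_subset_iff, hpS, hqS]) {x})
    rw [edgeCount_insert_right (by simpa using hpq), edgeCount_singleton_of_adj hp,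
      edgeCount_singleton_of_adj hq]
  have e1 : 0 < G.edgeCount {g} {j} := edgeCount_pos (by simp) (by simp) jg.symm
  have e2 : 0 < G.edgeCount {h} {g, j} :=
    edgeCount_pos (Finset.mem_singleton_self _) (by simp) jh.symm
  have e3 : 0 < G.edgeCount {i} {h, g, j} :=
    edgeCount_pos (Finset.mem_singleton_self _) (by simp) ji.symm
  have e4 : 2 ≤ G.edgeCount {a} {i, h, g, j} := two ah ai (by grind) (by simp) (by simp)
  have e5 : 2 ≤ G.edgeCount {b} {a, i, h, g, j} := two bg bh (by grind) (by simp) (by simp)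
  have e6 : 2 ≤ G.edgeCount {c} {b, a, i, h, g, j} := two cg ci (by grind) (by simp) (by simp)
  omega

/-- A vertex outside the cube minus a vertex that is joined to it by two edges is the only vertex
outside it. -/
lemma IsCubeMinusVertex.eq_of_two_adj [Fintype V] [DecidableEq V]
    (hQ : IsCubeMinusVertex G j g h i a b c) (hG : IsCubic G) (h3 : G.IsThreeEdgeConnected)
    {z p q : V} (hz : z ∉ [j, g, h, i, a, b, c]) (hp : p ∈ [j, g, h, i, a, b, c])
    (hq : q ∈ [j, g, h, i, a, b, c]) (hpq : p ≠ q) (hzp : G.Adj z p) (hzq : G.Adj z q) (y : V) :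
    y ∈ [j, g, h, i, a, b, c, z] := by
  have hS : ∀ y, y ∈ ({c, b, a, i, h, g, j} : Finset V) ↔ y ∈ [j, g, h, i, a, b, c] := fun y => by
    simp only [Finset.mem_insert, Finset.mem_singleton, List.mem_cons, List.not_mem_nil, or_false]
    grind
  have hle := hQ.cutSize_le hG
  have hins := cutSize_insert hG (fun h => hz ((hS z).1 h))
  have h2 : 2 ≤ G.edgeCount {z} {c, b, a, i, h, g, j} := by
    refine le_trans ?_ (edgeCount_mono_right (A := {p, q}) (Finset.insert_subset ((hS p).2 hp)
      (Finset.singleton_subset_iff.2 ((hS q).2 hq))) {z})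
    rw [edgeCount_insert_right (by simpa using hpq), edgeCount_singleton_of_adj hzp,
      edgeCount_singleton_of_adj hzq]
  have hun : insert z ({c, b, a, i, h, g, j} : Finset V) = Finset.univ := by
    by_contra hne
    have := h3 _ (Finset.insert_nonempty _ _) hne
    omega
  have hy : y ∈ insert z ({c, b, a, i, h, g, j} : Finset V) := hun ▸ Finset.mem_univ y
  rw [Finset.mem_insert, hS] at hy
  simp only [List.mem_cons, List.not_mem_nil, or_false] at hy ⊢
  grind

/-- The cube minus a vertex is attached to three distinct vertices, unless the graph is the
cube. -/
lemma IsCubeMinusVertex.nodup_or_nonempty_iso [Fintype V] [DecidableEq V]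
    (hQ : IsCubeMinusVertex G j g h i a b c) (hG : IsCubic G) (h3 : G.IsThreeEdgeConnected)
    {d e f : V} (hA : IsAttached G j g h i a b c d e f) :
    [j, g, h, i, a, b, c, d, e, f].Nodup ∨ Nonempty (G ≃g cubeGraph) := by
  obtain ⟨ad, be, cf, hd, he, hf⟩ := hA
  have nd := hQ.nodup
  have iso : ∀ z, z ∉ [j, g, h, i, a, b, c] → (∀ y, y ∈ [j, g, h, i, a, b, c, z]) →
      Nonempty (G ≃g cubeGraph) := by
    intro z hz hall
    have only : ∀ y, y ∉ [j, g, h, i, a, b, c] → y = z := by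
      intro y hy
      have := hall y
      simp only [List.mem_cons, List.not_mem_nil, or_false] at this hy
      tauto
    have ez : e = z := only e he
    have fz : f = z := only f hf
    obtain rfl : d = z := only d hd
    rw [ez] at be
    rw [fz] at cf
    have nd8 : [j, g, h, i, a, b, c, d].Nodup := by
      have := List.nodup_append.2 ⟨nd, List.nodup_singleton d, fun x hx y hy hxy => by
        rw [List.mem_singleton] at hy; exact hz (by rwa [← hy, ← hxy])⟩
      exact this
    refine hQ.nonempty_iso hG nd8 ad be cf ?_
    rw [← Finset.card_univ, show (Finset.univ : Finset V) = [j, g, h, i, a, b, c, d].toFinset by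
      ext y; simpa using hall y, List.toFinset_card_of_nodup nd8]
    rfl
  simp only [List.nodup_cons, List.mem_cons, List.not_mem_nil, not_or, or_false] at nd
  by_cases hde : d = e
  · subst hde
    exact Or.inr (iso d hd (hQ.eq_of_two_adj hG h3 hd (p := a) (q := b) (by simp) (by simp)
      (by grind) ad.symm be.symm))
  by_cases hdf : d = f
  · subst hdf
    exact Or.inr (iso d hd (hQ.eq_of_two_adj hG h3 hd (p := a) (q := c) (by simp) (by simp)
      (by grind) ad.symm cf.symm))
  by_cases hef : e = f
  · subst hef
    exact Or.inr (iso e he (hQ.eq_of_two_adj hG h3 he (p := b) (q := c) (by simp) (by simp)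
      (by grind) be.symm cf.symm))
  left
  refine (List.nodup_append (l₁ := [j, g, h, i, a, b, c]) (l₂ := [d, e, f])).2
    ⟨hQ.nodup, by simp [hde, hdf, hef], ?_⟩
  rintro x hx y hy rfl
  simp only [List.mem_cons, List.not_mem_nil, or_false] at hy
  rcases hy with rfl | rfl | rfl
  exacts [hd hx, he hx, hf hx]

variable {d e f : V}

lemma IsCubeMinusVertex.isLinkage (hQ : IsCubeMinusVertex G j g h i a b c) (hG : IsCubic G)
    (hA : IsAttached G j g h i a b c d e f) (nd : [j, g, h, i, a, b, c, d, e, f].Nodup) :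
    IsLinkage G ![j, j, j] ![h, g, i] ![a, b, c] ![d, e, f] := by
  obtain ⟨ad, be, cf, -, -, -⟩ := hA
  obtain ⟨-, jg, jh, ji, ah, ai, bg, bh, cg, ci⟩ := hQ
  simp only [List.nodup_cons, List.mem_cons, List.not_mem_nil, not_or, or_false] at nd
  have kj : ∀ z, G.Adj j z → z = g ∨ z = h ∨ z = i := fun z hz =>
    hG.eq_of_adj jg jh ji (by grind) (by grind) (by grind) hz
  have kg : ∀ z, G.Adj g z → z = j ∨ z = b ∨ z = c := fun z hz =>
    hG.eq_of_adj jg.symm bg.symm cg.symm (by grind) (by grind) (by grind) hz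
  have kh : ∀ z, G.Adj h z → z = j ∨ z = a ∨ z = b := fun z hz =>
    hG.eq_of_adj jh.symm ah.symm bh.symm (by grind) (by grind) (by grind) hz
  have ki : ∀ z, G.Adj i z → z = j ∨ z = a ∨ z = c := fun z hz =>
    hG.eq_of_adj ji.symm ai.symm ci.symm (by grind) (by grind) (by grind) hz
  have ka : ∀ z, G.Adj a z → z = d ∨ z = h ∨ z = i := fun z hz =>
    hG.eq_of_adj ad ah ai (by grind) (by grind) (by grind) hz
  have kb : ∀ z, G.Adj b z → z = e ∨ z = g ∨ z = h := fun z hz =>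
    hG.eq_of_adj be bg bh (by grind) (by grind) (by grind) hz
  have kc : ∀ z, G.Adj c z → z = f ∨ z = g ∨ z = i := fun z hz =>
    hG.eq_of_adj cf cg ci (by grind) (by grind) (by grind) hz
  have nj : ∀ z ∈ [d, e, f], ¬ G.Adj j z := by
    intro z hz hjz
    simp only [List.mem_cons, List.not_mem_nil, or_false] at hz
    rcases kj z hjz with h | h | h <;> grind
  constructor
  · intro k; fin_cases k <;> assumption
  · intro k; fin_cases k; exacts [ah.symm, bg.symm, ci.symm]
  · intro k; fin_cases k; exacts [ad.symm, be.symm, cf.symm]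
  · intro k l hkl; fin_cases k <;> fin_cases l <;> first | rfl | (simp at hkl; grind)
  · intro k l hkl; fin_cases k <;> fin_cases l <;> first | rfl | (simp at hkl; grind)
  · intro k l; fin_cases k <;> fin_cases l <;> simp <;> grind
  · intro k l; fin_cases k <;> fin_cases l <;> simp <;> grind
  · intro k l; fin_cases k <;> fin_cases l <;> simp <;> grind
  · intro k l; fin_cases k <;> fin_cases l <;> simp <;> grind
  · intro k l; fin_cases k <;> fin_cases l <;> simp <;> grind
  · intro k; fin_cases k <;> simp <;> grind
  · intro k; fin_cases k <;> exact nj _ (by simp)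
  · intro k l hkl
    fin_cases k <;> fin_cases l <;> first | rfl | (simp at hkl; grind)
  · intro k z hz
    simp only [Fin.exists_fin_succ]
    fin_cases k
    · have := kh z hz; simp; grind
    · have := kg z hz; simp; grind
    · have := ki z hz; simp; grind
  · intro k z hz
    simp only [Fin.exists_fin_succ]
    fin_cases k
    · have := ka z hz; simp; grind
    · have := kb z hz; simp; grind
    · have := kc z hz; simp; grind

/-- Contracting the cube minus a vertex to a single vertex leads from a Barnette graph to a Barnette
graph: every cut of the new graph is one of the old graph. -/
theorem IsCubeMinusVertex.isC3CBP [Fintype V] [DecidableEq V]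
    (hQ : IsCubeMinusVertex G j g h i a b c) (M : PlaneEmbedding G) (hG : IsCubic G)
    (h3 : G.IsThreeEdgeConnected) (hb : G.IsBipartite)
    (hA : IsAttached G j g h i a b c d e f) (nd : [j, g, h, i, a, b, c, d, e, f].Nodup) :
    IsC3CBP ((G ⊔ edge j d ⊔ edge j e ⊔ edge j f).induce (({g, h, i, a, b, c} : Set V)ᶜ)) := by
  have L := hQ.isLinkage hG hA nd
  have hK : ∀ z, z ∈ (({g, h, i, a, b, c} : Set V)ᶜ) ↔
      ∀ k, z ≠ ![h, g, i] k ∧ z ≠ ![a, b, c] k := fun z => by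
    simp [Fin.forall_fin_succ]; tauto
  have hH : ∀ p q, (G ⊔ edge j d ⊔ edge j e ⊔ edge j f).Adj p q ↔
      G.Adj p q ∨ ∃ k, s(p, q) = s(![j, j, j] k, ![d, e, f] k) := fun p q => by
    simp only [sup_adj]
    rw [edge_adj_iff_of_ne (show j ≠ d from L.x_ne_y 0),
      edge_adj_iff_of_ne (show j ≠ e from L.x_ne_y 1),
      edge_adj_iff_of_ne (show j ≠ f from L.x_ne_y 2)]
    simp [Fin.exists_fin_succ, or_assoc]
  set T : Finset V := {g, h, i, a, b, c}ᶜ with hT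
  have hTK : ∀ z, z ∈ T ↔ z ∈ (({g, h, i, a, b, c} : Set V)ᶜ) := fun z => by simp [hT]
  refine L.isC3CBP hK (fun p q _ _ => hH p q) M hG hb hTK ?_
  intro A hA hA0 hAT
  -- the six deleted vertices are put on the side of `j`
  by_cases hj : j ∈ A
  · have := L.edgeCount_lift_le hK (fun p q _ _ => hH p q) (C := Tᶜ) hTK hA
      (by simp [hT, hj, Fin.forall_fin_succ]) disjoint_compl_left
    have h := h3 (A ∪ Tᶜ) (hA0.mono Finset.subset_union_left) (fun h => hAT (by
      refine hA.antisymm fun z hz => ?_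
      have hz' : z ∈ A ∪ Tᶜ := h ▸ Finset.mem_univ z
      simpa [hz] using hz'))
    rw [Finset.sdiff_self, edgeCount_empty_right] at this
    omega
  · have := L.edgeCount_lift_le hK (fun p q _ _ => hH p q) (C := ∅) hTK hA
      (by simp [hj, Fin.forall_fin_succ]) (Finset.disjoint_empty_left _)
    have h := h3 (A ∪ ∅) (hA0.mono Finset.subset_union_left) (fun h => by
      have hz' : j ∈ A ∪ ∅ := h ▸ Finset.mem_univ _
      rw [Finset.union_empty] at hz'
      exact hj hz')
    rw [edgeCount_empty_left] at this
    omega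

end SimpleGraph

/-! ### Squares from 4-faces -/

namespace SimpleGraph

section Square

variable {V : Type*} {G : SimpleGraph V}

/-- A 4-cycle together with a common neighbour of two opposite vertices of it would be a set of five
vertices with three outgoing edges. -/
lemma not_adj_both_of_fourCycle [Fintype V] [DecidableEq V] (hG : IsCubic G)
    (h3 : G.IsThreeEdgeConnected) (h7 : ∀ X, G.cutSize X = 3 → 1 < X.card → 7 ≤ X.card)
    {p q r s w : V} (hpq : G.Adj p q) (hqr : G.Adj q r) (hrs : G.Adj r s) (hsp : G.Adj s p)
    (hpr : p ≠ r) (hqs : q ≠ s) (hwq : w ≠ q) (hws : w ≠ s) (hpw : G.Adj p w) : ¬ G.Adj r w := by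
  intro hrw
  have n1 : p ∉ ({w} : Finset V) := by simpa using hpw.ne
  have n2 : r ∉ ({p, w} : Finset V) := by simpa using ⟨hpr.symm, hrw.ne⟩
  have n3 : q ∉ ({r, p, w} : Finset V) := by simpa using ⟨hqr.ne, hpq.ne', hwq.symm⟩
  have n4 : s ∉ ({q, r, p, w} : Finset V) := by
    simpa using ⟨hqs.symm, hrs.ne', hsp.ne, hws.symm⟩
  have c0 := cutSize_singleton hG w
  have c1 := cutSize_insert hG n1
  have c2 := cutSize_insert hG n2
  have c3 := cutSize_insert hG n3
  have c4 := cutSize_insert hG n4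
  have two : ∀ {x : V} {S : Finset V}, G.Adj x p → G.Adj x r → p ∈ S → r ∈ S →
      2 ≤ G.edgeCount {x} S := fun {x S} hp hr hpS hrS => by
    refine le_trans ?_ (edgeCount_mono_right (A := {p, r}) (B := S)
      (Finset.insert_subset hpS (Finset.singleton_subset_iff.2 hrS)) {x})
    rw [edgeCount_insert_right (by simpa using hpr), edgeCount_singleton_of_adj hp,
      edgeCount_singleton_of_adj hr]
  have e1 : 0 < G.edgeCount {p} {w} := edgeCount_pos (by simp) (by simp) hpw
  have e2 : 0 < G.edgeCount {r} {p, w} :=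
    edgeCount_pos (Finset.mem_singleton_self _) (by simp) hrw
  have e3 : 2 ≤ G.edgeCount {q} {r, p, w} := two hpq.symm hqr (by simp) (by simp)
  have e4 : 2 ≤ G.edgeCount {s} {q, r, p, w} := two hsp hrs.symm (by simp) (by simp)
  have hcard : ({s, q, r, p, w} : Finset V).card = 5 := by
    rw [Finset.card_insert_of_notMem n4, Finset.card_insert_of_notMem n3,
      Finset.card_insert_of_notMem n2, Finset.card_insert_of_notMem n1, Finset.card_singleton]
  have hpar := cutSize_mod_two hG {s, q, r, p, w}
  rw [hcard] at hpar
  have hne : ({s, q, r, p, w} : Finset V) ≠ Finset.univ := by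
    intro hun
    rw [hun, cutSize, Finset.compl_univ, edgeCount_empty_right] at hpar
    omega
  have hge := h3 _ (Finset.insert_nonempty _ _) hne
  have := h7 {s, q, r, p, w} (by omega) (by omega)
  omega

/-- A 4-cycle in a bipartite cubic graph without small 3-edge cuts is a square. -/
theorem exists_isSquare [Fintype V] [DecidableEq V] (hG : IsCubic G) (h3 : G.IsThreeEdgeConnected)
    (f : G.Coloring (Fin 2)) (h7 : ∀ X, G.cutSize X = 3 → 1 < X.card → 7 ≤ X.card) {v : Fin 4 → V}
    (hv : ∀ i, G.Adj (v i) (v (i + 1))) (hv2 : ∀ i, v i ≠ v (i + 2)) : ∃ u, IsSquare G v u := by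
  choose u hu hu1 hu3 using fun i => hG.exists_third (x := v i) (a := v (i + 1)) (b := v (i + 3))
  have e1 : ∀ i : Fin 4, i + 1 + 1 = i + 2 := by decide
  have e2 : ∀ i : Fin 4, i + 2 + 1 = i + 3 := by decide
  have e3 : ∀ i : Fin 4, i + 3 + 1 = i := by decide
  have e4 : ∀ i : Fin 4, i + 1 + 2 = i + 3 := by decide
  have hcases : ∀ i k : Fin 4, k = i ∨ k = i + 1 ∨ k = i + 2 ∨ k = i + 3 := by decide
  have a1 := hv
  have a2 : ∀ i, G.Adj (v (i + 1)) (v (i + 2)) := fun i => e1 i ▸ hv (i + 1)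
  have a3 : ∀ i, G.Adj (v (i + 2)) (v (i + 3)) := fun i => e2 i ▸ hv (i + 2)
  have a4 : ∀ i, G.Adj (v (i + 3)) (v i) := fun i => by
    have := hv (i + 3)
    rwa [e3] at this
  have hv13 : ∀ i, v (i + 1) ≠ v (i + 3) := fun i => e4 i ▸ hv2 (i + 1)
  have hcol : ∀ i, f (v (i + 2)) = f (v i) := fun i => by
    have h1 := f.valid (a1 i)
    have h2 := f.valid (a2 i)
    omega
  have hopp : ∀ i, u i ≠ u (i + 2) := fun i h =>
    not_adj_both_of_fourCycle hG h3 h7 (a1 i) (a2 i) (a3 i) (a4 i) (hv2 i) (hv13 i)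
      (hu1 i) (hu3 i) (hu i) (h ▸ hu (i + 2))
  refine ⟨u, hv, hu, ?_, ?_, ?_⟩
  · intro i k hik
    rcases hcases i k with rfl | rfl | rfl | rfl
    · rfl
    · exact absurd hik (a1 i).ne
    · exact absurd hik (hv2 i)
    · exact absurd hik (a4 i).ne'
  · intro i k hik
    have c1 := f.valid (hu i)
    have c2 := f.valid (hu k)
    have c3 : f (u i) = f (u k) := by rw [hik]
    rcases hcases i k with rfl | rfl | rfl | rfl
    · rfl
    · have := f.valid (a1 i)
      omega
    · exact absurd hik (hopp i)
    · have := f.valid (a4 i)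
      omega
  · intro k i hki
    rcases hcases i k with rfl | rfl | rfl | rfl
    · exact (hu k).ne hki
    · exact hu1 i hki.symm
    · exact f.valid (hu i) (by rw [← hki, hcol])
    · exact hu3 i hki.symm

/-- Some 4-face can be reduced to a Barnette graph, unless there is a cube minus a vertex. The
4-face is taken inside a smallest nontrivial side of a 3-edge cut. -/
theorem exists_isC3CBP_or_isCubeMinusVertex [Fintype V] [DecidableEq V] (M : PlaneEmbedding G)
    (hG : IsCubic G) (h3 : G.IsThreeEdgeConnected) (f : G.Coloring (Fin 2)) [Nonempty V] :
    (∃ v u, IsSquare G v u ∧ M.IsFourFace (v 0) (v 1) (v 2) (v 3) ∧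
      IsC3CBP ((squareSup G u).induce (({v 0, v 1, v 2, v 3} : Set V)ᶜ))) ∨
    ∃ j g h i a b c, IsCubeMinusVertex G j g h i a b c := by
  have h7 := fun X (hX : G.cutSize X = 3) (hX1 : 1 < X.card) =>
    seven_le_card_of_cutSize_eq_three M hG h3 f hX hX1
  obtain ⟨X, hXmem, hmin⟩ : ∃ X ∈ Finset.univ.filter fun X => G.cutSize X = 3 ∧ 1 < X.card,
      ∀ Y ∈ Finset.univ.filter fun X => G.cutSize X = 3 ∧ 1 < X.card, X.card ≤ Y.card := by
    refine Finset.exists_min_image _ _ ?_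
    let p : V := Classical.arbitrary V
    refine ⟨{p}ᶜ, Finset.mem_filter.2 ⟨Finset.mem_univ _, ?_, ?_⟩⟩
    · rw [cutSize_compl, cutSize_singleton hG]
    · obtain ⟨q, hq, -⟩ := hG.exists_third (x := p) (a := p) (b := p)
      obtain ⟨r, hr, hrq, -⟩ := hG.exists_third (x := p) (a := q) (b := q)
      exact Finset.one_lt_card.2
        ⟨q, by simpa using hq.ne', r, by simpa using hr.ne', hrq.symm⟩
  simp only [Finset.mem_filter, Finset.mem_univ, true_and] at hXmem hmin
  obtain ⟨hX, hX1⟩ := hXmem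
  obtain ⟨d, h4, hin⟩ := exists_fourFace_within M hG h3 f hX hX1
  set φ := facePerm M.rot with hφ
  replace h4 : φ (φ (φ (φ d))) = d := h4
  let v : Fin 4 → V := ![d.fst, (φ d).fst, (φ (φ d)).fst, (φ (φ (φ d))).fst]
  have hvX : ∀ i, v i ∈ X := by
    intro i
    fin_cases i
    exacts [hin 0, hin 1, hin 2, hin 3]
  have hadj : ∀ e : G.Dart, G.Adj e.fst (φ e).fst := fun e => by
    rw [hφ, facePerm_fst M.rot_fst]
    exact e.adj
  have hne : ∀ e : G.Dart, e.fst ≠ (φ (φ e)).fst := fun e => by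
    rw [hφ, facePerm_fst M.rot_fst]
    exact (snd_rot_ne hG M.rot_fst M.rot_cyclic e.symm).symm
  have hv : ∀ i, G.Adj (v i) (v (i + 1)) := by
    intro i
    fin_cases i
    · exact hadj d
    · exact hadj _
    · exact hadj _
    · have := hadj (φ (φ (φ d)))
      rwa [h4] at this
  have hv2 : ∀ i, v i ≠ v (i + 2) := by
    intro i
    fin_cases i
    · exact hne d
    · exact hne _
    · have := hne (φ (φ d))
      rwa [h4] at this
    · have := hne (φ (φ (φ d)))
      rwa [h4] at this
  obtain ⟨u, hs⟩ := exists_isSquare hG h3 f h7 hv hv2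
  rcases hs.isC3CBP_or M hG h3 ⟨f⟩ with hB | ⟨Y, hY⟩
  · exact Or.inl ⟨v, u, hs, ⟨d, rfl, rfl, rfl, rfl, h4⟩, hB⟩
  rcases (hs.rotate 1).isC3CBP_or M hG h3 ⟨f⟩ with hB | ⟨Z, hZ⟩
  · exact Or.inl ⟨_, _, hs.rotate 1, ⟨φ d, rfl, rfl, rfl, congrArg (fun e : G.Dart => e.fst) h4,
      congrArg φ h4⟩, hB⟩
  · obtain ⟨R, hR⟩ := exists_isCubeLike hG h3 hs hY hZ
    exact Or.inr (hR.exists_isCubeMinusVertex hG h3 hs hX hvX fun Y h1 h2 => hmin Y ⟨h1, h2⟩)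

/-- Bipartite cubic graphs have at least six vertices: the neighbourhoods of two adjacent vertices
are disjoint. -/
lemma six_le_card [Finite V] [Nonempty V] (hG : IsCubic G) (hb : G.IsBipartite) :
    6 ≤ Nat.card V := by
  obtain ⟨f⟩ := hb
  let x : V := Classical.arbitrary V
  obtain ⟨y, hxy⟩ := hG.exists_adj x
  have hd : Disjoint (G.neighborSet x) (G.neighborSet y) := by
    rw [Set.disjoint_left]
    intro z hx hy
    have h1 := f.valid hxy
    have h2 := f.valid (show G.Adj x z from hx)
    have h3 := f.valid (show G.Adj y z from hy)
    omega
  have h := Set.ncard_union_eq hd (Set.toFinite _) (Set.toFinite _)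
  rw [hG, hG] at h
  rw [← Set.ncard_univ, show 6 = 3 + 3 from rfl, ← h]
  exact Set.ncard_le_ncard (Set.subset_univ _) (Set.toFinite _)

end Square

end SimpleGraph

/-! ### Generating Barnette graphs -/

open SimpleGraph

section Main

variable {V V' : Type u} {G : SimpleGraph V} {G' : SimpleGraph V'}

lemma ReducesR0.card_add_four [Finite V] (h : ReducesR0 G G') : Nat.card V' + 4 = Nat.card V := by
  obtain ⟨M, v₀, v₁, v₂, v₃, u₀, u₁, u₂, u₃, nd, -, -, -, -, -, ⟨e⟩⟩ := h
  rw [Nat.card_congr e.toEquiv, Nat.card_coe_set_eq,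
    ← Set.ncard_add_ncard_compl ({v₀, v₁, v₂, v₃} : Set V), add_comm]
  congr 1
  classical
  have nd' : [v₀, v₁, v₂, v₃].Nodup := nd.sublist (List.sublist_append_left _ [u₀, u₁, u₂, u₃])
  rw [show ({v₀, v₁, v₂, v₃} : Set V) = ([v₀, v₁, v₂, v₃].toFinset : Set V) by simp,
    Set.ncard_coe_finset, List.toFinset_card_of_nodup nd']
  rfl

lemma ReducesR4.card_add_six [Finite V] (h : ReducesR4 G G') : Nat.card V' + 6 = Nat.card V := by
  obtain ⟨j, g, h, i, a, b, c, d, e, f, nd, -, -, -, -, -, -, -, -, -, -, -, -, ⟨iso⟩⟩ := h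
  rw [Nat.card_congr iso.toEquiv, Nat.card_coe_set_eq,
    ← Set.ncard_add_ncard_compl ({g, h, i, a, b, c} : Set V), add_comm]
  congr 1
  classical
  have nd' : [g, h, i, a, b, c].Nodup :=
    (List.nodup_cons.1 nd).2.sublist (List.sublist_append_left _ [d, e, f])
  rw [show ({g, h, i, a, b, c} : Set V) = ([g, h, i, a, b, c].toFinset : Set V) by simp,
    Set.ncard_coe_finset, List.toFinset_card_of_nodup nd']
  rfl

lemma card_lt_of_reduces [Finite V] (h : ReducesR0 G G' ∨ ReducesR4 G G') :
    Nat.card V' < Nat.card V := by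
  rcases h with h | h
  · have := h.card_add_four
    omega
  · have := h.card_add_six
    omega

/-- Every Barnette graph other than the cube can be reduced to a Barnette graph. -/
theorem IsC3CBP.nonempty_iso_or_exists_reduces [Finite V] (hB : IsC3CBP G) :
    Nonempty (G ≃g cubeGraph) ∨ ∃ (V' : Type u) (_ : Finite V') (G' : SimpleGraph V'),
      IsC3CBP G' ∧ (ReducesR0 G G' ∨ ReducesR4 G G') := by
  classical
  have := Fintype.ofFinite V
  obtain ⟨hG, hk, ⟨f⟩, ⟨M⟩⟩ := hB
  have h3 := hk.isThreeEdgeConnected hG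
  have hne : Nonempty V := Nat.card_pos_iff.1 (Nat.zero_lt_of_lt hk.1) |>.1
  rcases exists_isC3CBP_or_isCubeMinusVertex M hG h3 f with
    ⟨v, u, hs, hF, hB⟩ | ⟨j, g, h, i, a, b, c, hQ⟩
  · refine Or.inr ⟨_, inferInstance, _, hB, Or.inl ⟨M, v 0, v 1, v 2, v 3, u 0, u 1, u 2, u 3, ?_,
      hF, hs.adj_out 0, hs.adj_out 1, hs.adj_out 2, hs.adj_out 3, ⟨Iso.refl⟩⟩⟩
    have nv : (List.ofFn v).Nodup := List.nodup_ofFn.2 hs.v_inj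
    have nu : (List.ofFn u).Nodup := List.nodup_ofFn.2 hs.u_inj
    have := List.nodup_append.2 ⟨nv, nu, fun x hx y hy => by
      obtain ⟨k, rfl⟩ := List.mem_ofFn.1 hx
      obtain ⟨l, rfl⟩ := List.mem_ofFn.1 hy
      exact hs.ne k l⟩
    simpa [List.ofFn_succ] using this
  · obtain ⟨d, e, k, hA⟩ := hQ.exists_isAttached hG f
    rcases hQ.nodup_or_nonempty_iso hG h3 hA with nd | hiso
    · exact Or.inr ⟨_, inferInstance, _, hQ.isC3CBP M hG h3 ⟨f⟩ hA nd, Or.inr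
        ⟨j, g, h, i, a, b, c, d, e, k, nd, hQ.jg, hQ.jh, hQ.ji, hQ.ah, hQ.ai, hQ.bg, hQ.bh, hQ.cg,
          hQ.ci, hA.ad, hA.be, hA.cf, ⟨Iso.refl⟩⟩⟩
    · exact Or.inl hiso

/-- On at most eight vertices no reduction leads to a Barnette graph, since at most four vertices
would remain, too few for one. -/
lemma IsC3CBP.nonempty_iso_of_card_le [Finite V] (hB : IsC3CBP G) (hV : Nat.card V ≤ 8) :
    Nonempty (G ≃g cubeGraph) := by
  rcases hB.nonempty_iso_or_exists_reduces with h | ⟨V', _, G', hB', hR⟩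
  · exact h
  have hne : Nonempty V' := Nat.card_pos_iff.1 (Nat.zero_lt_of_lt hB'.connected.1) |>.1
  have h6 := six_le_card hB'.cubic hB'.bipartite
  rcases hR with h | h
  · have := h.card_add_four
    omega
  · have := h.card_add_six
    omega

lemma IsC3CBP.alwaysReducesToCube [Finite V] (hB : IsC3CBP G) : AlwaysReducesToCube G := by
  induction hn : Nat.card V using Nat.strong_induction_on generalizing V with
  | _ n ih =>
    rcases hB.nonempty_iso_or_exists_reduces with h | h
    · exact .cube h
    · refine .step h fun V' _ G' hB' hR => ?_
      exact ih _ (hn ▸ card_lt_of_reduces hR) hB' rfl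

lemma AlwaysReducesToCube.generatedFromCube {V : Type u} [Finite V] {G : SimpleGraph V}
    (h : AlwaysReducesToCube G) (hB : IsC3CBP G) : GeneratedFromCube G := by
  induction h with
  | cube h => exact .cube h
  | step h _ ih =>
    obtain ⟨V', _, G', hB', hR⟩ := h
    have hgen := ih V' G' hB' hR hB'
    rcases hR with hR | hR
    · exact .reverseR0 hgen hB hR
    · exact .reverseR4 hgen hB hR

end Main

theorem mainTheorem1 :
    (∀ (V : Type u) [Finite V] (G : SimpleGraph V), IsC3CBP G → 8 < Nat.card V →
      ∃ (V' : Type u) (_ : Finite V') (G' : SimpleGraph V'),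
        IsC3CBP G' ∧ Nat.card V' < Nat.card V ∧ (ReducesR0 G G' ∨ ReducesR4 G G')) ∧
    IsC3CBP cubeGraph ∧
    (∀ (V : Type u) [Finite V] (G : SimpleGraph V), IsC3CBP G → Nat.card V ≤ 8 →
      Nonempty (G ≃g cubeGraph)) ∧
    (∀ (V : Type u) [Finite V] (G : SimpleGraph V), IsC3CBP G → AlwaysReducesToCube G) ∧
    (∀ (V : Type u) [Finite V] (G : SimpleGraph V), IsC3CBP G → GeneratedFromCube G) := by
  refine ⟨fun V _ G hB hV => ?_, isC3CBP_cubeGraph,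
    fun V _ G hB hV => hB.nonempty_iso_of_card_le hV, fun V _ G hB => hB.alwaysReducesToCube,
    fun V _ G hB => hB.alwaysReducesToCube.generatedFromCube hB⟩
  rcases hB.nonempty_iso_or_exists_reduces with ⟨⟨e⟩⟩ | ⟨V', hf, G', hB', hR⟩
  · rw [Nat.card_congr e.toEquiv, Nat.card_eq_fintype_card, Fintype.card_fin] at hV
    omega
  · exact ⟨V', hf, G', hB', card_lt_of_reduces hR, hR⟩
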